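/- **Setting.** Let $m\ge 2$ and let $S_j(x)=\rho_jx+b_j$ ($1\le j\le m$) be similitudes of $\mathbb R$ with $0<\rho_j<1$, $S_j((0,1))\subseteq(0,1)$ for all $j$, $S_1(0)=0$ and $S_m(1)=1$. Let $K$ be the attractor, i.e. the non-empty compact set with $K=\bigcup_jS_j(K)$, let $\alpha=\dim_HK$, and assume $\alpha<1$. For a finite word $\mathbf i=(i_1,\dots,i_k)$ over $\{1,\dots,m\}$ put $S_{\mathbf i}=S_{i_1}\circ\cdots\circ S_{i_k}$. *Index sets.* Let $\mathcal M_0,\mathcal M_1,\dots$ be finite sets of words, $\mathcal M_0$ consisting of the empty word only, such that: the minimal and the maximal length of a word of $\mathcal M_k$ are non-decreasing in $k$ and tend to infinity; no word of $\mathcal M_k$ is an initial segment of another word of $\mathcal M_k$; every word longer than all words of $\mathcal M_k$ has an initial segment in $\mathcal M_k$; every word shorter than all words of $\mathcal M_k$ is an initial segment of a word of $\mathcal M_k$; and there is $L\ge1$ such that $|\mathbf j|-|\mathbf i|\le L$ whenever $\mathbf i\in\mathcal M_k$ is an initial segment of $\mathbf j\in\mathcal M_{k+1}$. Let $\mathcal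 V_k=\{S_{\mathbf i}:\mathbf i\in\mathcal M_k\}$ and $U_k=\bigcup_{f\in\mathcal V_k}f((0,1))$, and assume that $U_0\supseteq U_1\supseteq\cdots$. *Islands.* The $k$-th generation islands are the closures of the connected components of $U_k$; an island is always taken together with its generation. For an island $I$ of generation $k$ let $V(I)=\{f\in\mathcal V_k: f([0,1])\subseteq I\}$; the intervals $f([0,1])$, $f\in V(I)$, are its constitutive intervals. An offspring of $I$ is an island of generation $k+1$ contained in $I$. The lakes of generation $k$ are the (possibly empty) open intervals between neighbouring islands of generation $k$; two neighbouring islands touch if the lake between them is empty. Islands $I,I'$ of generations $k,k'$ are equivalent if there is an affine map $\tau$ of $I$ onto $I'$ with $V(I')=\{\tau\circ f:f\in V(I)\}$ such that, for each $l\ge1$, $J\mapsto\tau(J)$ maps the islands of generation $k+l$ in $I$ onto the islands of generation $k'+l$ in $I'$. Equivalence classes are called overlap types. Assume that there are only finitely many overlap types $\mathcal T_1,\dots,\mathcal T_q$, and that the matrix $A_\alpha(i,j)=\sum\{(|J|/|I|)^\alpha: J\text{ an offspring of }I\text{ of type }\mathcal T_j\}$, where $I$ is a chosen island of type $\mathcal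 T_i$, is irreducible. Let $k_0\ge 0$ be the smallest integer such that every overlap type of an island of generation $k_0+1$ already occurs in one of the generations $0,\dots,k_0$. *Assumption A.* For any two different constitutive intervals of an island, neither contains the other. *Assumption B.* $S_1([0,1])\cap K=S_1(K)$ and $S_m([0,1])\cap K=S_m(K)$. *Notation.* Let $\lambda=\mathcal H^\alpha|_K/\mathcal H^\alpha(K)$, let $d(J)=\lambda(J)/|J|^\alpha$ for a non-degenerate interval $J$, and let $d_{\max}$ be the supremum of $d(J)$ over all non-degenerate intervals $J\subseteq[0,1]$. Put $\underline D_0=\inf_{0<x\le1}d([0,x])$ and $\underline D_1=\inf_{0<x\le1}d([1-x,1])$. Let $\beta^{(k)}_{\max}$ and $\beta^{(k)}_{\min}$ be the largest and the smallest length of a $k$-th generation island, and $\gamma_{\min}^{*(k)}$ the smallest length of a non-empty lake of generation $k$. For an island $I=[c,d]$ let $v_0,v_1\in V(I)$ be the maps with $v_0(0)=c$ and $v_1(1)=d$, with contraction ratios $\rho_{v_0},\rho_{v_1}$. Let $p_0(I)\ge0$ be the smallest integer $p$ such that $v_0S_1^p(1)<f(0)$ for all $f\in V(I)\setminus\{v_0\}$,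 and $p_1(I)\ge0$ the smallest integer $p$ such that $v_1S_m^p(0)>f(1)$ for all $f\in V(I)\setminus\{v_1\}$. Put $\eta=\eta_1\eta_2$ with $\eta_1=\min_I\min\{\rho_{v_0}/|I|,\rho_{v_1}/|I|\}$ and $\eta_2=\min_I\min\{\rho_1^{p_0(I)},\rho_m^{p_1(I)}\}$, where $I$ runs over all islands of all generations. An interval in $\mathcal F_k$ is an interval $[x,y]$, $x<y$, where $x$ is the left endpoint of a $k$-th generation island and $y$ is the right endpoint of a $k$-th generation island. **Theorem 4.12.** In this setting, and under Assumptions A and B, suppose that there are two touching islands of generation $k_0+1$, and that $\rho_1,\rho_m$ are non-arithmetic: $\rho_1^{n_1}\ne\rho_m^{n_m}$ for all positive integers $n_1,n_m$. Let $k,k_1,k_2\ge 0$ be the smallest integers (which exist) such that $$2\beta^{(k)}_{\max}\le\Bigl(\eta\,\min\{\beta^{(k_0+1)}_{\min},\gamma_{\min}^{*(k_0+1)}\}\,\min\{\underline D_0,\underline D_1\}\Bigr)^{\frac1{1-\alpha}},$$ $$\beta^{(k_1)}_{\max}\le(\rho_1\underline D_1)^{\frac1{1-\alpha}},\qquad \beta^{(k_2)}_{\max}\le(\rho_m\underline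 D_0)^{\frac1{1-\alpha}}.$$ Then $d_{\max}$ is equal to the maximum of the following two finite families of values: $d(I)$, where $I$ varies over all intervals in $\mathcal F_k$; and $\bigl(d(I_1)^{1/(1-\alpha)}+d(I_2)^{1/(1-\alpha)}\bigr)^{1-\alpha}$, where $I_1$ varies over all intervals of the form $[0,x]$ in $\mathcal F_{k_1}$ and $I_2$ over all intervals of the form $[y,1]$ in $\mathcal F_{k_2}$. -/

import Mathlib

open Set Filter MeasureTheory

noncomputable section

/-- An iterated function system `S_j(x) = ρ_j x + b_j` (`j : Fin m`) of orientation preserving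
contractive similitudes of the line. -/
structure LinearIFS (m : ℕ) where
  ρ : Fin m → ℝ
  b : Fin m → ℝ
  ρ_pos : ∀ j, 0 < ρ j
  ρ_lt_one : ∀ j, ρ j < 1

namespace LinearIFS

variable {m : ℕ}

/-- The similitude `S_j`. -/
def map (S : LinearIFS m) (j : Fin m) (x : ℝ) : ℝ := S.ρ j * x + S.b j

/-- The composition `S_i = S_{i_1} ∘ ⋯ ∘ S_{i_k}` along a finite word `i = (i_1, …, i_k)`;
the empty word gives the identity. -/
def wordMap (S : LinearIFS m) : List (Fin m) → ℝ → ℝ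
  | [] => id
  | j :: w => S.map j ∘ wordMap S w

/-- `K` is the attractor of the system: the (unique) non-empty compact set with
`K = ⋃ j, S_j(K)`. -/
def IsAttractor (S : LinearIFS m) (K : Set ℝ) : Prop :=
  IsCompact K ∧ K.Nonempty ∧ K = ⋃ j, S.map j '' K

end LinearIFS

/-- The minimal length of a word in a finite set of words. -/
def minLength {m : ℕ} (A : Finset (List (Fin m))) : ℕ := sInf (List.length '' (A : Set (List (Fin m))))

/-- The maximal length of a word in a finite set of words. -/
def maxLength {m : ℕ} (A : Finset (List (Fin m))) : ℕ := A.sup List.length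

/-- A sequence of nested index sets `M_0, M_1, …` over the alphabet `Fin m`. The relation
`i <+: j` says that `i` is an initial segment of `j`. -/
structure IsNestedIndexSeq {m : ℕ} (M : ℕ → Finset (List (Fin m))) : Prop where
  zero : M 0 = {[]}
  min_mono : Monotone fun k => minLength (M k)
  min_tendsto : Tendsto (fun k => minLength (M k)) atTop atTop
  max_mono : Monotone fun k => maxLength (M k)
  max_tendsto : Tendsto (fun k => maxLength (M k)) atTop atTop
  incomparable : ∀ k, ∀ i ∈ M k, ∀ j ∈ M k, i ≠ j → ¬ i <+: j
  exists_prefix : ∀ k, ∀ j : List (Fin m), maxLength (M k) < j.length → ∃ i ∈ M k, i <+: j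
  exists_extension : ∀ k, ∀ j : List (Fin m), j.length < minLength (M k) → ∃ i ∈ M k, j <+: i
  bounded_gap : ∃ L : ℕ, 0 < L ∧ ∀ k, ∀ i ∈ M k, ∀ j ∈ M (k + 1), i <+: j →
    j.length - i.length ≤ L

section Islands

variable {m : ℕ} (S : LinearIFS m) (M : ℕ → Finset (List (Fin m)))

/-- The `k`-th generation vertices `S_v`, as a set of maps. (The generation is recorded separately,
and words with the same map give the same vertex.) -/
def vertices (k : ℕ) : Set (ℝ → ℝ) := {f | ∃ w ∈ M k, f = S.wordMap w}

/-- The open set `⋃_{v ∈ V_k} S_v((0,1))`. -/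
def openUnion (k : ℕ) : Set ℝ := ⋃ f ∈ vertices S M k, f '' Ioo 0 1

/-- `[a, b]` is a `k`-th generation island: the closure of a connected component `(a, b)` of
the open set `⋃_{v ∈ V_k} S_v((0,1))`. -/
def IsIsland (k : ℕ) (a b : ℝ) : Prop :=
  ∃ x ∈ openUnion S M k, connectedComponentIn (openUnion S M k) x = Ioo a b

/-- For an island `[a, b]` of generation `k`: the set `V([a, b])` of the vertices of generation
`k` whose intervals `S_v([0,1])` (the constitutive intervals) lie in `[a, b]`. -/
def constituents (k : ℕ) (a b : ℝ) : Set (ℝ → ℝ) :=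
  {f | f ∈ vertices S M k ∧ f '' Icc 0 1 ⊆ Icc a b}

/-- An island `[left, right]`, together with its generation. -/
structure Island where
  level : ℕ
  left : ℝ
  right : ℝ
  isIsland : IsIsland S M level left right

variable {S M}

/-- The vertex set `V(I)` of an island. -/
def Island.V (I : Island S M) : Set (ℝ → ℝ) := constituents S M I.level I.left I.right

/-- The length `|I|` of an island. -/
def Island.length (I : Island S M) : ℝ := I.right - I.left

/-- Equivalence of islands: some affine map `τ(x) = s x + t` maps `I` onto `I'`, carries the
maps `S_v`, `v ∈ V(I)`, onto the maps `S_v'`, `v' ∈ V(I')`, by `S_v ↦ τ ∘ S_v`, and carries, for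
every `l ≥ 1`, the islands `l` generations below `I` contained in `I` exactly onto the islands `l`
generations below `I'` contained in `I'`. (All contraction ratios being positive,
`S_v' = τ ∘ S_v` is only possible with `s > 0`.) -/
def Island.Equivalent (I I' : Island S M) : Prop :=
  ∃ s t : ℝ, 0 < s ∧ s * I.left + t = I'.left ∧ s * I.right + t = I'.right ∧
    I'.V = (fun f => (fun x => s * x + t) ∘ f) '' I.V ∧
    ∀ l : ℕ, 1 ≤ l → ∀ c d : ℝ,
      (IsIsland S M (I.level + l) c d ∧ Icc c d ⊆ Icc I.left I.right) ↔
      (IsIsland S M (I'.level + l) (s * c + t) (s * d + t) ∧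
        Icc (s * c + t) (s * d + t) ⊆ Icc I'.left I'.right)

theorem Island.Equivalent.refl (I : Island S M) : I.Equivalent I := by
  refine ⟨1, 0, one_pos, by ring, by ring, ?_, ?_⟩
  · have : (fun f : ℝ → ℝ => (fun x => 1 * x + 0) ∘ f) = id := by
      funext f x; simp
    rw [this, Set.image_id]
  · intro l _ c d; simp

theorem Island.Equivalent.symm {I J : Island S M} (h : I.Equivalent J) : J.Equivalent I := by
  obtain ⟨s, t, hs, hl, hr, hV, hI⟩ := h
  have hs' := hs.ne'
  have key : ∀ x, s * (s⁻¹ * x + -(s⁻¹ * t)) + t = x := fun x => by field_simp; ring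
  have key' : ∀ x, s⁻¹ * (s * x + t) + -(s⁻¹ * t) = x := fun x => by field_simp; ring
  refine ⟨s⁻¹, -(s⁻¹ * t), inv_pos.mpr hs, ?_, ?_, ?_, ?_⟩
  · rw [← hl, key']
  · rw [← hr, key']
  · rw [hV, Set.image_image]
    have : (fun f : ℝ → ℝ => (fun x => s⁻¹ * x + -(s⁻¹ * t)) ∘ (fun x => s * x + t) ∘ f) = id := by
      funext f x; simp only [Function.comp, key', id]
    rw [this, Set.image_id]
  · intro l hl1 c d
    have := hI l hl1 (s⁻¹ * c + -(s⁻¹ * t)) (s⁻¹ * d + -(s⁻¹ * t))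
    rw [key, key] at this
    exact this.symm

theorem Island.Equivalent.trans {I J L : Island S M} (h : I.Equivalent J) (h' : J.Equivalent L) :
    I.Equivalent L := by
  obtain ⟨s, t, hs, hl, hr, hV, hI⟩ := h
  obtain ⟨s', t', hs', hl', hr', hV', hI'⟩ := h'
  have key : ∀ x, s' * (s * x + t) + t' = s' * s * x + (s' * t + t') := fun x => by ring
  refine ⟨s' * s, s' * t + t', mul_pos hs' hs, ?_, ?_, ?_, ?_⟩
  · rw [← key, hl, hl']
  · rw [← key, hr, hr']
  · rw [hV', hV, Set.image_image]
    congr 1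
    funext f x
    simp only [Function.comp, key]
  · intro l hl1 c d
    rw [hI l hl1 c d, hI' l hl1 (s * c + t) (s * d + t), key, key]

variable (S M)

/-- Equivalence of islands as an equivalence relation. -/
instance islandSetoid : Setoid (Island S M) where
  r := Island.Equivalent
  iseqv := ⟨Island.Equivalent.refl, Island.Equivalent.symm, Island.Equivalent.trans⟩

/-- The overlap types: the equivalence classes of islands. -/
def OverlapType : Type := Quotient (islandSetoid S M)

variable {S M}

/-- The overlap type `[I]`. -/
def Island.type (I : Island S M) : OverlapType S M := Quotient.mk (islandSetoid S M) I

/-- `J` is an offspring of `I`. -/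
def Island.IsOffspring (J I : Island S M) : Prop :=
  J.level = I.level + 1 ∧ Icc J.left J.right ⊆ Icc I.left I.right

/-- The weighted incidence matrix `A_α`, computed with the island `rep T` of type `T`: the entry
at `(T, T')` is the (finite) sum of `(|J| / |rep T|)^α` over all offsprings `J` of `rep T` with
`[J] = T'`. -/
def weightedIncidence (rep : OverlapType S M → Island S M) (α : ℝ) :
    Matrix (OverlapType S M) (OverlapType S M) ℝ := fun T T' =>
  ∑ᶠ J ∈ {J : Island S M | J.IsOffspring (rep T) ∧ J.type = T'}, (J.length / (rep T).length) ^ α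

variable (S M)

/-- No island of generation `k + 1` is of a new overlap type, i.e. of an overlap type which does
not occur in the generations `0, …, k`. -/
def NoNewType (k : ℕ) : Prop :=
  ∀ I : Island S M, I.level = k + 1 → ∃ I' : Island S M, I'.level ≤ k ∧ I'.type = I.type

/-- Assumption A: for two different constitutive intervals of the same island, none is contained
in the other. -/
def AssumptionA : Prop :=
  ∀ I : Island S M, ∀ f ∈ I.V, ∀ g ∈ I.V, f ≠ g → ¬ f '' Icc 0 1 ⊆ g '' Icc 0 1

/-- `β_max^{(k)}`: the maximal length of a `k`-th generation island. -/
def betaMax (k : ℕ) : ℝ := sSup {r | ∃ I : Island S M, I.level = k ∧ r = I.length}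

/-- `β_min^{(k)}`: the minimal length of a `k`-th generation island. -/
def betaMin (k : ℕ) : ℝ := sInf {r | ∃ I : Island S M, I.level = k ∧ r = I.length}

/-- The lengths of the lakes `(b, c)` between neighbouring islands `[a, b]`, `[c, d]` of generation
`k`; the length is `0` (and the lake is empty) if the two islands touch. -/
def lakeLengths (k : ℕ) : Set ℝ :=
  {r | ∃ I J : Island S M, I.level = k ∧ J.level = k ∧ I.right ≤ J.left ∧
    (∀ L : Island S M, L.level = k → L.right ≤ I.right ∨ J.left ≤ L.left) ∧
    r = J.left - I.right}

/-- `γ*_min^{(k)}`: the minimal length of a non-empty lake of generation `k`. -/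
def gammaMinStar (k : ℕ) : ℝ := sInf {r | r ∈ lakeLengths S M k ∧ 0 < r}

/-- `[x, y]` is a (non-degenerate) interval of the `k`-th generation field: it starts at the left
endpoint of a `k`-th generation island and stops at the right endpoint of such an island, i.e. it
is a union of consecutive `k`-th generation islands and of the lakes between them. -/
def IsFieldInterval (k : ℕ) (x y : ℝ) : Prop :=
  x < y ∧ (∃ y', IsIsland S M k x y') ∧ (∃ x', IsIsland S M k x' y)

end Islands

section Eta

variable {n : ℕ} (S : LinearIFS (n + 2)) (M : ℕ → Finset (List (Fin (n + 2))))

/-- `η_1`: the minimum, over all islands `I`, of `ρ_v / |I|` for the constitutive intervals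
`S_v([0,1])` of `I` with the same left or the same right endpoint as `I`; here `ρ_v` is the
contraction ratio `S_v(1) - S_v(0)`. -/
def etaOne : ℝ :=
  sInf {r | ∃ I : Island S M, ∃ f ∈ I.V, (f 0 = I.left ∨ f 1 = I.right) ∧
    r = (f 1 - f 0) / I.length}

/-- `|i_0(I)| = k`: with `v` the vertex of `V(I)` such that `S_v(0)` is the left endpoint `c`
of `I`, `k` is the smallest number for which `S_v S_1^k([0,1]) ⊆ [c, c')`, where `c'` is the
smallest left endpoint of the other constitutive intervals of `I`. It is `0` if and only if there
are no other ones. -/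
def Island.IsLeftExponent {S : LinearIFS (n + 2)} {M : ℕ → Finset (List (Fin (n + 2)))}
    (I : Island S M) (k : ℕ) : Prop :=
  ∃ f ∈ I.V, f 0 = I.left ∧ IsLeast {k | ∀ g ∈ I.V, g ≠ f → f ((S.map 0)^[k] 1) < g 0} k

/-- `|i_1(I)| = k`: the mirror image of the previous definition, at the right endpoint of `I` and
with the last map of the system. -/
def Island.IsRightExponent {S : LinearIFS (n + 2)} {M : ℕ → Finset (List (Fin (n + 2)))}
    (I : Island S M) (k : ℕ) : Prop :=
  ∃ f ∈ I.V, f 1 = I.right ∧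
    IsLeast {k | ∀ g ∈ I.V, g ≠ f → g 1 < f ((S.map (Fin.last (n + 1)))^[k] 0)} k

/-- `η_2`: the minimum of `ρ_1^{|i_0(I)|}` and `ρ_m^{|i_1(I)|}` over all islands `I`. -/
def etaTwo : ℝ :=
  sInf {r | ∃ (I : Island S M) (k : ℕ), (I.IsLeftExponent k ∧ r = S.ρ 0 ^ k) ∨
    (I.IsRightExponent k ∧ r = S.ρ (Fin.last (n + 1)) ^ k)}

/-- `η = η_1 η_2`. -/
def eta : ℝ := etaOne S M * etaTwo S M

/-- Assumption B: `S_1([0,1]) ∩ K = S_1(K)` and `S_m([0,1]) ∩ K = S_m(K)`. -/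
def AssumptionB (K : Set ℝ) : Prop :=
  S.map 0 '' Icc 0 1 ∩ K = S.map 0 '' K ∧
    S.map (Fin.last (n + 1)) '' Icc 0 1 ∩ K = S.map (Fin.last (n + 1)) '' K

end Eta

section Density

variable (K : Set ℝ)

/-- The Hausdorff dimension of `K`, as a real number. -/
def hdim : ℝ := (dimH K).toReal

/-- The normalized Hausdorff measure `λ = H^α|_K / H^α(K)`, with `α` the dimension of `K`. -/
def normMeasure : Measure ℝ :=
  (Measure.hausdorffMeasure (hdim K) K)⁻¹ • (Measure.hausdorffMeasure (hdim K)).restrict K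

/-- The density `d(J) = λ(J) / |J|^α`. -/
def density (J : Set ℝ) : ℝ := (normMeasure K J).toReal / Metric.diam J ^ hdim K

/-- The maximal density `d_max`: the supremum of `d(J)` over all non-degenerate intervals
`J ⊆ [0,1]` (open, closed or half-open). -/
def dMax : ℝ :=
  sSup {r | ∃ J : Set ℝ, J.OrdConnected ∧ J.Nontrivial ∧ J ⊆ Icc 0 1 ∧ r = density K J}

/-- `D_0 = inf_{0 < x ≤ 1} d([0, x])` -/
def lowerD0 : ℝ := sInf ((fun x => density K (Icc 0 x)) '' Ioc 0 1)

/-- `D_1 = inf_{0 < x ≤ 1} d([1 - x, 1])` -/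
def lowerD1 : ℝ := sInf ((fun x => density K (Icc (1 - x) 1)) '' Ioc 0 1)

end Density

end

/-! Density is invariant under affine maps that respect K, so every interval can be inspected at the
scale at which it first separates. Replace an interval by the hull of its part of K, take the last
generation in which one island contains that hull, and move this island to a similar one of
generation at most k₀ (`exists_similarity`). The result has the same density and lies in no island
of generation k₀ + 1 (`exists_magnification`). It therefore spans an island or a non-empty lake, and
is long, or it straddles a point where two islands touch (`long_or_straddle`).

In the second case, if the length is below c₀ = η min{β_min, γ*_min}, only the outermost
constitutive map is seen on either side of the touching point. The two halves then have densities at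
most D₁ = max d([1-x,1]) and D₀ = max d([0,x]), and Hölder's inequality bounds the density of the
whole by C = (D₀^(1/(1-α)) + D₁^(1/(1-α)))^(1-α). Thus d_max is at most the larger of C and the
maximum of d over intervals of length at least c₀ (`density_le`).

Conversely, scaled copies of [1-y,1] and [0,x] fit to the left and to the right of a touching point,
at scales given by powers of ρ_m and ρ_1. As the ratios are non-arithmetic, the attainable
proportions are dense, and the equality case of Hölder's inequality is approximated
(`combine_le_of_touching`), so C ≤ d_max.

The maxima become finite ones as follows. Suppose an endpoint of an optimal interval of length l is
interior to f([0,1]), f of generation k. Extending the interval to the end of f([0,1]) by δ adds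
mass at least D δ^α, with D the lower density at that end; since α < 1, this raises the density as
soon as β_max^(1-α) ≤ l D. An endpoint in no island interior that is not the matching end of an
island can be moved inwards without loss of mass. Hence optimal endpoints are island endpoints
(`isIsland_left_of_optimal`, `isIsland_right_of_optimal`). Intervals with l ≥ c₀ lead to k. By
Assumption B the extremal [0,x] and [1-x,1] can be chosen with l ≥ ρ_1 and l ≥ ρ_m, which leads to
k₁ and k₂.

The normalization needs 0 < H^α(K) < ∞. Both bounds come from comparing the dimension with sums of
powers of ratios: disjoint copies inside K with a sum above 1 would make the dimension exceed α, and
covering copies with a sum below 1 would make it smaller than α. -/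

/-! ### Hausdorff measure and dimension of sets made of similar copies of themselves -/

theorem exists_pos_forall_le {ι : Type*} [Finite ι] (f : ι → ℝ) (hf : ∀ i, 0 < f i) :
    ∃ ε : ℝ, 0 < ε ∧ ∀ i, ε ≤ f i := by
  rcases isEmpty_or_nonempty ι with h | h
  · exact ⟨1, one_pos, fun i => (h.false i).elim⟩
  · obtain ⟨i, hi⟩ := Finite.exists_min f
    exact ⟨f i, hf i, hi⟩

open scoped Pointwise in
/-- An affine image scales the Hausdorff measure of a subset of the line. -/
theorem hausdorffMeasure_affine_image {d : ℝ} (hd : 0 ≤ d) {r : ℝ} (hr : 0 < r) (c : ℝ)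
    (E : Set ℝ) :
    μH[d] ((fun x => r * x + c) '' E) = ENNReal.ofReal r ^ d * μH[d] E := by
  have h1 : (fun x => r * x + c) '' E = (fun x => x + c) '' (r • E) := by
    rw [← Set.image_smul, Set.image_image]
    rfl
  have h2 : Isometry (fun x : ℝ => x + c) := isometry_add_right c
  rw [h1, h2.hausdorffMeasure_image (Or.inl hd), Measure.hausdorffMeasure_smul₀ hd hr.ne',
    ENNReal.smul_def, smul_eq_mul, ENNReal.coe_rpow_of_nonneg _ hd, ENNReal.ofReal,
    show ‖r‖₊ = r.toNNReal by rw [Real.nnnorm_of_nonneg hr.le, Real.toNNReal_of_nonneg hr.le]]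

/-- A compact set of small Hausdorff measure has a finite cover by short open intervals with a
small sum of powers of the lengths. -/
theorem exists_finite_Ioo_cover {K : Set ℝ} (hK : IsCompact K) {d : ℝ} (hd : 0 ≤ d) {C : ENNReal}
    (h : μH[d] K < C) {ε : ℝ} (hε : 0 < ε) :
    ∃ (s : Finset ℕ) (a b : ℕ → ℝ), (∀ i ∈ s, a i < b i) ∧ (∀ i ∈ s, b i - a i ≤ ε) ∧
      K ⊆ ⋃ i ∈ s, Ioo (a i) (b i) ∧ ∑ i ∈ s, ENNReal.ofReal (b i - a i) ^ d < C := by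
  rw [Measure.hausdorffMeasure_apply] at h
  -- Diameters at most ε/2 leave room for fattening each set by less than ε/4 on either side.
  have h' := lt_of_le_of_lt (le_iSup₂_of_le (ENNReal.ofReal (ε / 2))
    (by simpa using hε) le_rfl) h
  simp only [iInf_lt_iff] at h'
  obtain ⟨t, hcov, hdiam, hsum⟩ := h'
  -- The slack below `C` is distributed over the sets of the cover; `e n` pays for turning the n-th
  -- set into an open interval.
  obtain ⟨e, he, hesum⟩ := ENNReal.exists_pos_sum_of_countable' (tsub_pos_of_lt hsum).ne' ℕ
  have key : ∀ n, (t n).Nonempty → ∃ p : ℝ × ℝ, p.1 < p.2 ∧ p.2 - p.1 ≤ ε ∧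
      t n ⊆ Ioo p.1 p.2 ∧ ENNReal.ofReal (p.2 - p.1) ^ d ≤ Metric.ediam (t n) ^ d + e n := by
    intro n hn
    have hfin : Metric.ediam (t n) ≠ ⊤ := ne_top_of_le_ne_top ENNReal.ofReal_ne_top (hdiam n)
    have hb : Bornology.IsBounded (t n) := Metric.isBounded_iff_ediam_ne_top.2 hfin
    set D := Metric.diam (t n) with hD
    have hDe : Metric.ediam (t n) = ENNReal.ofReal D := by
      rw [hD, Metric.diam, ENNReal.ofReal_toReal hfin]
    have hD0 : 0 ≤ D := Metric.diam_nonneg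
    have hDε : D ≤ ε / 2 := by
      have := hdiam n
      rw [hDe] at this
      exact (ENNReal.ofReal_le_ofReal_iff (by positivity)).1 this
    have hlim : Tendsto (fun η : ℝ => ENNReal.ofReal (D + 2 * η) ^ d) (nhds 0)
        (nhds (ENNReal.ofReal D ^ d)) := by
      have hc : Continuous (fun η : ℝ => ENNReal.ofReal (D + 2 * η) ^ d) := by
        refine (ENNReal.continuous_rpow_const).comp (ENNReal.continuous_ofReal.comp ?_)
        fun_prop
      have := hc.tendsto 0
      simpa using this
    have hlt : ENNReal.ofReal D ^ d < ENNReal.ofReal D ^ d + e n :=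
      ENNReal.lt_add_right (ENNReal.rpow_ne_top_of_nonneg hd ENNReal.ofReal_ne_top) (he n).ne'
    have hev := (hlim.eventually_lt_const hlt).filter_mono (nhdsWithin_le_nhds (s := Ioi 0))
    have hev2 : ∀ᶠ η : ℝ in nhdsWithin 0 (Ioi 0), η < ε / 4 :=
      (eventually_lt_nhds (by positivity)).filter_mono nhdsWithin_le_nhds
    obtain ⟨η, ⟨h1, h2⟩, h3⟩ := ((hev.and hev2).and self_mem_nhdsWithin).exists
    have hds := Real.diam_eq hb
    rw [← hD] at hds
    refine ⟨(sInf (t n) - η, sSup (t n) + η), ?_, ?_, ?_, ?_⟩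
    · have := Real.sInf_le_sSup (t n) hb.bddBelow hb.bddAbove
      dsimp only; linarith
    · dsimp only; linarith
    · intro x hx
      have := csInf_le hb.bddBelow hx
      have := le_csSup hb.bddAbove hx
      constructor <;> dsimp only <;> linarith
    · rw [hDe]
      refine le_trans (le_of_eq ?_) h1.le
      congr 2
      dsimp only; linarith
  choose! p hp1 hp2 hp3 hp4 using key
  classical
  have hcov' : K ⊆ ⋃ n, (if (t n).Nonempty then Ioo (p n).1 (p n).2 else ∅) := by
    intro x hx
    obtain ⟨n, hn⟩ := mem_iUnion.1 (hcov hx)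
    have hne : (t n).Nonempty := ⟨x, hn⟩
    refine mem_iUnion.2 ⟨n, ?_⟩
    rw [if_pos hne]
    exact hp3 n hne hn
  obtain ⟨s, hs⟩ := hK.elim_finite_subcover _
    (fun n => by split_ifs; exacts [isOpen_Ioo, isOpen_empty]) hcov'
  refine ⟨s.filter fun n => (t n).Nonempty, fun n => (p n).1, fun n => (p n).2, ?_, ?_, ?_, ?_⟩
  · intro n hn; exact hp1 n (Finset.mem_filter.1 hn).2
  · intro n hn; exact hp2 n (Finset.mem_filter.1 hn).2
  · intro x hx
    obtain ⟨n, hn, hxn⟩ := mem_iUnion₂.1 (hs hx)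
    by_cases hne : (t n).Nonempty
    · rw [if_pos hne] at hxn
      exact mem_iUnion₂.2 ⟨n, Finset.mem_filter.2 ⟨hn, hne⟩, hxn⟩
    · rw [if_neg hne] at hxn
      exact hxn.elim
  · calc ∑ n ∈ s.filter fun n => (t n).Nonempty, ENNReal.ofReal ((p n).2 - (p n).1) ^ d
        ≤ ∑ n ∈ s.filter fun n => (t n).Nonempty,
            ((⨆ _ : (t n).Nonempty, Metric.ediam (t n) ^ d) + e n) := by
          refine Finset.sum_le_sum fun n hn => ?_
          have hne := (Finset.mem_filter.1 hn).2
          rw [ciSup_pos hne]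
          exact hp4 n hne
      _ ≤ ∑' n, ((⨆ _ : (t n).Nonempty, Metric.ediam (t n) ^ d) + e n) :=
          ENNReal.sum_le_tsum _
      _ = (∑' n, ⨆ _ : (t n).Nonempty, Metric.ediam (t n) ^ d) + ∑' n, e n := ENNReal.tsum_add
      _ < C := by
          have := ENNReal.add_lt_add_left hsum.ne_top hesum
          rwa [add_tsub_cancel_of_le hsum.le] at this

/-- Mass distribution without a measure: if `K` contains separated similar copies of itself with
`∑ r_i ^ t ≥ 1`, then every finite cover of `K` by intervals has a large sum of `t`-th powers. -/
theorem rpow_le_sum_of_cover {K : Set ℝ} (hKne : K.Nonempty) {ι : Type*} [Fintype ι]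
    [Nontrivial ι] {r c : ι → ℝ} (hr : ∀ i, 0 < r i) {δ : ℝ} (hδ : 0 < δ)
    (hmap : ∀ i, ∀ x ∈ K, r i * x + c i ∈ K)
    (hsep : ∀ i j, i ≠ j → ∀ x ∈ K, ∀ y ∈ K, δ ≤ |(r i * x + c i) - (r j * y + c j)|)
    {t : ℝ} (ht : 0 ≤ t) (hsum : 1 ≤ ∑ i, r i ^ t) (s : Finset ℕ) :
    ∀ a b : ℕ → ℝ, (∀ n ∈ s, a n < b n) → K ⊆ ⋃ n ∈ s, Ioo (a n) (b n) →
      δ ^ t ≤ ∑ n ∈ s, (b n - a n) ^ t := by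
  classical
  induction s using Finset.strongInduction with
  | H s ih =>
    intro a b hab hcov
    -- One interval of length at least δ suffices alone. Otherwise no interval meets two copies, and
    -- the cover contains disjoint non-empty subfamilies, one for each copy. As there are at least
    -- two copies, each subfamily is strictly smaller than `s`; pulled back by the map of its copy
    -- it covers K, so induction applies.
    by_cases hbig : ∃ n ∈ s, δ ≤ b n - a n
    · obtain ⟨n, hn, hδn⟩ := hbig
      calc δ ^ t ≤ (b n - a n) ^ t := Real.rpow_le_rpow hδ.le hδn ht
        _ ≤ ∑ n ∈ s, (b n - a n) ^ t :=
          Finset.single_le_sum (f := fun n => (b n - a n) ^ t)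
            (fun n hn => Real.rpow_nonneg (by linarith [hab n hn]) _) hn
    push Not at hbig
    let u : ι → Finset ℕ := fun i => s.filter fun n => ∃ x ∈ K, r i * x + c i ∈ Ioo (a n) (b n)
    have hus : ∀ i, u i ⊆ s := fun i => Finset.filter_subset _ _
    have hdisj : ∀ i j, i ≠ j → Disjoint (u i) (u j) := by
      intro i j hij
      rw [Finset.disjoint_left]
      intro n hn hn'
      obtain ⟨hns, x, hx, hxn⟩ := Finset.mem_filter.1 hn
      obtain ⟨_, y, hy, hyn⟩ := Finset.mem_filter.1 hn'
      have h1 := hsep i j hij x hx y hy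
      have h2 := hbig n hns
      have h3 : |(r i * x + c i) - (r j * y + c j)| < b n - a n := by
        rw [abs_lt]; constructor <;> linarith [hxn.1, hxn.2, hyn.1, hyn.2]
      linarith
    have hucov : ∀ i, ∀ x ∈ K, ∃ n ∈ u i, r i * x + c i ∈ Ioo (a n) (b n) := by
      intro i x hx
      obtain ⟨n, hn, hxn⟩ := mem_iUnion₂.1 (hcov (hmap i x hx))
      exact ⟨n, Finset.mem_filter.2 ⟨hn, x, hx, hxn⟩, hxn⟩
    have hune : ∀ i, (u i).Nonempty := fun i => by
      obtain ⟨x, hx⟩ := hKne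
      obtain ⟨n, hn, _⟩ := hucov i x hx
      exact ⟨n, hn⟩
    have hssub : ∀ i, u i ⊂ s := by
      intro i
      refine (Finset.ssubset_iff_subset_ne).2 ⟨hus i, fun h => ?_⟩
      obtain ⟨j, hj⟩ := exists_ne i
      obtain ⟨n, hn⟩ := hune j
      exact Finset.disjoint_left.1 (hdisj j i hj) hn (h ▸ hus j hn)
    have hstep : ∀ i, r i ^ t * δ ^ t ≤ ∑ n ∈ u i, (b n - a n) ^ t := by
      intro i
      have hri := hr i
      have := ih (u i) (hssub i) (fun n => (a n - c i) / r i) (fun n => (b n - c i) / r i)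
        (fun n hn => by
          have := hab n (hus i hn)
          exact div_lt_div_of_pos_right (by linarith) hri)
        (fun x hx => by
          obtain ⟨n, hn, h1, h2⟩ := hucov i x hx
          refine mem_iUnion₂.2 ⟨n, hn, ?_, ?_⟩
          · rw [div_lt_iff₀ hri]; linarith
          · rw [lt_div_iff₀ hri]; linarith)
      calc r i ^ t * δ ^ t ≤ r i ^ t * ∑ n ∈ u i, ((b n - c i) / r i - (a n - c i) / r i) ^ t :=
            mul_le_mul_of_nonneg_left this (Real.rpow_nonneg hri.le _)
        _ = ∑ n ∈ u i, (b n - a n) ^ t := by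
            rw [Finset.mul_sum]
            refine Finset.sum_congr rfl fun n hn => ?_
            have h := hab n (hus i hn)
            rw [← Real.mul_rpow hri.le]
            · congr 1; field_simp; ring
            · rw [← sub_div]; exact div_nonneg (by linarith) hri.le
    calc δ ^ t ≤ (∑ i, r i ^ t) * δ ^ t := le_mul_of_one_le_left (Real.rpow_nonneg hδ.le _) hsum
      _ = ∑ i, r i ^ t * δ ^ t := Finset.sum_mul _ _ _
      _ ≤ ∑ i, ∑ n ∈ u i, (b n - a n) ^ t := Finset.sum_le_sum fun i _ => hstep i
      _ = ∑ n ∈ Finset.univ.biUnion u, (b n - a n) ^ t :=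
          (Finset.sum_biUnion fun i _ j _ hij => hdisj i j hij).symm
      _ ≤ ∑ n ∈ s, (b n - a n) ^ t :=
          Finset.sum_le_sum_of_subset_of_nonneg (Finset.biUnion_subset.2 fun i _ => hus i)
            fun n hn _ => Real.rpow_nonneg (by linarith [hab n hn]) _

/-- Disjoint similar copies of `K` inside `K` with `∑ r_i ^ s > 1` force `dim K > s`. -/
theorem lt_dimH_of_disjoint_copies {K : Set ℝ} (hK : IsCompact K) (hKne : K.Nonempty) {ι : Type*}
    [Fintype ι] {r c : ι → ℝ} (hr : ∀ i, 0 < r i) (hr1 : ∀ i, r i < 1)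
    (hmap : ∀ i, ∀ x ∈ K, r i * x + c i ∈ K)
    (hdisj : ∀ i j, i ≠ j → ∀ x ∈ K, ∀ y ∈ K, r i * x + c i ≠ r j * y + c j)
    {s : ℝ} (hs : 0 ≤ s) (hsum : 1 < ∑ i, r i ^ s) : ENNReal.ofReal s < dimH K := by
  classical
  -- A single ratio below 1 cannot give a sum above 1.
  have hnt : Nontrivial ι := by
    by_contra h
    rw [not_nontrivial_iff_subsingleton] at h
    rcases isEmpty_or_nonempty ι with h' | ⟨⟨i⟩⟩
    · simp at hsum; linarith
    · rw [Fintype.sum_subsingleton _ i] at hsum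
      exact absurd hsum (not_lt.2 (Real.rpow_le_one (hr i).le (hr1 i).le hs))
  -- The strict inequality survives for some exponent t > s; non-zero t-dimensional measure then
  -- yields dim K ≥ t > s.
  have hcont : Continuous fun t : ℝ => ∑ i, r i ^ t :=
    continuous_finsetSum _ fun i _ => Real.continuous_const_rpow (hr i).ne'
  have hev : ∀ᶠ t in nhdsWithin s (Ioi s), 1 < ∑ i, r i ^ t :=
    ((hcont.tendsto s).eventually_const_lt hsum).filter_mono nhdsWithin_le_nhds
  obtain ⟨t, ht1, hst⟩ := (hev.and self_mem_nhdsWithin).exists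
  have ht0 : 0 ≤ t := hs.trans hst.le
  have hsep : ∀ p : ι × ι, ∃ δ : ℝ, 0 < δ ∧ (p.1 ≠ p.2 → ∀ x ∈ K, ∀ y ∈ K,
      δ ≤ |(r p.1 * x + c p.1) - (r p.2 * y + c p.2)|) := by
    rintro ⟨i, j⟩
    by_cases hij : i = j
    · exact ⟨1, one_pos, fun h => (h hij).elim⟩
    have hci : IsCompact ((fun x => r i * x + c i) '' K) := hK.image (by fun_prop)
    have hcj : IsCompact ((fun x => r j * x + c j) '' K) := hK.image (by fun_prop)
    have hd : Disjoint ((fun x => r i * x + c i) '' K) ((fun x => r j * x + c j) '' K) := by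
      rw [Set.disjoint_left]
      rintro _ ⟨x, hx, rfl⟩ ⟨y, hy, hxy⟩
      exact hdisj i j hij x hx y hy hxy.symm
    obtain ⟨δ, hδ, h⟩ := Metric.exists_pos_forall_lt_edist hci hcj.isClosed hd
    refine ⟨δ, by exact_mod_cast hδ, fun _ x hx y hy => ?_⟩
    have := h _ (mem_image_of_mem _ hx) _ (mem_image_of_mem _ hy)
    rw [edist_dist, ← ENNReal.ofReal_coe_nnreal, Real.dist_eq] at this
    exact ((ENNReal.ofReal_lt_ofReal_iff_of_nonneg δ.coe_nonneg).1 this).le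
  choose δ hδ hδsep using hsep
  obtain ⟨δ₀, hδ₀, hle⟩ := exists_pos_forall_le δ hδ
  have hne : μH[t] K ≠ 0 := by
    intro h0
    have hlt : μH[t] K < ENNReal.ofReal δ₀ ^ t := by
      rw [h0]
      exact ENNReal.rpow_pos (by simpa using hδ₀) ENNReal.ofReal_ne_top
    obtain ⟨u, a, b, hab, -, hcov, hsumlt⟩ := exists_finite_Ioo_cover hK ht0 hlt one_pos
    have h1 := rpow_le_sum_of_cover hKne hr hδ₀ hmap
      (fun i j hij x hx y hy => (hle (i, j)).trans (hδsep (i, j) hij x hx y hy)) ht0 ht1.le u a b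
      hab hcov
    rw [ENNReal.ofReal_rpow_of_pos hδ₀] at hsumlt
    have h2 : ∑ i ∈ u, ENNReal.ofReal (b i - a i) ^ t
        = ENNReal.ofReal (∑ i ∈ u, (b i - a i) ^ t) := by
      rw [ENNReal.ofReal_sum_of_nonneg fun i hi => Real.rpow_nonneg (by linarith [hab i hi]) _]
      exact Finset.sum_congr rfl fun i hi => ENNReal.ofReal_rpow_of_pos (by linarith [hab i hi])
    rw [h2] at hsumlt
    exact absurd hsumlt (not_lt.2 (ENNReal.ofReal_le_ofReal h1))
  have hle : ((t.toNNReal : NNReal) : ENNReal) ≤ dimH K := by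
    apply le_dimH_of_hausdorffMeasure_ne_zero
    rwa [Real.coe_toNNReal t ht0]
  refine lt_of_lt_of_le ?_ hle
  exact (ENNReal.ofReal_lt_ofReal_iff (by linarith)).2 hst

/-- If `K` is covered by finitely many contracted similar copies of itself with `∑ r_i ^ d < 1`,
then `dim K < d`. -/
theorem dimH_lt_of_subset_copies {K : Set ℝ} (hK : IsCompact K) {ι : Type}
    [Fintype ι] {r c : ι → ℝ} (hr : ∀ i, 0 < r i) (hr1 : ∀ i, r i < 1)
    (hcov : ∀ x ∈ K, ∃ i, ∃ y ∈ K, x = r i * y + c i)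
    {d : ℝ} (hd : 0 < d) (hsum : ∑ i, r i ^ d < 1) : dimH K < ENNReal.ofReal d := by
  have hcont : Continuous fun t : ℝ => ∑ i, r i ^ t :=
    continuous_finsetSum _ fun i _ => Real.continuous_const_rpow (hr i).ne'
  have hev : ∀ᶠ t in nhdsWithin d (Iio d), ∑ i, r i ^ t < 1 :=
    ((hcont.tendsto d).eventually_lt_const hsum).filter_mono nhdsWithin_le_nhds
  have hev2 : ∀ᶠ t in nhdsWithin d (Iio d), 0 < t :=
    (eventually_gt_nhds hd).filter_mono nhdsWithin_le_nhds
  obtain ⟨t, ⟨ht1, ht0⟩, htd⟩ := ((hev.and hev2).and self_mem_nhdsWithin).exists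
  obtain ⟨R, hR0, hR1, hrR⟩ : ∃ R : ℝ, 0 < R ∧ R < 1 ∧ ∀ i, r i ≤ R := by
    obtain ⟨ε, hε, h⟩ := exists_pos_forall_le (fun i => 1 - r i) (fun i => sub_pos.2 (hr1 i))
    -- The maximum with 1/2 keeps R positive even for an empty index type.
    refine ⟨max (1 - ε) (1 / 2), by positivity, by simp [hε]; norm_num, fun i => ?_⟩
    exact le_max_of_le_left (by linarith [h i])
  -- Substituting the cover into itself makes the copies arbitrarily small, while the sum of t-th
  -- powers is multiplicative and stays at most 1. Hence the t-dimensional measure is finite for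
  -- some t < d.
  have hpow : ∀ n : ℕ, ∃ (κ : Type) (_ : Fintype κ) (p q : κ → ℝ), (∀ k, 0 < p k) ∧
      (∀ k, p k ≤ R ^ n) ∧ (∀ x ∈ K, ∃ k, ∃ y ∈ K, x = p k * y + q k) ∧ ∑ k, p k ^ t ≤ 1 := by
    intro n
    induction n with
    | zero =>
      exact ⟨Unit, inferInstance, fun _ => 1, fun _ => 0, fun _ => one_pos, fun _ => by simp,
        fun x hx => ⟨(), x, hx, by simp⟩, by simp⟩
    | succ n ih =>
      obtain ⟨κ, _, p, q, hp, hpR, hpc, hps⟩ := ih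
      refine ⟨κ × ι, inferInstance, fun z => p z.1 * r z.2, fun z => p z.1 * c z.2 + q z.1,
        fun z => mul_pos (hp _) (hr _), fun z => ?_, fun x hx => ?_, ?_⟩
      · rw [pow_succ]
        exact mul_le_mul (hpR _) (hrR _) (hr _).le (by positivity)
      · obtain ⟨k, y, hy, rfl⟩ := hpc x hx
        obtain ⟨i, z, hz, rfl⟩ := hcov y hy
        exact ⟨(k, i), z, hz, by ring⟩
      · calc ∑ z : κ × ι, (p z.1 * r z.2) ^ t = ∑ k, ∑ i, p k ^ t * r i ^ t := by
              rw [Fintype.sum_prod_type]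
              refine Finset.sum_congr rfl fun k _ => Finset.sum_congr rfl fun i _ => ?_
              exact Real.mul_rpow (hp k).le (hr i).le
          _ = (∑ k, p k ^ t) * ∑ i, r i ^ t := by
              rw [Finset.sum_mul_sum]
          _ ≤ 1 * 1 := mul_le_mul hps ht1.le
              (Finset.sum_nonneg fun i _ => Real.rpow_nonneg (hr i).le _) zero_le_one
          _ = 1 := one_mul 1
  choose κ hκ p q hp hpR hpc hps using hpow
  have hKb : Metric.ediam K ≠ ⊤ := hK.isBounded.ediam_ne_top
  have hdi : ∀ n k, Metric.ediam ((fun x => p n k * x + q n k) '' K)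
      ≤ ENNReal.ofReal (p n k) * Metric.ediam K := by
    intro n k
    have hl : LipschitzWith (p n k).toNNReal (fun x => p n k * x + q n k) := by
      refine LipschitzWith.of_dist_le_mul fun x y => ?_
      rw [Real.coe_toNNReal _ (hp n k).le, Real.dist_eq, Real.dist_eq, add_sub_add_right_eq_sub,
        ← mul_sub, abs_mul, abs_of_pos (hp n k)]
    exact hl.ediam_image_le K
  have hlim : Tendsto (fun n : ℕ => ENNReal.ofReal (R ^ n) * Metric.ediam K) atTop (nhds 0) := by
    have h1 : Tendsto (fun n : ℕ => ENNReal.ofReal (R ^ n)) atTop (nhds 0) := by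
      have := ENNReal.tendsto_ofReal (tendsto_pow_atTop_nhds_zero_of_lt_one hR0.le hR1)
      simpa using this
    have := ENNReal.Tendsto.mul_const h1 (Or.inr hKb)
    simpa using this
  have hle := Measure.hausdorffMeasure_le_liminf_sum t K _ hlim
    (fun n k => (fun x => p n k * x + q n k) '' K)
    (Eventually.of_forall fun n k => (hdi n k).trans (by
      gcongr; exact hpR n k))
    (Eventually.of_forall fun n x hx => by
      obtain ⟨k, y, hy, rfl⟩ := hpc n x hx
      exact mem_iUnion.2 ⟨k, y, hy, rfl⟩)
  have hbound : ∀ n, ∑ k, Metric.ediam ((fun x => p n k * x + q n k) '' K) ^ t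
      ≤ Metric.ediam K ^ t := by
    intro n
    calc ∑ k, Metric.ediam ((fun x => p n k * x + q n k) '' K) ^ t
        ≤ ∑ k, (ENNReal.ofReal (p n k) * Metric.ediam K) ^ t :=
          Finset.sum_le_sum fun k _ => ENNReal.rpow_le_rpow (hdi n k) ht0.le
      _ = ENNReal.ofReal (∑ k, p n k ^ t) * Metric.ediam K ^ t := by
          rw [ENNReal.ofReal_sum_of_nonneg fun k _ => Real.rpow_nonneg (hp n k).le _,
            Finset.sum_mul]
          refine Finset.sum_congr rfl fun k _ => ?_
          rw [ENNReal.mul_rpow_of_nonneg _ _ ht0.le, ENNReal.ofReal_rpow_of_pos (hp n k)]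
      _ ≤ 1 * Metric.ediam K ^ t := by
          gcongr
          exact ENNReal.ofReal_le_one.2 (hps n)
      _ = _ := one_mul _
  have hfin : μH[t] K ≠ ⊤ := by
    refine ne_top_of_le_ne_top (ENNReal.rpow_ne_top_of_nonneg ht0.le hKb) (hle.trans ?_)
    exact liminf_le_of_frequently_le' (Frequently.of_forall hbound)
  have : dimH K ≤ ((t.toNNReal : NNReal) : ENNReal) := by
    apply dimH_le_of_hausdorffMeasure_ne_top
    rwa [Real.coe_toNNReal t ht0.le]
  exact this.trans_lt ((ENNReal.ofReal_lt_ofReal_iff hd).2 htd)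

/-! ### Word maps, the attractor and the vertices -/

theorem LinearIFS.wordMap_append {m : ℕ} (S : LinearIFS m) (u v : List (Fin m)) (x : ℝ) :
    S.wordMap (u ++ v) x = S.wordMap u (S.wordMap v x) := by
  induction u with
  | nil => rfl
  | cons j u ih => simp only [List.cons_append, LinearIFS.wordMap, Function.comp, ih]

theorem LinearIFS.wordMap_affine {m : ℕ} (S : LinearIFS m) {R : ℝ} (hR : ∀ j, S.ρ j ≤ R)
    (w : List (Fin m)) : ∃ r : ℝ, 0 < r ∧ r ≤ R ^ w.length ∧
      ∀ x, S.wordMap w x = r * x + S.wordMap w 0 := by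
  induction w with
  | nil => exact ⟨1, one_pos, by simp, fun x => by simp [LinearIFS.wordMap]⟩
  | cons j w ih =>
    obtain ⟨r, hr, hrR, h⟩ := ih
    have hj := S.ρ_pos j
    refine ⟨S.ρ j * r, mul_pos hj hr, ?_, fun x => ?_⟩
    · rw [List.length_cons, pow_succ']
      exact mul_le_mul (hR j) hrR hr.le (hj.le.trans (hR j))
    · simp only [LinearIFS.wordMap, Function.comp, LinearIFS.map]
      rw [h x]; ring

theorem LinearIFS.exists_ρ_le {m : ℕ} (S : LinearIFS m) :
    ∃ R : ℝ, 0 < R ∧ R < 1 ∧ ∀ j, S.ρ j ≤ R := by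
  obtain ⟨ε, hε, h⟩ := exists_pos_forall_le (fun j => 1 - S.ρ j) fun j => sub_pos.2 (S.ρ_lt_one j)
  exact ⟨max (1 - ε) (1 / 2), by positivity, by simp [hε]; norm_num,
    fun j => le_max_of_le_left (by linarith [h j])⟩

/-- The standing assumptions: `K` is the attractor, `(0,1)` is invariant, the first map fixes `0`,
the last one fixes `1`, and the generalized finite type condition holds. -/
structure FiniteTypeIFS {n : ℕ} (S : LinearIFS (n + 2)) (M : ℕ → Finset (List (Fin (n + 2))))
    (K : Set ℝ) : Prop where
  attractor : S.IsAttractor K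
  inv : ∀ j, S.map j '' Ioo 0 1 ⊆ Ioo 0 1
  map_zero : S.map 0 0 = 0
  map_one : S.map (Fin.last (n + 1)) 1 = 1
  index : IsNestedIndexSeq M
  nested : Antitone (openUnion S M)
  finite : Finite (OverlapType S M)

namespace FiniteTypeIFS

variable {n : ℕ} {S : LinearIFS (n + 2)} {M : ℕ → Finset (List (Fin (n + 2)))} {K : Set ℝ}

section Attractor

variable (H : FiniteTypeIFS S M K)
include H

theorem b_first : S.b 0 = 0 := by
  have := H.map_zero
  simpa [LinearIFS.map] using this

theorem map_first (x : ℝ) : S.map 0 x = S.ρ 0 * x := by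
  simp [LinearIFS.map, H.b_first]

theorem map_last (x : ℝ) :
    S.map (Fin.last (n + 1)) x = 1 - S.ρ (Fin.last (n + 1)) * (1 - x) := by
  have := H.map_one
  simp only [LinearIFS.map] at this ⊢
  linarith

theorem map_mem_Icc (j : Fin (n + 2)) {x : ℝ} (hx : x ∈ Icc (0 : ℝ) 1) :
    S.map j x ∈ Icc (0 : ℝ) 1 := by
  have h : MapsTo (S.map j) (Ioo 0 1) (Ioo 0 1) := fun x hx => H.inv j (mem_image_of_mem _ hx)
  have hc : Continuous (S.map j) := by unfold LinearIFS.map; fun_prop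
  have := h.closure hc
  rw [closure_Ioo zero_ne_one] at this
  exact this hx

theorem map_mem (j : Fin (n + 2)) {x : ℝ} (hx : x ∈ K) : S.map j x ∈ K := by
  rw [H.attractor.2.2]
  exact mem_iUnion.2 ⟨j, mem_image_of_mem _ hx⟩

theorem exists_map_eq {x : ℝ} (hx : x ∈ K) : ∃ j, ∃ y ∈ K, S.map j y = x := by
  rw [H.attractor.2.2] at hx
  exact mem_iUnion.1 hx

theorem wordMap_mem (w : List (Fin (n + 2))) {x : ℝ} (hx : x ∈ K) : S.wordMap w x ∈ K := by
  induction w with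
  | nil => exact hx
  | cons j w ih => exact H.map_mem j ih

theorem wordMap_mem_Icc (w : List (Fin (n + 2))) {x : ℝ} (hx : x ∈ Icc (0 : ℝ) 1) :
    S.wordMap w x ∈ Icc (0 : ℝ) 1 := by
  induction w with
  | nil => exact hx
  | cons j w ih => exact H.map_mem_Icc j ih

theorem exists_wordMap_eq (N : ℕ) {x : ℝ} (hx : x ∈ K) :
    ∃ w : List (Fin (n + 2)), w.length = N ∧ ∃ y ∈ K, S.wordMap w y = x := by
  induction N generalizing x with
  | zero => exact ⟨[], rfl, x, hx, rfl⟩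
  | succ N ih =>
    obtain ⟨j, y, hy, rfl⟩ := H.exists_map_eq hx
    obtain ⟨w, hw, z, hz, rfl⟩ := ih hy
    exact ⟨j :: w, by simp [hw], z, hz, rfl⟩

/-- The maximum s of K is S_j(y) for some y ≤ s in K, so s ≤ ρ_j s + (1 - ρ_j), which forces s ≤ 1.
The minimum is treated symmetrically. -/
theorem subset_Icc : K ⊆ Icc 0 1 := by
  obtain ⟨hc, hne, -⟩ := H.attractor
  have h0 : ∀ j, 0 ≤ S.b j ∧ S.ρ j + S.b j ≤ 1 := fun j => by
    have h1 := H.map_mem_Icc j (left_mem_Icc.2 zero_le_one)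
    have h2 := H.map_mem_Icc j (right_mem_Icc.2 zero_le_one)
    simp only [LinearIFS.map, mem_Icc] at h1 h2
    constructor <;> linarith
  have hsup : sSup K ≤ 1 := by
    obtain ⟨j, y, hy, h⟩ := H.exists_map_eq (hc.sSup_mem hne)
    have hys := le_csSup hc.bddAbove hy
    simp only [LinearIFS.map] at h
    by_contra hlt
    push Not at hlt
    nlinarith [S.ρ_pos j, S.ρ_lt_one j, (h0 j).2, mul_le_mul_of_nonneg_left hys (S.ρ_pos j).le]
  have hinf : 0 ≤ sInf K := by
    obtain ⟨j, y, hy, h⟩ := H.exists_map_eq (hc.sInf_mem hne)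
    have hys := csInf_le hc.bddBelow hy
    simp only [LinearIFS.map] at h
    by_contra hlt
    push Not at hlt
    nlinarith [S.ρ_pos j, S.ρ_lt_one j, (h0 j).1, mul_le_mul_of_nonneg_left hys (S.ρ_pos j).le]
  exact fun x hx => ⟨hinf.trans (csInf_le hc.bddBelow hx), (le_csSup hc.bddAbove hx).trans hsup⟩

theorem iterate_first (p : ℕ) (x : ℝ) : (S.map 0)^[p] x = S.ρ 0 ^ p * x := by
  induction p with
  | zero => simp
  | succ p ih => rw [Function.iterate_succ_apply', ih, H.map_first, pow_succ']; ring

theorem iterate_last (p : ℕ) (x : ℝ) : (S.map (Fin.last (n + 1)))^[p] x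
    = 1 - S.ρ (Fin.last (n + 1)) ^ p * (1 - x) := by
  induction p with
  | zero => simp
  | succ p ih => rw [Function.iterate_succ_apply', ih, H.map_last, pow_succ']; ring

theorem iterate_mem (j : Fin (n + 2)) (p : ℕ) {x : ℝ} (hx : x ∈ K) : (S.map j)^[p] x ∈ K := by
  induction p with
  | zero => exact hx
  | succ p ih => rw [Function.iterate_succ_apply']; exact H.map_mem j ih

theorem zero_mem : (0 : ℝ) ∈ K := by
  obtain ⟨x, hx⟩ := H.attractor.2.1
  have h1 : Tendsto (fun p : ℕ => S.ρ 0 ^ p * x) atTop (nhds (0 * x)) :=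
    (tendsto_pow_atTop_nhds_zero_of_lt_one (S.ρ_pos 0).le (S.ρ_lt_one 0)).mul_const x
  rw [zero_mul] at h1
  refine H.attractor.1.isClosed.mem_of_tendsto h1 (Eventually.of_forall fun p => ?_)
  rw [← H.iterate_first]
  exact H.iterate_mem 0 p hx

theorem one_mem : (1 : ℝ) ∈ K := by
  obtain ⟨x, hx⟩ := H.attractor.2.1
  have h1 : Tendsto (fun p : ℕ => 1 - S.ρ (Fin.last (n + 1)) ^ p * (1 - x)) atTop
      (nhds (1 - 0 * (1 - x))) :=
    ((tendsto_pow_atTop_nhds_zero_of_lt_one (S.ρ_pos _).le (S.ρ_lt_one _)).mul_const _).const_sub 1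
  rw [zero_mul, sub_zero] at h1
  refine H.attractor.1.isClosed.mem_of_tendsto h1 (Eventually.of_forall fun p => ?_)
  rw [← H.iterate_last]
  exact H.iterate_mem _ p hx

/-- Every point of `K` lies in the image of `K` under a map of the `k`-th generation. -/
theorem exists_vertex_eq (k : ℕ) {x : ℝ} (hx : x ∈ K) : ∃ f ∈ vertices S M k, ∃ y ∈ K, f y = x := by
  obtain ⟨w, hw, y, hy, rfl⟩ := H.exists_wordMap_eq (maxLength (M k) + 1) hx
  obtain ⟨i, hi, v, rfl⟩ := H.index.exists_prefix k w (by omega)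
  refine ⟨S.wordMap i, ⟨i, hi, rfl⟩, S.wordMap v y, H.wordMap_mem v hy, ?_⟩
  rw [LinearIFS.wordMap_append]

end Attractor

section Vertices

variable (S M) in
theorem finite_vertices (k : ℕ) : (vertices S M k).Finite := by
  have : vertices S M k = S.wordMap '' (M k : Set (List (Fin (n + 2)))) := by
    ext f; constructor
    · rintro ⟨w, hw, rfl⟩; exact ⟨w, hw, rfl⟩
    · rintro ⟨w, hw, rfl⟩; exact ⟨w, hw, rfl⟩
  rw [this]
  exact (M k).finite_toSet.image _

theorem vertex_sub_le {R : ℝ} (hR : ∀ j, S.ρ j ≤ R) (hR0 : 0 ≤ R) (hR1 : R ≤ 1) {k : ℕ}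
    {f : ℝ → ℝ} (hf : f ∈ vertices S M k) : f 1 - f 0 ≤ R ^ minLength (M k) := by
  obtain ⟨w, hw, rfl⟩ := hf
  obtain ⟨r, -, hr, h⟩ := S.wordMap_affine hR w
  rw [h 1]
  have : minLength (M k) ≤ w.length := Nat.sInf_le (mem_image_of_mem _ hw)
  have := pow_le_pow_of_le_one hR0 hR1 this
  linarith

theorem vertex_lt {k : ℕ} {f : ℝ → ℝ} (hf : f ∈ vertices S M k) : f 0 < f 1 := by
  obtain ⟨w, hw, rfl⟩ := hf
  obtain ⟨r, h0, -, h⟩ := S.wordMap_affine (fun j => (S.ρ_lt_one j).le) w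
  rw [h 1]; linarith

/-- A vertex is recorded as a function only, so its ratio and translation have to be read off from
its values at 1 and 0. -/
theorem vertex_apply {k : ℕ} {f : ℝ → ℝ} (hf : f ∈ vertices S M k) (x : ℝ) :
    f x = (f 1 - f 0) * x + f 0 := by
  obtain ⟨w, hw, rfl⟩ := hf
  obtain ⟨r, h0, -, h⟩ := S.wordMap_affine (fun j => (S.ρ_lt_one j).le) w
  rw [h x, h 1]; ring

theorem vertex_image_Ioo {k : ℕ} {f : ℝ → ℝ} (hf : f ∈ vertices S M k) :
    f '' Ioo 0 1 = Ioo (f 0) (f 1) := by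
  have h : f = fun x => (f 1 - f 0) * x + f 0 := funext (vertex_apply hf)
  have hlt := vertex_lt hf
  conv_lhs => rw [h]
  rw [image_affine_Ioo (by linarith)]
  simp

theorem vertex_image_Icc {k : ℕ} {f : ℝ → ℝ} (hf : f ∈ vertices S M k) :
    f '' Icc 0 1 = Icc (f 0) (f 1) := by
  have h : f = fun x => (f 1 - f 0) * x + f 0 := funext (vertex_apply hf)
  have hlt := vertex_lt hf
  conv_lhs => rw [h]
  rw [image_affine_Icc' (by linarith)]
  simp

theorem mem_openUnion {k : ℕ} {x : ℝ} :
    x ∈ openUnion S M k ↔ ∃ f ∈ vertices S M k, x ∈ Ioo (f 0) (f 1) := by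
  simp only [openUnion, mem_iUnion, exists_prop]
  exact exists_congr fun f => and_congr_right fun hf => by rw [vertex_image_Ioo hf]

theorem isOpen_openUnion (k : ℕ) : IsOpen (openUnion S M k) := by
  refine isOpen_biUnion fun f hf => ?_
  rw [vertex_image_Ioo hf]
  exact isOpen_Ioo

theorem mem_constituents {k : ℕ} {a b : ℝ} {f : ℝ → ℝ} :
    f ∈ constituents S M k a b ↔ f ∈ vertices S M k ∧ a ≤ f 0 ∧ f 1 ≤ b := by
  refine and_congr_right fun hf => ?_
  rw [vertex_image_Icc hf, Icc_subset_Icc_iff (vertex_lt hf).le]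

variable (H : FiniteTypeIFS S M K)
include H

theorem vertex_zero_nonneg {k : ℕ} {f : ℝ → ℝ} (hf : f ∈ vertices S M k) : 0 ≤ f 0 := by
  obtain ⟨w, hw, rfl⟩ := hf
  exact (H.wordMap_mem_Icc w (left_mem_Icc.2 zero_le_one)).1

theorem vertex_one_le {k : ℕ} {f : ℝ → ℝ} (hf : f ∈ vertices S M k) : f 1 ≤ 1 := by
  obtain ⟨w, hw, rfl⟩ := hf
  exact (H.wordMap_mem_Icc w (right_mem_Icc.2 zero_le_one)).2

theorem vertex_mem {k : ℕ} {f : ℝ → ℝ} (hf : f ∈ vertices S M k) {x : ℝ} (hx : x ∈ K) :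
    f x ∈ K := by
  obtain ⟨w, hw, rfl⟩ := hf
  exact H.wordMap_mem w hx

theorem openUnion_subset (k : ℕ) : openUnion S M k ⊆ Ioo 0 1 := by
  intro x hx
  obtain ⟨f, hf, h1, h2⟩ := mem_openUnion.1 hx
  exact ⟨(H.vertex_zero_nonneg hf).trans_lt h1, h2.trans_le (H.vertex_one_le hf)⟩

end Vertices

end FiniteTypeIFS

/-- A bounded, open, non-empty, preconnected set of reals is an open interval. -/
theorem IsPreconnected.eq_Ioo_of_isOpen {C : Set ℝ} (hC : IsPreconnected C) (ho : IsOpen C)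
    (hb : BddBelow C) (ha : BddAbove C) : C = Ioo (sInf C) (sSup C) := by
  apply Subset.antisymm
  · intro x hx
    obtain ⟨ε, hε, h⟩ := Metric.isOpen_iff.1 ho x hx
    have h1 : x - ε / 2 ∈ C := h (by
      rw [Metric.mem_ball, Real.dist_eq, abs_lt]; constructor <;> linarith)
    have h2 : x + ε / 2 ∈ C := h (by
      rw [Metric.mem_ball, Real.dist_eq, abs_lt]; constructor <;> linarith)
    exact ⟨by linarith [csInf_le hb h1], by linarith [le_csSup ha h2]⟩
  · rcases C.eq_empty_or_nonempty with rfl | hne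
    · simp
    · exact IsConnected.Ioo_csInf_csSup_subset ⟨hne, hC⟩ hb ha

/-! ### Geometry of the islands -/

section IslandGeometry

variable {n : ℕ} {S : LinearIFS (n + 2)} {M : ℕ → Finset (List (Fin (n + 2)))} {K : Set ℝ}
  {k : ℕ} {a b c d : ℝ}

open FiniteTypeIFS

theorem IsIsland.Ioo_subset (h : IsIsland S M k a b) : Ioo a b ⊆ openUnion S M k := by
  obtain ⟨x, hx, h⟩ := h
  rw [← h]; exact connectedComponentIn_subset _ _

theorem IsIsland.lt (h : IsIsland S M k a b) : a < b := by
  obtain ⟨x, hx, h⟩ := h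
  have := mem_connectedComponentIn hx
  rw [h] at this
  exact this.1.trans this.2

theorem IsIsland.connectedComponentIn_eq (h : IsIsland S M k a b) {x : ℝ} (hx : x ∈ Ioo a b) :
    connectedComponentIn (openUnion S M k) x = Ioo a b := by
  obtain ⟨y, hy, h⟩ := h
  rw [← h] at hx ⊢
  exact (_root_.connectedComponentIn_eq hx).symm

theorem IsIsland.subset_of_isPreconnected (h : IsIsland S M k a b) {s : Set ℝ}
    (hs : IsPreconnected s) (hsU : s ⊆ openUnion S M k) {x : ℝ} (hx : x ∈ s)
    (hxI : x ∈ Ioo a b) : s ⊆ Ioo a b := by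
  rw [← h.connectedComponentIn_eq hxI]
  exact hs.subset_connectedComponentIn hx hsU

theorem IsIsland.eq_of_mem (h : IsIsland S M k a b) (h' : IsIsland S M k c d) {x : ℝ}
    (hx : x ∈ Ioo a b) (hx' : x ∈ Ioo c d) : a = c ∧ b = d := by
  have := (h.connectedComponentIn_eq hx).symm.trans (h'.connectedComponentIn_eq hx')
  have hab := h.lt
  have hcd := h'.lt
  have h1 := (Ioo_subset_Ioo_iff hab).1 this.le
  have h2 := (Ioo_subset_Ioo_iff hcd).1 this.ge
  exact ⟨le_antisymm h2.1 h1.1, le_antisymm h1.2 h2.2⟩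

/-- Two islands of the same generation coincide or lie side by side. -/
theorem IsIsland.trichotomy (h : IsIsland S M k a b) (h' : IsIsland S M k c d) :
    (a = c ∧ b = d) ∨ b ≤ c ∨ d ≤ a := by
  by_contra hne
  push Not at hne
  obtain ⟨h1, h2, h3⟩ := hne
  have hab := h.lt
  have hcd := h'.lt
  have hlt : max a c < min b d := by
    simp only [max_lt_iff, lt_min_iff]; exact ⟨⟨hab, h2⟩, h3, hcd⟩
  obtain ⟨x, hx1, hx2⟩ := exists_between hlt
  rw [max_lt_iff] at hx1
  rw [lt_min_iff] at hx2
  obtain ⟨e1, e2⟩ := h.eq_of_mem h' ⟨hx1.1, hx2.1⟩ ⟨hx1.2, hx2.2⟩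
  exact h1 e1 e2

theorem IsIsland.le_vertex (h : IsIsland S M k a b) {f : ℝ → ℝ} (hf : f ∈ vertices S M k) {x : ℝ}
    (hx : x ∈ Ioo (f 0) (f 1)) (hxI : x ∈ Ioo a b) : a ≤ f 0 ∧ f 1 ≤ b := by
  have hsub : Ioo (f 0) (f 1) ⊆ openUnion S M k := fun y hy => mem_openUnion.2 ⟨f, hf, hy⟩
  have := h.subset_of_isPreconnected isPreconnected_Ioo hsub hx hxI
  exact (Ioo_subset_Ioo_iff (vertex_lt hf)).1 this

/-- The smallest left endpoint of a constitutive interval cannot be interior to the island: it would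
lie in the open interval of another constitutive map, which starts further left. -/
theorem IsIsland.exists_left (h : IsIsland S M k a b) :
    ∃ f ∈ constituents S M k a b, f 0 = a := by
  have hab := h.lt
  have hfin : (constituents S M k a b).Finite := (finite_vertices S M k).subset fun f hf => hf.1
  have hpt : ∀ x ∈ Ioo a b, ∃ f ∈ constituents S M k a b, f 0 < x := by
    intro x hx
    obtain ⟨f, hf, hxf⟩ := mem_openUnion.1 (h.Ioo_subset hx)
    exact ⟨f, mem_constituents.2 ⟨hf, h.le_vertex hf hxf hx⟩, hxf.1⟩
  have hne : (constituents S M k a b).Nonempty := by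
    obtain ⟨f, hf, _⟩ := hpt ((a + b) / 2) ⟨by linarith, by linarith⟩
    exact ⟨f, hf⟩
  obtain ⟨f, hf, hmin⟩ := hfin.exists_minimalFor (fun f => f 0) _ hne
  refine ⟨f, hf, le_antisymm ?_ (mem_constituents.1 hf).2.1⟩
  by_contra hlt
  push Not at hlt
  obtain ⟨hf1, hf2, hf3⟩ := mem_constituents.1 hf
  obtain ⟨g, hg, hgx⟩ := hpt (f 0) ⟨hlt, (vertex_lt hf1).trans_le hf3⟩
  exact absurd (hmin hg hgx.le) (not_le.2 hgx)

theorem IsIsland.exists_right (h : IsIsland S M k a b) :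
    ∃ f ∈ constituents S M k a b, f 1 = b := by
  have hab := h.lt
  have hfin : (constituents S M k a b).Finite := (finite_vertices S M k).subset fun f hf => hf.1
  have hpt : ∀ x ∈ Ioo a b, ∃ f ∈ constituents S M k a b, x < f 1 := by
    intro x hx
    obtain ⟨f, hf, hxf⟩ := mem_openUnion.1 (h.Ioo_subset hx)
    exact ⟨f, mem_constituents.2 ⟨hf, h.le_vertex hf hxf hx⟩, hxf.2⟩
  have hne : (constituents S M k a b).Nonempty := by
    obtain ⟨f, hf, _⟩ := hpt ((a + b) / 2) ⟨by linarith, by linarith⟩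
    exact ⟨f, hf⟩
  obtain ⟨f, hf, hmax⟩ := hfin.exists_maximalFor (fun f => f 1) _ hne
  refine ⟨f, hf, le_antisymm (mem_constituents.1 hf).2.2 ?_⟩
  by_contra hlt
  push Not at hlt
  obtain ⟨hf1, hf2, hf3⟩ := mem_constituents.1 hf
  obtain ⟨g, hg, hgx⟩ := hpt (f 1) ⟨hf2.trans_lt (vertex_lt hf1), hlt⟩
  exact absurd (hmax hg hgx.le) (not_le.2 hgx)

theorem finite_islands (S : LinearIFS (n + 2)) (M : ℕ → Finset (List (Fin (n + 2)))) (k : ℕ) :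
    {p : ℝ × ℝ | IsIsland S M k p.1 p.2}.Finite := by
  have hf := finite_vertices S M k
  refine ((hf.image fun f => f 0).prod (hf.image fun f => f 1)).subset ?_
  rintro ⟨a, b⟩ h
  obtain ⟨f, hf, rfl⟩ := IsIsland.exists_left h
  obtain ⟨g, hg, rfl⟩ := IsIsland.exists_right h
  exact ⟨mem_image_of_mem _ hf.1, mem_image_of_mem _ hg.1⟩

namespace FiniteTypeIFS

variable (H : FiniteTypeIFS S M K)
include H

theorem exists_island_of_mem_openUnion {x : ℝ} (hx : x ∈ openUnion S M k) :
    ∃ a b, IsIsland S M k a b ∧ x ∈ Ioo a b := by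
  set C := connectedComponentIn (openUnion S M k) x with hC
  have hsub : C ⊆ Icc 0 1 := (connectedComponentIn_subset _ _).trans
    ((H.openUnion_subset k).trans Ioo_subset_Icc_self)
  have h : C = Ioo (sInf C) (sSup C) :=
    isPreconnected_connectedComponentIn.eq_Ioo_of_isOpen (isOpen_openUnion k).connectedComponentIn
      (bddBelow_Icc.mono hsub) (bddAbove_Icc.mono hsub)
  exact ⟨_, _, ⟨x, hx, h⟩, h ▸ mem_connectedComponentIn hx⟩

theorem exists_island_of_vertex {f : ℝ → ℝ} (hf : f ∈ vertices S M k) :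
    ∃ a b, IsIsland S M k a b ∧ a ≤ f 0 ∧ f 1 ≤ b := by
  have hlt := vertex_lt hf
  have hx : (f 0 + f 1) / 2 ∈ Ioo (f 0) (f 1) := ⟨by linarith, by linarith⟩
  obtain ⟨a, b, h, hxI⟩ := H.exists_island_of_mem_openUnion (mem_openUnion.2 ⟨f, hf, hx⟩)
  exact ⟨a, b, h, h.le_vertex hf hx hxI⟩

theorem vertex_apply_mem_Icc {f : ℝ → ℝ} (hf : f ∈ vertices S M k) {y : ℝ} (hy : y ∈ K) :
    f y ∈ Icc (f 0) (f 1) := by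
  rw [← vertex_image_Icc hf]
  exact mem_image_of_mem _ (H.subset_Icc hy)

theorem exists_island_of_mem (k : ℕ) {x : ℝ} (hx : x ∈ K) :
    ∃ a b, IsIsland S M k a b ∧ x ∈ Icc a b := by
  obtain ⟨f, hf, y, hy, rfl⟩ := H.exists_vertex_eq k hx
  obtain ⟨a, b, h, h1, h2⟩ := H.exists_island_of_vertex hf
  have := H.vertex_apply_mem_Icc hf hy
  exact ⟨a, b, h, h1.trans this.1, this.2.trans h2⟩

/-- `K ∩ I` is the union of the sets `f(K)`, `f ∈ V(I)`. -/
theorem exists_constituent_eq (h : IsIsland S M k a b) {x : ℝ} (hx : x ∈ K) (hxI : x ∈ Icc a b) :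
    ∃ f ∈ constituents S M k a b, ∃ y ∈ K, f y = x := by
  -- Endpoints are treated separately: where islands touch, an arbitrary vertex producing x could
  -- belong to the neighbouring island.
  rcases eq_or_lt_of_le hxI.1 with rfl | ha
  · obtain ⟨f, hf, hfa⟩ := h.exists_left
    exact ⟨f, hf, 0, H.zero_mem, hfa⟩
  rcases eq_or_lt_of_le hxI.2 with rfl | hb
  · obtain ⟨f, hf, hfb⟩ := h.exists_right
    exact ⟨f, hf, 1, H.one_mem, hfb⟩
  obtain ⟨f, hf, y, hy, rfl⟩ := H.exists_vertex_eq k hx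
  have hm := H.vertex_apply_mem_Icc hf hy
  have hlt := vertex_lt hf
  -- The point may be an endpoint of f([0,1]), but it is interior to the island, so the two open
  -- intervals overlap at some z.
  obtain ⟨z, hz1, hz2⟩ := exists_between
    (show max a (f 0) < min b (f 1) from by
      simp only [max_lt_iff, lt_min_iff]
      exact ⟨⟨h.lt, hm.1.trans_lt hb⟩, ha.trans_le hm.2, hlt⟩)
  rw [max_lt_iff] at hz1
  rw [lt_min_iff] at hz2
  exact ⟨f, mem_constituents.2 ⟨hf, h.le_vertex hf ⟨hz1.2, hz2.2⟩ ⟨hz1.1, hz2.1⟩⟩, y, hy, rfl⟩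

theorem island_zero_iff : IsIsland S M 0 a b ↔ a = 0 ∧ b = 1 := by
  have hU : openUnion S M 0 = Ioo 0 1 := by
    ext x
    rw [mem_openUnion]
    simp [vertices, H.index.zero, LinearIFS.wordMap]
  constructor
  · intro h
    have hx : (a + b) / 2 ∈ Ioo a b := ⟨by linarith [h.lt], by linarith [h.lt]⟩
    have h1 := h.Ioo_subset
    have h2 := h.subset_of_isPreconnected (by rw [hU]; exact isPreconnected_Ioo) Subset.rfl
      (h1 hx) hx
    rw [hU] at h1 h2
    have h3 := (Ioo_subset_Ioo_iff h.lt).1 h1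
    have h4 := (Ioo_subset_Ioo_iff one_pos).1 h2
    exact ⟨le_antisymm h4.1 h3.1, le_antisymm h3.2 h4.2⟩
  · rintro ⟨rfl, rfl⟩
    refine ⟨1 / 2, ?_, ?_⟩
    · rw [hU]; constructor <;> norm_num
    · rw [hU]
      exact isPreconnected_Ioo.connectedComponentIn (by constructor <;> norm_num)

theorem exists_parent (h : IsIsland S M (k + 1) a b) :
    ∃ c d, IsIsland S M k c d ∧ c ≤ a ∧ b ≤ d := by
  have hab := h.lt
  have hx : (a + b) / 2 ∈ Ioo a b := ⟨by linarith, by linarith⟩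
  have hsub := h.Ioo_subset.trans (H.nested (Nat.le_succ k))
  obtain ⟨c, d, h', hx'⟩ := H.exists_island_of_mem_openUnion (hsub hx)
  have := h'.subset_of_isPreconnected isPreconnected_Ioo hsub hx hx'
  exact ⟨c, d, h', (Ioo_subset_Ioo_iff hab).1 this⟩

theorem exists_ancestor {l : ℕ} (hkl : k ≤ l) (h : IsIsland S M l a b) :
    ∃ c d, IsIsland S M k c d ∧ c ≤ a ∧ b ≤ d := by
  induction l, hkl using Nat.le_induction generalizing a b with
  | base => exact ⟨a, b, h, le_rfl, le_rfl⟩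
  | succ l _ ih =>
    obtain ⟨c, d, h', h1, h2⟩ := H.exists_parent h
    obtain ⟨e, f, h'', h3, h4⟩ := ih h'
    exact ⟨e, f, h'', h3.trans h1, h2.trans h4⟩

theorem island_bounds (h : IsIsland S M k a b) : 0 ≤ a ∧ b ≤ 1 := by
  obtain ⟨f, hf, rfl⟩ := h.exists_left
  obtain ⟨g, hg, rfl⟩ := h.exists_right
  exact ⟨H.vertex_zero_nonneg hf.1, H.vertex_one_le hg.1⟩

theorem left_mem (h : IsIsland S M k a b) : a ∈ K := by
  obtain ⟨f, hf, rfl⟩ := h.exists_left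
  exact H.vertex_mem hf.1 H.zero_mem

theorem exists_first_island (k : ℕ) : ∃ b, IsIsland S M k 0 b := by
  obtain ⟨a, b, h, h1, h2⟩ := H.exists_island_of_mem k H.zero_mem
  obtain rfl : a = 0 := le_antisymm h1 (H.island_bounds h).1
  exact ⟨b, h⟩

theorem exists_last_island (k : ℕ) : ∃ a, IsIsland S M k a 1 := by
  obtain ⟨a, b, h, h1, h2⟩ := H.exists_island_of_mem k H.one_mem
  obtain rfl : b = 1 := le_antisymm (H.island_bounds h).2 h2
  exact ⟨a, h⟩

end FiniteTypeIFS

end IslandGeometry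

/-! ### Invariants of overlap types, η and the lengths of islands -/

section Invariants

variable {n : ℕ} {S : LinearIFS (n + 2)} {M : ℕ → Finset (List (Fin (n + 2)))} {K : Set ℝ}
  {k : ℕ} {a b c d : ℝ}

open FiniteTypeIFS

theorem Island.length_pos (I : Island S M) : 0 < I.length := sub_pos.2 I.isIsland.lt

theorem Island.finite_V (I : Island S M) : I.V.Finite :=
  (finite_vertices S M I.level).subset fun _ hf => hf.1

/-- A set-valued invariant of overlap types with finite values has a finite union of values. -/
theorem FiniteTypeIFS.finite_iUnion (H : FiniteTypeIFS S M K) {X : Type*} (φ : Island S M → Set X)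
    (hφ : ∀ I J : Island S M, I.Equivalent J → φ I ⊆ φ J) (hfin : ∀ I, (φ I).Finite) :
    (⋃ I, φ I).Finite := by
  have := H.finite
  let ψ : OverlapType S M → Set X :=
    Quotient.lift φ fun I J h => (hφ I J h).antisymm (hφ J I (Island.Equivalent.symm h))
  have h : (⋃ I, φ I) = ⋃ T, ψ T := by
    apply Subset.antisymm
    · exact iUnion_subset fun I => subset_iUnion ψ (Quotient.mk _ I)
    · refine iUnion_subset fun T => ?_
      induction T using Quotient.ind with
      | _ I => exact subset_iUnion φ I
  rw [h]
  refine Set.finite_iUnion fun T => ?_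
  induction T using Quotient.ind with
  | _ I => exact hfin I

/-- The gen `0` island `[0,1]`. -/
def FiniteTypeIFS.rootIsland (H : FiniteTypeIFS S M K) : Island S M :=
  ⟨0, 0, 1, H.island_zero_iff.2 ⟨rfl, rfl⟩⟩

theorem Set.Finite.sInf_pos {E : Set ℝ} (h : E.Finite) (hne : E.Nonempty) (hpos : ∀ r ∈ E, 0 < r) :
    0 < sInf E := hpos _ (hne.csInf_mem h)

/-- These quotients are unchanged by the affine map of an equivalence, so finitely many types leave
finitely many values, and the infimum `etaOne` is an attained, positive minimum. -/
theorem FiniteTypeIFS.finite_etaOne_set (H : FiniteTypeIFS S M K) :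
    {r | ∃ I : Island S M, ∃ f ∈ I.V, (f 0 = I.left ∨ f 1 = I.right) ∧
      r = (f 1 - f 0) / I.length}.Finite := by
  have : {r | ∃ I : Island S M, ∃ f ∈ I.V, (f 0 = I.left ∨ f 1 = I.right) ∧
      r = (f 1 - f 0) / I.length} = ⋃ I : Island S M, {r | ∃ f ∈ I.V,
        (f 0 = I.left ∨ f 1 = I.right) ∧ r = (f 1 - f 0) / I.length} := by
    ext r; simp
  rw [this]
  refine H.finite_iUnion _ ?_ fun I => ?_
  · rintro I J ⟨s, t, hs, hl, hr, hV, -⟩ r ⟨f, hf, hend, rfl⟩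
    refine ⟨(fun x => s * x + t) ∘ f, by rw [hV]; exact mem_image_of_mem _ hf, ?_, ?_⟩
    · simp only [Function.comp]
      rcases hend with h | h
      · left; rw [h, hl]
      · right; rw [h, hr]
    · simp only [Function.comp, Island.length, ← hl, ← hr]
      rw [add_sub_add_right_eq_sub, add_sub_add_right_eq_sub, ← mul_sub, ← mul_sub,
        mul_div_mul_left _ _ hs.ne']
  · refine (I.finite_V.image fun f => (f 1 - f 0) / I.length).subset ?_
    rintro r ⟨f, hf, -, rfl⟩
    exact mem_image_of_mem _ hf

theorem FiniteTypeIFS.etaOne_pos (H : FiniteTypeIFS S M K) : 0 < etaOne S M := by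
  refine H.finite_etaOne_set.sInf_pos ?_ ?_
  · obtain ⟨f, hf, h0⟩ := H.rootIsland.isIsland.exists_left
    exact ⟨_, H.rootIsland, f, hf, Or.inl h0, rfl⟩
  · rintro r ⟨I, f, hf, -, rfl⟩
    exact div_pos (sub_pos.2 (vertex_lt hf.1)) (Island.length_pos I)

theorem FiniteTypeIFS.etaOne_mul_le (H : FiniteTypeIFS S M K) (I : Island S M) {f : ℝ → ℝ}
    (hf : f ∈ I.V) (hend : f 0 = I.left ∨ f 1 = I.right) : etaOne S M * I.length ≤ f 1 - f 0 := by
  rw [← le_div_iff₀ (Island.length_pos I)]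
  exact csInf_le H.finite_etaOne_set.bddBelow ⟨I, f, hf, hend, rfl⟩

theorem FiniteTypeIFS.etaOne_le_one (H : FiniteTypeIFS S M K) : etaOne S M ≤ 1 := by
  obtain ⟨f, hf, h0⟩ := H.rootIsland.isIsland.exists_left
  have h := H.etaOne_mul_le H.rootIsland hf (Or.inl h0)
  have h1 : H.rootIsland.length = 1 := by simp [Island.length, rootIsland]
  rw [h1, mul_one] at h
  linarith [H.vertex_zero_nonneg hf.1, H.vertex_one_le hf.1]

theorem Island.Equivalent.isLeftExponent {I J : Island S M} (h : I.Equivalent J) {p : ℕ}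
    (hp : I.IsLeftExponent p) : J.IsLeftExponent p := by
  obtain ⟨s, t, hs, hl, hr, hV, -⟩ := h
  obtain ⟨f, hf, h0, hleast⟩ := hp
  refine ⟨(fun x => s * x + t) ∘ f, by rw [hV]; exact mem_image_of_mem _ hf,
    by simp only [Function.comp]; rw [h0, hl], ?_⟩
  convert hleast using 1
  ext k
  rw [hV]
  simp only [mem_ofPred_eq, forall_mem_image, Function.comp_apply]
  refine forall₂_congr fun g hg => ?_
  have h1 : (fun x => s * x + t) ∘ g ≠ (fun x => s * x + t) ∘ f ↔ g ≠ f := by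
    rw [not_iff_not]
    refine ⟨fun h => funext fun x => ?_, fun h => by rw [h]⟩
    have := congrFun h x
    simp only [Function.comp_apply, add_left_inj] at this
    exact mul_left_cancel₀ hs.ne' this
  rw [h1]
  refine imp_congr_right fun _ => ?_
  rw [add_lt_add_iff_right, mul_lt_mul_iff_right₀ hs]

theorem Island.Equivalent.isRightExponent {I J : Island S M} (h : I.Equivalent J) {p : ℕ}
    (hp : I.IsRightExponent p) : J.IsRightExponent p := by
  obtain ⟨s, t, hs, hl, hr, hV, -⟩ := h
  obtain ⟨f, hf, h0, hleast⟩ := hp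
  refine ⟨(fun x => s * x + t) ∘ f, by rw [hV]; exact mem_image_of_mem _ hf,
    by simp only [Function.comp]; rw [h0, hr], ?_⟩
  convert hleast using 1
  ext k
  rw [hV]
  simp only [mem_ofPred_eq, forall_mem_image, Function.comp_apply]
  refine forall₂_congr fun g hg => ?_
  have h1 : (fun x => s * x + t) ∘ g ≠ (fun x => s * x + t) ∘ f ↔ g ≠ f := by
    rw [not_iff_not]
    refine ⟨fun h => funext fun x => ?_, fun h => by rw [h]⟩
    have := congrFun h x
    simp only [Function.comp_apply, add_left_inj] at this
    exact mul_left_cancel₀ hs.ne' this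
  rw [h1]
  refine imp_congr_right fun _ => ?_
  rw [add_lt_add_iff_right, mul_lt_mul_iff_right₀ hs]

theorem FiniteTypeIFS.finite_etaTwo_set (H : FiniteTypeIFS S M K) :
    {r | ∃ (I : Island S M) (k : ℕ), (I.IsLeftExponent k ∧ r = S.ρ 0 ^ k) ∨
      (I.IsRightExponent k ∧ r = S.ρ (Fin.last (n + 1)) ^ k)}.Finite := by
  have : {r | ∃ (I : Island S M) (k : ℕ), (I.IsLeftExponent k ∧ r = S.ρ 0 ^ k) ∨
      (I.IsRightExponent k ∧ r = S.ρ (Fin.last (n + 1)) ^ k)} =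
      (⋃ I : Island S M, {r | ∃ k : ℕ, I.IsLeftExponent k ∧ r = S.ρ 0 ^ k}) ∪
      ⋃ I : Island S M, {r | ∃ k : ℕ, I.IsRightExponent k ∧ r = S.ρ (Fin.last (n + 1)) ^ k} := by
    ext r
    simp only [mem_ofPred_eq, mem_union, mem_iUnion, exists_or]
  rw [this]
  refine (H.finite_iUnion _ ?_ fun I => ?_).union (H.finite_iUnion _ ?_ fun I => ?_)
  · rintro I J h r ⟨p, hp, rfl⟩
    exact ⟨p, h.isLeftExponent hp, rfl⟩
  -- The exponent is a least element determined by the map f, of which there are finitely many.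
  · refine (I.finite_V.image fun f => S.ρ 0 ^
      sInf {k | ∀ g ∈ I.V, g ≠ f → f ((S.map 0)^[k] 1) < g 0}).subset ?_
    rintro r ⟨p, ⟨f, hf, -, hleast⟩, rfl⟩
    exact ⟨f, hf, by rw [← hleast.csInf_eq]⟩
  · rintro I J h r ⟨p, hp, rfl⟩
    exact ⟨p, h.isRightExponent hp, rfl⟩
  · refine (I.finite_V.image fun f => S.ρ (Fin.last (n + 1)) ^
      sInf {k | ∀ g ∈ I.V, g ≠ f → g 1 < f ((S.map (Fin.last (n + 1)))^[k] 0)}).subset ?_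
    rintro r ⟨p, ⟨f, hf, -, hleast⟩, rfl⟩
    exact ⟨f, hf, by rw [← hleast.csInf_eq]⟩

theorem Nat.exists_isLeast {E : Set ℕ} (h : E.Nonempty) : ∃ p, IsLeast E p :=
  ⟨sInf E, Nat.sInf_mem h, fun _ hq => Nat.sInf_le hq⟩

/-- By Assumption A no other constitutive interval starts at the left endpoint, since one of the two
would contain the other. As S_1^p(1) tends to 0, the images f(S_1^p(1)) eventually fall below all
the other left endpoints. -/
theorem FiniteTypeIFS.exists_isLeftExponent (H : FiniteTypeIFS S M K) (hA : AssumptionA S M)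
    (I : Island S M) : ∃ p, I.IsLeftExponent p := by
  obtain ⟨f, hf, h0⟩ := I.isIsland.exists_left
  obtain ⟨p, hp⟩ : ∃ p, IsLeast {k | ∀ g ∈ I.V, g ≠ f → f ((S.map 0)^[k] 1) < g 0} p := by
    apply Nat.exists_isLeast
    have hlim : Tendsto (fun p : ℕ => f ((S.map 0)^[p] 1)) atTop (nhds (f 0)) := by
      have h1 : Tendsto (fun p : ℕ => (f 1 - f 0) * (S.ρ 0 ^ p * 1) + f 0) atTop
          (nhds ((f 1 - f 0) * (0 * 1) + f 0)) :=
        (((tendsto_pow_atTop_nhds_zero_of_lt_one (S.ρ_pos 0).le (S.ρ_lt_one 0)).mul_const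
          1).const_mul _).add_const _
      rw [zero_mul, mul_zero, zero_add] at h1
      refine h1.congr fun p => ?_
      rw [vertex_apply hf.1 ((S.map 0)^[p] 1), H.iterate_first]
    have hev : ∀ᶠ p : ℕ in atTop, ∀ g ∈ I.V, g ≠ f → f ((S.map 0)^[p] 1) < g 0 := by
      rw [eventually_all_finite I.finite_V]
      intro g hg
      by_cases hgf : g = f
      · exact Eventually.of_forall fun p h => (h hgf).elim
      have hlt : f 0 < g 0 := by
        refine lt_of_le_of_ne (h0 ▸ (mem_constituents.1 hg).2.1) fun heq => ?_
        rcases le_total (f 1) (g 1) with h | h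
        · refine hA I f hf g hg (Ne.symm hgf) ?_
          rw [vertex_image_Icc hf.1, vertex_image_Icc hg.1]
          exact Icc_subset_Icc heq.ge h
        · refine hA I g hg f hf hgf ?_
          rw [vertex_image_Icc hf.1, vertex_image_Icc hg.1]
          exact Icc_subset_Icc heq.le h
      exact (hlim.eventually_lt_const hlt).mono fun p hp _ => hp
    obtain ⟨p, hp⟩ := hev.exists
    exact ⟨p, hp⟩
  exact ⟨p, f, hf, h0, hp⟩

theorem FiniteTypeIFS.exists_isRightExponent (H : FiniteTypeIFS S M K) (hA : AssumptionA S M)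
    (I : Island S M) : ∃ p, I.IsRightExponent p := by
  obtain ⟨f, hf, h0⟩ := I.isIsland.exists_right
  obtain ⟨p, hp⟩ : ∃ p, IsLeast {k | ∀ g ∈ I.V, g ≠ f →
      g 1 < f ((S.map (Fin.last (n + 1)))^[k] 0)} p := by
    apply Nat.exists_isLeast
    have hlim : Tendsto (fun p : ℕ => f ((S.map (Fin.last (n + 1)))^[p] 0)) atTop
        (nhds (f 1)) := by
      have h1 : Tendsto (fun p : ℕ => (f 1 - f 0) * (1 - S.ρ (Fin.last (n + 1)) ^ p * (1 - 0))
          + f 0) atTop (nhds ((f 1 - f 0) * (1 - 0 * (1 - 0)) + f 0)) :=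
        ((((tendsto_pow_atTop_nhds_zero_of_lt_one (S.ρ_pos _).le (S.ρ_lt_one _)).mul_const
          _).const_sub 1).const_mul _).add_const _
      have e : (f 1 - f 0) * (1 - 0 * (1 - 0)) + f 0 = f 1 := by ring
      rw [e] at h1
      refine h1.congr fun p => ?_
      rw [vertex_apply hf.1 ((S.map (Fin.last (n + 1)))^[p] 0), H.iterate_last]
    have hev : ∀ᶠ p : ℕ in atTop, ∀ g ∈ I.V, g ≠ f →
        g 1 < f ((S.map (Fin.last (n + 1)))^[p] 0) := by
      rw [eventually_all_finite I.finite_V]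
      intro g hg
      by_cases hgf : g = f
      · exact Eventually.of_forall fun p h => (h hgf).elim
      have hlt : g 1 < f 1 := by
        refine lt_of_le_of_ne (h0 ▸ (mem_constituents.1 hg).2.2) fun heq => ?_
        rcases le_total (f 0) (g 0) with h | h
        · refine hA I g hg f hf hgf ?_
          rw [vertex_image_Icc hf.1, vertex_image_Icc hg.1]
          exact Icc_subset_Icc h heq.le
        · refine hA I f hf g hg (Ne.symm hgf) ?_
          rw [vertex_image_Icc hf.1, vertex_image_Icc hg.1]
          exact Icc_subset_Icc h heq.ge
      exact (hlim.eventually_const_lt hlt).mono fun p hp _ => hp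
    obtain ⟨p, hp⟩ := hev.exists
    exact ⟨p, hp⟩
  exact ⟨p, f, hf, h0, hp⟩

theorem FiniteTypeIFS.etaTwo_pos (H : FiniteTypeIFS S M K) (hA : AssumptionA S M) :
    0 < etaTwo S M := by
  refine H.finite_etaTwo_set.sInf_pos ?_ ?_
  · obtain ⟨p, hp⟩ := H.exists_isLeftExponent hA H.rootIsland
    exact ⟨_, H.rootIsland, p, Or.inl ⟨hp, rfl⟩⟩
  · rintro r ⟨I, p, ⟨-, rfl⟩ | ⟨-, rfl⟩⟩
    · exact pow_pos (S.ρ_pos _) _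
    · exact pow_pos (S.ρ_pos _) _

theorem FiniteTypeIFS.etaTwo_le_left (H : FiniteTypeIFS S M K) {I : Island S M} {p : ℕ}
    (hp : I.IsLeftExponent p) : etaTwo S M ≤ S.ρ 0 ^ p :=
  csInf_le H.finite_etaTwo_set.bddBelow ⟨I, p, Or.inl ⟨hp, rfl⟩⟩

theorem FiniteTypeIFS.etaTwo_le_right (H : FiniteTypeIFS S M K) {I : Island S M} {p : ℕ}
    (hp : I.IsRightExponent p) : etaTwo S M ≤ S.ρ (Fin.last (n + 1)) ^ p :=
  csInf_le H.finite_etaTwo_set.bddBelow ⟨I, p, Or.inr ⟨hp, rfl⟩⟩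

theorem FiniteTypeIFS.eta_pos (H : FiniteTypeIFS S M K) (hA : AssumptionA S M) : 0 < eta S M :=
  mul_pos H.etaOne_pos (H.etaTwo_pos hA)

theorem FiniteTypeIFS.eta_le_one (H : FiniteTypeIFS S M K) (hA : AssumptionA S M) :
    eta S M ≤ 1 := by
  obtain ⟨p, hp⟩ := H.exists_isLeftExponent hA H.rootIsland
  exact mul_le_one₀ H.etaOne_le_one (H.etaTwo_pos hA).le
    ((H.etaTwo_le_left hp).trans (pow_le_one₀ (S.ρ_pos _).le (S.ρ_lt_one _).le))

theorem finite_lengths (S : LinearIFS (n + 2)) (M : ℕ → Finset (List (Fin (n + 2)))) (k : ℕ) :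
    {r | ∃ I : Island S M, I.level = k ∧ r = I.length}.Finite := by
  refine ((finite_islands S M k).image fun p => p.2 - p.1).subset ?_
  rintro r ⟨⟨l, a, b, h⟩, rfl, rfl⟩
  exact ⟨(a, b), h, rfl⟩

theorem IsIsland.le_betaMax (h : IsIsland S M k a b) : b - a ≤ betaMax S M k :=
  le_csSup (finite_lengths S M k).bddAbove ⟨⟨k, a, b, h⟩, rfl, rfl⟩

theorem IsIsland.betaMin_le (h : IsIsland S M k a b) : betaMin S M k ≤ b - a :=
  csInf_le (finite_lengths S M k).bddBelow ⟨⟨k, a, b, h⟩, rfl, rfl⟩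

theorem FiniteTypeIFS.nonempty_lengths (H : FiniteTypeIFS S M K) (k : ℕ) :
    {r | ∃ I : Island S M, I.level = k ∧ r = I.length}.Nonempty := by
  obtain ⟨b, h⟩ := H.exists_first_island k
  exact ⟨_, ⟨k, 0, b, h⟩, rfl, rfl⟩

theorem FiniteTypeIFS.betaMin_pos (H : FiniteTypeIFS S M K) (k : ℕ) : 0 < betaMin S M k := by
  refine (finite_lengths S M k).sInf_pos (H.nonempty_lengths k) ?_
  rintro r ⟨I, -, rfl⟩
  exact Island.length_pos I

theorem FiniteTypeIFS.vertex_sub_le_betaMax (H : FiniteTypeIFS S M K) {f : ℝ → ℝ}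
    (hf : f ∈ vertices S M k) : f 1 - f 0 ≤ betaMax S M k := by
  obtain ⟨a, b, h, h1, h2⟩ := H.exists_island_of_vertex hf
  linarith [h.le_betaMax]

/-- The length of an island is at most 1/`etaOne` times that of its leftmost constitutive interval,
which is short because the words of its generation are long. -/
theorem FiniteTypeIFS.tendsto_betaMax (H : FiniteTypeIFS S M K) :
    Tendsto (betaMax S M) atTop (nhds 0) := by
  obtain ⟨R, hR0, hR1, hR⟩ := S.exists_ρ_le
  have h1 : Tendsto (fun k => R ^ minLength (M k) / etaOne S M) atTop (nhds (0 / etaOne S M)) :=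
    ((tendsto_pow_atTop_nhds_zero_of_lt_one hR0.le hR1).comp H.index.min_tendsto).div_const _
  rw [zero_div] at h1
  refine tendsto_of_tendsto_of_tendsto_of_le_of_le tendsto_const_nhds h1 (fun k => ?_) fun k => ?_
  · obtain ⟨b, h⟩ := H.exists_first_island k
    linarith [h.le_betaMax, h.lt]
  · refine csSup_le (H.nonempty_lengths k) ?_
    rintro r ⟨I, rfl, rfl⟩
    obtain ⟨f, hf, h0⟩ := I.isIsland.exists_left
    rw [le_div_iff₀ H.etaOne_pos, mul_comm]
    exact (H.etaOne_mul_le I hf (Or.inl h0)).trans (vertex_sub_le hR hR0.le hR1.le hf.1)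

theorem FiniteTypeIFS.exists_ncard_le (H : FiniteTypeIFS S M K) :
    ∃ N : ℕ, ∀ I : Island S M, I.V.ncard ≤ N := by
  have hfin : (⋃ I : Island S M, {I.V.ncard}).Finite := by
    refine H.finite_iUnion _ ?_ fun I => finite_singleton _
    rintro I J ⟨s, t, hs, hl, hr, hV, -⟩
    rw [hV, ncard_image_of_injective]
    intro f g h
    funext x
    have := congrFun h x
    simp only [Function.comp_apply, add_left_inj] at this
    exact mul_left_cancel₀ hs.ne' this
  obtain ⟨N, hN⟩ := hfin.bddAbove
  exact ⟨N, fun I => hN (mem_iUnion.2 ⟨I, rfl⟩)⟩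

/-- The offspring of an island have comparable length. -/
theorem FiniteTypeIFS.exists_offspring_ratio (H : FiniteTypeIFS S M K) :
    ∃ q : ℝ, 0 < q ∧ ∀ k a b c d, IsIsland S M k a b → IsIsland S M (k + 1) c d → a ≤ c → d ≤ b →
      q * (b - a) ≤ d - c := by
  have hfin : (⋃ I : Island S M, {r : ℝ | ∃ c d, IsIsland S M (I.level + 1) c d ∧
      Icc c d ⊆ Icc I.left I.right ∧ r = (d - c) / I.length}).Finite := by
    refine H.finite_iUnion _ ?_ fun I => ?_
    · rintro I J ⟨s, t, hs, hl, hr, -, hI⟩ r ⟨c, d, h, hsub, rfl⟩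
      obtain ⟨h', hsub'⟩ := (hI 1 le_rfl c d).1 ⟨h, hsub⟩
      refine ⟨_, _, h', hsub', ?_⟩
      simp only [Island.length, ← hl, ← hr]
      rw [add_sub_add_right_eq_sub, add_sub_add_right_eq_sub, ← mul_sub, ← mul_sub,
        mul_div_mul_left _ _ hs.ne']
    · refine ((finite_islands S M (I.level + 1)).image fun p => (p.2 - p.1) / I.length).subset ?_
      rintro r ⟨c, d, h, -, rfl⟩
      exact ⟨(c, d), h, rfl⟩
  -- The empty case is split off because the infimum of the empty set is 0; there the claim is void.
  rcases (⋃ I : Island S M, {r : ℝ | ∃ c d, IsIsland S M (I.level + 1) c d ∧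
      Icc c d ⊆ Icc I.left I.right ∧ r = (d - c) / I.length}).eq_empty_or_nonempty with he | hne
  · refine ⟨1, one_pos, fun k a b c d h h' hac hdb => ?_⟩
    exact (eq_empty_iff_forall_notMem.1 he _ (mem_iUnion.2
      ⟨⟨k, a, b, h⟩, c, d, h', Icc_subset_Icc hac hdb, rfl⟩)).elim
  · refine ⟨_, hfin.sInf_pos hne ?_, fun k a b c d h h' hac hdb => ?_⟩
    · intro r hr
      obtain ⟨I, c, d, h, -, rfl⟩ := mem_iUnion.1 hr
      exact div_pos (sub_pos.2 h.lt) (Island.length_pos I)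
    · rw [← le_div_iff₀ (sub_pos.2 h.lt)]
      exact csInf_le hfin.bddBelow (mem_iUnion.2
        ⟨⟨k, a, b, h⟩, c, d, h', Icc_subset_Icc hac hdb, rfl⟩)

end Invariants

/-! ### Similar islands and the reduction to generations at most k₀ -/

section Similarity

variable {n : ℕ} {S : LinearIFS (n + 2)} {M : ℕ → Finset (List (Fin (n + 2)))} {K : Set ℝ}
  {k : ℕ} {a b c d : ℝ}

open FiniteTypeIFS

/-- The affine map `x ↦ s x + t` carries the island `[a,b]` of generation `k` to the island
`[a',b']` of generation `k'` together with their descendants and their parts of `K`. -/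
structure IsIslandSimilarity (S : LinearIFS (n + 2)) (M : ℕ → Finset (List (Fin (n + 2))))
    (K : Set ℝ) (k : ℕ) (a b : ℝ) (k' : ℕ) (a' b' s t : ℝ) : Prop where
  pos : 0 < s
  left : s * a + t = a'
  right : s * b + t = b'
  mem_iff : ∀ x ∈ Icc a b, (x ∈ K ↔ s * x + t ∈ K)
  descendant_iff : ∀ l : ℕ, 1 ≤ l → ∀ c d : ℝ, (IsIsland S M (k + l) c d ∧ a ≤ c ∧ d ≤ b) ↔
    (IsIsland S M (k' + l) (s * c + t) (s * d + t) ∧ a' ≤ s * c + t ∧ s * d + t ≤ b')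

theorem IsIslandSimilarity.refl (k : ℕ) (a b : ℝ) : IsIslandSimilarity S M K k a b k a b 1 0 :=
  ⟨one_pos, by ring, by ring, by simp, by simp⟩

theorem IsIslandSimilarity.trans {k₁ k₂ k₃ : ℕ} {a₁ b₁ a₂ b₂ a₃ b₃ s t s' t' : ℝ}
    (h : IsIslandSimilarity S M K k₁ a₁ b₁ k₂ a₂ b₂ s t)
    (h' : IsIslandSimilarity S M K k₂ a₂ b₂ k₃ a₃ b₃ s' t') :
    IsIslandSimilarity S M K k₁ a₁ b₁ k₃ a₃ b₃ (s' * s) (s' * t + t') := by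
  have key : ∀ x, s' * s * x + (s' * t + t') = s' * (s * x + t) + t' := fun x => by ring
  refine ⟨mul_pos h'.pos h.pos, by rw [key, h.left, h'.left], by rw [key, h.right, h'.right], ?_,
    ?_⟩
  · intro x hx
    have h1 := mul_le_mul_of_nonneg_left hx.1 h.pos.le
    have h2 := mul_le_mul_of_nonneg_left hx.2 h.pos.le
    rw [h.mem_iff x hx, h'.mem_iff _ ⟨by rw [← h.left]; linarith, by rw [← h.right]; linarith⟩, key]
  · intro l hl c d
    rw [h.descendant_iff l hl, h'.descendant_iff l hl, key, key]

/-- An equivalence of islands says nothing about the constitutive maps of later generations, but it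
does control the later islands and, as shown next, the points of K. A similarity records just these
data, and they restrict to offspring with the same s and t. -/
theorem IsIslandSimilarity.offspring {k' : ℕ} {a' b' s t : ℝ}
    (h : IsIslandSimilarity S M K k a b k' a' b' s t) (hI : IsIsland S M (k + 1) c d)
    (hac : a ≤ c) (hdb : d ≤ b) :
    IsIsland S M (k' + 1) (s * c + t) (s * d + t) ∧
      IsIslandSimilarity S M K (k + 1) c d (k' + 1) (s * c + t) (s * d + t) s t := by
  obtain ⟨h1, h2, h3⟩ := (h.descendant_iff 1 le_rfl c d).1 ⟨hI, hac, hdb⟩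
  refine ⟨h1, h.pos, rfl, rfl, fun x hx => h.mem_iff x ⟨hac.trans hx.1, hx.2.trans hdb⟩, ?_⟩
  intro l hl e f
  have hs := h.pos
  have hD := h.descendant_iff (1 + l) (by omega) e f
  rw [← add_assoc, ← add_assoc] at hD
  have e1 : c ≤ e ↔ s * c + t ≤ s * e + t := by
    rw [add_le_add_iff_right, mul_le_mul_iff_right₀ hs]
  have e2 : f ≤ d ↔ s * f + t ≤ s * d + t := by
    rw [add_le_add_iff_right, mul_le_mul_iff_right₀ hs]
  constructor
  · rintro ⟨hi, hce, hfd⟩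
    exact ⟨(hD.1 ⟨hi, hac.trans hce, hfd.trans hdb⟩).1, e1.1 hce, e2.1 hfd⟩
  · rintro ⟨hi, hce, hfd⟩
    exact ⟨(hD.2 ⟨hi, h2.trans hce, hfd.trans h3⟩).1, e1.2 hce, e2.2 hfd⟩

/-- The part of K in an island is the union of the sets f(K) over its constitutive maps, so the
correspondence of those maps carries one part of K onto the other. -/
theorem FiniteTypeIFS.similarity_of_equivalent (H : FiniteTypeIFS S M K) {I J : Island S M}
    (h : I.Equivalent J) : ∃ s t,
      IsIslandSimilarity S M K I.level I.left I.right J.level J.left J.right s t := by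
  obtain ⟨s, t, hs, hl, hr, hV, hD⟩ := h
  refine ⟨s, t, hs, hl, hr, fun x hx => ⟨fun hxK => ?_, fun hxK => ?_⟩, fun m hm c d => ?_⟩
  · obtain ⟨f, hf, y, hy, rfl⟩ := H.exists_constituent_eq I.isIsland hxK hx
    have hg : (fun x => s * x + t) ∘ f ∈ J.V := by rw [hV]; exact mem_image_of_mem _ hf
    exact H.vertex_mem hg.1 hy
  · have h1 := mul_le_mul_of_nonneg_left hx.1 hs.le
    have h2 := mul_le_mul_of_nonneg_left hx.2 hs.le
    obtain ⟨g, hg, y, hy, hgy⟩ := H.exists_constituent_eq J.isIsland hxK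
      ⟨by rw [← hl]; linarith, by rw [← hr]; linarith⟩
    have hg' : g ∈ J.V := hg
    rw [hV] at hg'
    obtain ⟨f, hf, rfl⟩ := hg'
    simp only [Function.comp_apply, add_left_inj] at hgy
    rw [← mul_left_cancel₀ hs.ne' hgy]
    exact H.vertex_mem hf.1 hy
  · have := hD m hm c d
    constructor
    · rintro ⟨h1, h2, h3⟩
      obtain ⟨h4, h5⟩ := this.1 ⟨h1, Icc_subset_Icc h2 h3⟩
      exact ⟨h4, (Icc_subset_Icc_iff h4.lt.le).1 h5⟩
    · rintro ⟨h1, h2, h3⟩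
      obtain ⟨h4, h5⟩ := this.2 ⟨h1, Icc_subset_Icc h2 h3⟩
      exact ⟨h4, (Icc_subset_Icc_iff h4.lt.le).1 h5⟩

/-- Every island is similar to one of generation at most `k₀`. -/
theorem FiniteTypeIFS.exists_similarity (H : FiniteTypeIFS S M K) {k₀ : ℕ} (hk₀ : NoNewType S M k₀)
    (h : IsIsland S M k a b) : ∃ k' a' b' s t, k' ≤ k₀ ∧ IsIsland S M k' a' b' ∧
      IsIslandSimilarity S M K k a b k' a' b' s t := by
  induction k generalizing a b with
  | zero => exact ⟨0, a, b, 1, 0, Nat.zero_le _, h, .refl _ _ _⟩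
  | succ k ih =>
    obtain ⟨c, d, hP, hca, hbd⟩ := H.exists_parent h
    obtain ⟨k', a', b', s, t, hk', hI', hsim⟩ := ih hP
    obtain ⟨hJ, hsimJ⟩ := hsim.offspring h hca hbd
    -- The image of the offspring has generation k' + 1. Only for k' = k₀ is this too large, and
    -- then its type occurs already in a generation at most k₀.
    rcases Nat.lt_or_ge k' k₀ with hlt | hge
    · exact ⟨_, _, _, s, t, hlt, hJ, hsimJ⟩
    · obtain rfl : k' = k₀ := le_antisymm hk' hge
      obtain ⟨L, hL, hty⟩ := hk₀ ⟨k' + 1, _, _, hJ⟩ rfl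
      have heq : Island.Equivalent ⟨k' + 1, _, _, hJ⟩ L := Quotient.exact hty.symm
      obtain ⟨s', t', hs'⟩ := H.similarity_of_equivalent heq
      exact ⟨_, _, _, _, _, hL, L.isIsland, hsimJ.trans hs'⟩

end Similarity

/-! ### Lakes and the positivity of γ*_min -/

section Lakes

variable {n : ℕ} {S : LinearIFS (n + 2)} {M : ℕ → Finset (List (Fin (n + 2)))} {K : Set ℝ}
  {k : ℕ} {a b c d : ℝ}

open FiniteTypeIFS

theorem finite_lakeLengths (S : LinearIFS (n + 2)) (M : ℕ → Finset (List (Fin (n + 2)))) (k : ℕ) :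
    (lakeLengths S M k).Finite := by
  refine (((finite_islands S M k).prod (finite_islands S M k)).image
    fun p => p.2.1 - p.1.2).subset ?_
  rintro r ⟨⟨l, a, b, h⟩, ⟨l', c, d, h'⟩, rfl, hl', -, -, rfl⟩
  dsimp only at hl'
  subst hl'
  exact ⟨((a, b), (c, d)), ⟨h, h'⟩, rfl⟩

theorem gammaMinStar_le {r : ℝ} (hr : r ∈ lakeLengths S M k) (h0 : 0 < r) :
    gammaMinStar S M k ≤ r :=
  csInf_le ((finite_lakeLengths S M k).subset fun _ h => h.1).bddBelow ⟨hr, h0⟩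

/-- The island to the right of `[a, b]`. -/
theorem IsIsland.exists_next (h : IsIsland S M k a b) (h' : IsIsland S M k c d) (hbc : b ≤ c) :
    ∃ c' d', IsIsland S M k c' d' ∧ b ≤ c' ∧ c' ≤ c ∧ c' - b ∈ lakeLengths S M k := by
  have hfin : {p : ℝ × ℝ | IsIsland S M k p.1 p.2 ∧ b ≤ p.1}.Finite :=
    (finite_islands S M k).subset fun _ h => h.1
  obtain ⟨⟨c', d'⟩, ⟨h1, h2⟩, hmin⟩ := hfin.exists_minimalFor (fun p => p.1) _ ⟨(c, d), h', hbc⟩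
  have hmin' : ∀ e f, IsIsland S M k e f → b ≤ e → c' ≤ e := fun e f he hbe => by
    rcases le_total c' e with h | h
    · exact h
    · exact hmin (j := (e, f)) ⟨he, hbe⟩ h
  refine ⟨c', d', h1, h2, hmin' c d h' hbc, ⟨k, a, b, h⟩, ⟨k, c', d', h1⟩, rfl, rfl, h2, ?_, rfl⟩
  rintro ⟨l, e, f, he⟩ hl
  dsimp only at hl
  subst hl
  rcases h.trichotomy he with ⟨rfl, rfl⟩ | hbe | hfa
  · exact Or.inl le_rfl
  · exact Or.inr (hmin' e f he hbe)
  · exact Or.inl (hfa.trans h.lt.le)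

/-- A point outside every island of generation `k` gives a lake of positive length. -/
theorem FiniteTypeIFS.exists_lake (H : FiniteTypeIFS S M K) {x : ℝ} (hx : x ∈ Icc (0 : ℝ) 1)
    (hno : ∀ a b, IsIsland S M k a b → x ∉ Icc a b) : ∃ r ∈ lakeLengths S M k, 0 < r := by
  have hfin : {p : ℝ × ℝ | IsIsland S M k p.1 p.2 ∧ p.1 ≤ x}.Finite :=
    (finite_islands S M k).subset fun _ h => h.1
  obtain ⟨b₀, h₀⟩ := H.exists_first_island k
  obtain ⟨⟨a, b⟩, ⟨h1, h2⟩, hmax⟩ := hfin.exists_maximalFor (fun p => p.1) _ ⟨(0, b₀), h₀, hx.1⟩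
  have hbx : b < x := by
    by_contra hle
    exact hno a b h1 ⟨h2, not_lt.1 hle⟩
  obtain ⟨e, he⟩ := H.exists_last_island k
  have hbe : b ≤ e := by
    rcases h1.trichotomy he with ⟨-, rfl⟩ | h | h
    · exact absurd hx.2 (not_le.2 hbx)
    · exact h
    · exact absurd (h1.lt.trans (hbx.trans_le hx.2)) (not_lt.2 h)
  obtain ⟨c, d, hc, hbc, -, hlake⟩ := h1.exists_next he hbe
  refine ⟨_, hlake, ?_⟩
  by_contra hle
  have hcb : c ≤ b := by linarith
  have := hmax (j := (c, d)) ⟨hc, hcb.trans hbx.le⟩ (h1.lt.le.trans hbc)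
  exact absurd (h1.lt.trans_le hbc) (not_lt.2 this)

theorem IsIsland.mem_Icc_unique (h : IsIsland S M k a b) (h' : IsIsland S M k c d) {x : ℝ}
    (hx : x ∈ Ioo a b) (hx' : x ∈ Icc c d) : c = a ∧ d = b := by
  rcases h'.trichotomy h with h | h | h
  · exact h
  · exact absurd (hx.1.trans_le hx'.2) (not_lt.2 h)
  · exact absurd (hx'.1.trans_lt hx.2) (not_lt.2 h)

/-- If no new types appear after generation `k₀` and the dimension is below one, then there is a
non-empty lake of generation `k₀ + 1`. -/
theorem FiniteTypeIFS.exists_lake_pos (H : FiniteTypeIFS S M K) {k₀ : ℕ} (hk₀ : NoNewType S M k₀)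
    (hdim : dimH K < 1) : ∃ r ∈ lakeLengths S M (k₀ + 1), 0 < r := by
  by_contra hcon
  have hG : ∀ x ∈ Icc (0 : ℝ) 1, ∃ a b, IsIsland S M (k₀ + 1) a b ∧ x ∈ Icc a b := by
    intro x hx
    by_contra hno
    push Not at hno
    exact hcon (H.exists_lake hx hno)
  -- Without lakes in generation k₀ + 1, the ancestors of those islands show that each island of
  -- generation at most k₀ is filled by its offspring.
  have hfull₀ : ∀ k ≤ k₀, ∀ a b, IsIsland S M k a b → ∀ x ∈ Ioo a b,
      ∃ c d, IsIsland S M (k + 1) c d ∧ a ≤ c ∧ d ≤ b ∧ x ∈ Icc c d := by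
    intro k hk a b h x hx
    have hab := H.island_bounds h
    obtain ⟨e, f, he, hxe⟩ := hG x ⟨hab.1.trans hx.1.le, hx.2.le.trans hab.2⟩
    obtain ⟨c, d, hc, hce, hfd⟩ := H.exists_ancestor (Nat.succ_le_succ hk) he
    have hxc : x ∈ Icc c d := ⟨hce.trans hxe.1, hxe.2.trans hfd⟩
    obtain ⟨p, q, hp, hpc, hdq⟩ := H.exists_parent hc
    obtain ⟨rfl, rfl⟩ := h.mem_Icc_unique hp hx ⟨hpc.trans hxc.1, hxc.2.trans hdq⟩
    exact ⟨c, d, hc, hpc, hdq, hxc⟩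
  -- Similarity carries this property to the islands of all generations.
  have hfull : ∀ k a b, IsIsland S M k a b → ∀ x ∈ Ioo a b,
      ∃ c d, IsIsland S M (k + 1) c d ∧ a ≤ c ∧ d ≤ b ∧ x ∈ Icc c d := by
    intro k a b h x hx
    obtain ⟨k', a', b', s, t, hk', hI', hsim⟩ := H.exists_similarity hk₀ h
    have hs := hsim.pos
    have h1 : s * a < s * x := by rw [mul_lt_mul_iff_right₀ hs]; exact hx.1
    have h2 : s * x < s * b := by rw [mul_lt_mul_iff_right₀ hs]; exact hx.2
    obtain ⟨c', d', hc', hac, hdb, hx'⟩ := hfull₀ k' hk' a' b' hI' (s * x + t)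
      ⟨by rw [← hsim.left]; linarith, by rw [← hsim.right]; linarith⟩
    have hD := hsim.descendant_iff 1 le_rfl ((c' - t) / s) ((d' - t) / s)
    have ec : s * ((c' - t) / s) + t = c' := by field_simp; ring
    have ed : s * ((d' - t) / s) + t = d' := by field_simp; ring
    rw [ec, ed] at hD
    obtain ⟨h3, h4, h5⟩ := hD.2 ⟨hc', hac, hdb⟩
    refine ⟨_, _, h3, h4, h5, ?_, ?_⟩
    · rw [div_le_iff₀ hs]; linarith [hx'.1]
    · rw [le_div_iff₀ hs]; linarith [hx'.2]
  -- Passing from one generation to the next, only endpoints of islands are lost.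
  have hco : ∀ k, (Icc 0 1 \ openUnion S M k).Finite := by
    intro k
    induction k with
    | zero =>
      refine ((finite_singleton (1 : ℝ)).insert 0).subset ?_
      rintro x ⟨hx, hxU⟩
      have h01 : IsIsland S M 0 0 1 := H.island_zero_iff.2 ⟨rfl, rfl⟩
      by_contra hne
      simp only [mem_insert_iff, mem_singleton_iff, not_or] at hne
      exact hxU (h01.Ioo_subset ⟨lt_of_le_of_ne hx.1 (Ne.symm hne.1), lt_of_le_of_ne hx.2 hne.2⟩)
    | succ k ih =>
      have hf := finite_islands S M (k + 1)
      refine (ih.union ((hf.image fun p => p.1).union (hf.image fun p => p.2))).subset ?_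
      rintro x ⟨hx, hxU⟩
      by_cases hxk : x ∈ openUnion S M k
      · right
        obtain ⟨a, b, h, hxI⟩ := H.exists_island_of_mem_openUnion hxk
        obtain ⟨c, d, hc, -, -, hxc⟩ := hfull k a b h x hxI
        rcases eq_or_lt_of_le hxc.1 with rfl | hlt
        · exact Or.inl ⟨(c, d), hc, rfl⟩
        rcases eq_or_lt_of_le hxc.2 with rfl | hlt'
        · exact Or.inr ⟨(c, x), hc, rfl⟩
        exact (hxU (hc.Ioo_subset ⟨hlt, hlt'⟩)).elim
      · exact Or.inl ⟨hx, hxk⟩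
  have hcount : (⋃ k, Icc 0 1 \ openUnion S M k).Countable :=
    countable_iUnion fun k => (hco k).countable
  -- A point in all the open sets is within β_max^(k) of a left endpoint of an island, which belongs
  -- to K; as K is closed, the point is in K. So [0,1] is K up to a countable set, and K has
  -- dimension 1.
  have hsub : Icc (0 : ℝ) 1 ⊆ K ∪ ⋃ k, Icc 0 1 \ openUnion S M k := by
    intro x hx
    by_cases hxall : ∀ k, x ∈ openUnion S M k
    · left
      have hcl : ∀ ε > 0, ∃ y ∈ K, dist x y < ε := by
        intro ε hε
        obtain ⟨k, hk⟩ := (H.tendsto_betaMax.eventually_lt_const hε).exists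
        obtain ⟨a, b, h, hxI⟩ := H.exists_island_of_mem_openUnion (hxall k)
        refine ⟨a, H.left_mem h, ?_⟩
        rw [Real.dist_eq, abs_of_pos (sub_pos.2 hxI.1)]
        linarith [h.le_betaMax, hxI.2]
      rw [← H.attractor.1.isClosed.closure_eq]
      exact Metric.mem_closure_iff.2 hcl
    · push Not at hxall
      obtain ⟨k, hk⟩ := hxall
      exact Or.inr (mem_iUnion.2 ⟨k, hx, hk⟩)
  have h1 : dimH (Icc (0 : ℝ) 1) = 1 := by
    rw [Real.dimH_of_nonempty_interior (by rw [interior_Icc]; exact nonempty_Ioo.2 one_pos)]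
    simp
  have h2 := dimH_mono hsub
  rw [h1, dimH_union, dimH_countable hcount] at h2
  rw [max_eq_left (zero_le : (0 : ENNReal) ≤ dimH K)] at h2
  exact absurd hdim (not_lt.2 h2)

/-- Existence of a non-empty lake is essential here, since the infimum would otherwise take the
default value 0. -/
theorem FiniteTypeIFS.gammaMinStar_pos (H : FiniteTypeIFS S M K) {k₀ : ℕ}
    (hk₀ : NoNewType S M k₀) (hdim : dimH K < 1) : 0 < gammaMinStar S M (k₀ + 1) :=
  ((finite_lakeLengths S M (k₀ + 1)).subset fun _ h => h.1).sInf_pos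
    (H.exists_lake_pos hk₀ hdim) fun _ h => h.2

end Lakes

/-! ### The Hausdorff measure of K is positive and finite -/

section HausdorffMeasure

variable {n : ℕ} {S : LinearIFS (n + 2)} {M : ℕ → Finset (List (Fin (n + 2)))} {K : Set ℝ}

open FiniteTypeIFS

theorem dimH_eq_ofReal_hdim (hd1 : dimH K < 1) : dimH K = ENNReal.ofReal (hdim K) :=
  (ENNReal.ofReal_toReal (hd1.trans ENNReal.one_lt_top).ne).symm

theorem hdim_lt_one (h : dimH K < 1) : hdim K < 1 := by
  rw [dimH_eq_ofReal_hdim h] at h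
  exact ENNReal.ofReal_lt_one.1 h

/-- High iterates of the first and the last map give two disjoint copies of K, near 0 and near 1.
With exponent 0 their sum of powers is 2 > 1. -/
theorem FiniteTypeIFS.hdim_pos (H : FiniteTypeIFS S M K) (hd1 : dimH K < 1) : 0 < hdim K := by
  have hlim : ∀ j, ∀ᶠ p : ℕ in atTop, S.ρ j ^ p < 1 / 2 := fun j =>
    (tendsto_pow_atTop_nhds_zero_of_lt_one (S.ρ_pos j).le (S.ρ_lt_one j)).eventually_lt_const
      (by norm_num)
  obtain ⟨p, hp0, hp1⟩ := ((hlim 0).and (hlim (Fin.last (n + 1)))).exists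
  have h0 := pow_pos (S.ρ_pos 0) p
  have h1 := pow_pos (S.ρ_pos (Fin.last (n + 1))) p
  have key : ENNReal.ofReal 0 < dimH K := by
    refine lt_dimH_of_disjoint_copies (ι := Bool) H.attractor.1 H.attractor.2.1
      (r := fun i => cond i (S.ρ 0 ^ p) (S.ρ (Fin.last (n + 1)) ^ p))
      (c := fun i => cond i 0 (1 - S.ρ (Fin.last (n + 1)) ^ p)) ?_ ?_ ?_ ?_ le_rfl ?_
    · rintro (_ | _) <;> assumption
    · rintro (_ | _) <;> simp only [cond] <;> linarith
    · rintro (_ | _) x hx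
      · have := H.iterate_mem (Fin.last (n + 1)) p hx
        rw [H.iterate_last] at this
        simp only [cond]
        convert this using 1; ring
      · have := H.iterate_mem 0 p hx
        rw [H.iterate_first] at this
        simpa using this
    · have aux : ∀ x ∈ K, ∀ y ∈ K, S.ρ 0 ^ p * x + 0 <
          S.ρ (Fin.last (n + 1)) ^ p * y + (1 - S.ρ (Fin.last (n + 1)) ^ p) := by
        intro x hx y hy
        have := (H.subset_Icc hx).2
        have := (H.subset_Icc hy).1
        nlinarith
      rintro (_ | _) (_ | _) hij x hx y hy
      · exact (hij rfl).elim
      · exact (aux y hy x hx).ne'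
      · exact (aux x hx y hy).ne
      · exact (hij rfl).elim
    · simp
  rw [dimH_eq_ofReal_hdim hd1] at key
  simpa using key

/-- The lengths of the islands of a generation have a bounded sum of `α`-th powers. -/
theorem FiniteTypeIFS.sum_length_rpow_le (H : FiniteTypeIFS S M K) (hd1 : dimH K < 1) (k : ℕ) :
    ∑ p ∈ (finite_islands S M k).toFinset, (p.2 - p.1) ^ hdim K
      ≤ ((etaOne S M * S.ρ 0) ^ hdim K)⁻¹ := by
  set P := (finite_islands S M k).toFinset with hP
  have hmem : ∀ p : P, IsIsland S M k p.1.1 p.1.2 := fun p =>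
    (finite_islands S M k).mem_toFinset.1 p.2
  choose v hv hv0 using fun p : P => (hmem p).exists_left
  have hα := H.hdim_pos hd1
  have hρ := S.ρ_pos 0
  have hρ1 := S.ρ_lt_one 0
  have hη := H.etaOne_pos
  have hvV : ∀ p : P, v p ∈ vertices S M k := fun p => (hv p).1
  have hpos : ∀ p : P, 0 < (v p 1 - v p 0) * S.ρ 0 := fun p =>
    mul_pos (sub_pos.2 (vertex_lt (hvV p))) hρ
  -- The extra factor S_1 keeps each copy of K away from the right endpoint of its island, so copies
  -- in touching islands are disjoint as well. A sum above 1 would push the dimension above `hdim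
  -- K`.
  have hle : ∑ p : P, ((v p 1 - v p 0) * S.ρ 0) ^ hdim K ≤ 1 := by
    by_contra hlt
    push Not at hlt
    have hbound : ∀ p : P, ∀ x ∈ K, p.1.1 ≤ (v p 1 - v p 0) * S.ρ 0 * x + v p 0 ∧
        (v p 1 - v p 0) * S.ρ 0 * x + v p 0 < p.1.2 := by
      intro p x hx
      have hx' := H.subset_Icc hx
      have hb := (mem_constituents.1 (hv p)).2.2
      have hlt := sub_pos.2 (vertex_lt (hvV p))
      constructor
      · rw [hv0 p]
        have := mul_nonneg (hpos p).le hx'.1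
        rw [hv0 p] at this
        linarith
      · have h1 : (v p 1 - v p 0) * S.ρ 0 * x ≤ (v p 1 - v p 0) * S.ρ 0 * 1 :=
          mul_le_mul_of_nonneg_left hx'.2 (hpos p).le
        nlinarith
    have := lt_dimH_of_disjoint_copies (ι := P) H.attractor.1 H.attractor.2.1
      (r := fun p => (v p 1 - v p 0) * S.ρ 0) (c := fun p => v p 0) hpos
      (fun p => by
        have := H.vertex_zero_nonneg (hvV p)
        have := H.vertex_one_le (hvV p)
        have := vertex_lt (hvV p)
        nlinarith)
      (fun p x hx => by
        have := H.vertex_mem (hvV p) (H.map_mem 0 hx)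
        rw [vertex_apply (hvV p), H.map_first] at this
        convert this using 1; ring)
      (fun p q hpq x hx y hy heq => by
        have h1 := hbound p x hx
        have h2 := hbound q y hy
        rcases (hmem p).trichotomy (hmem q) with h | h | h
        · exact hpq (Subtype.ext (Prod.ext h.1 h.2))
        · linarith
        · linarith)
      hα.le hlt
    rw [← dimH_eq_ofReal_hdim hd1] at this
    exact lt_irrefl _ this
  rw [← Finset.sum_coe_sort P, ← one_div, le_div_iff₀ (Real.rpow_pos_of_pos (mul_pos hη hρ) _),
    Finset.sum_mul]
  refine le_trans (Finset.sum_le_sum fun p _ => ?_) hle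
  have hab := (hmem p).lt
  rw [← Real.mul_rpow (by linarith) (mul_pos hη hρ).le]
  refine Real.rpow_le_rpow (by have := sub_pos.2 hab; positivity) ?_ hα.le
  have := H.etaOne_mul_le ⟨k, _, _, hmem p⟩ (hv p) (Or.inl (hv0 p))
  simp only [Island.length] at this
  nlinarith

/-- The islands of generation k cover K, their lengths tend to 0, and their sums of α-th powers are
bounded independently of k. -/
theorem FiniteTypeIFS.hausdorffMeasure_ne_top (H : FiniteTypeIFS S M K) (hd1 : dimH K < 1) :
    μH[hdim K] K ≠ ⊤ := by
  have hlim : Tendsto (fun k => ENNReal.ofReal (betaMax S M k)) atTop (nhds 0) := by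
    have := ENNReal.tendsto_ofReal H.tendsto_betaMax
    simpa using this
  have hmem : ∀ k, ∀ p : (finite_islands S M k).toFinset, IsIsland S M k p.1.1 p.1.2 :=
    fun k p => (finite_islands S M k).mem_toFinset.1 p.2
  have hle := Measure.hausdorffMeasure_le_liminf_sum (hdim K) K _ hlim
    (fun k (p : (finite_islands S M k).toFinset) => Icc p.1.1 p.1.2)
    (Eventually.of_forall fun k p => by
      rw [Real.ediam_Icc]
      exact ENNReal.ofReal_le_ofReal (hmem k p).le_betaMax)
    (Eventually.of_forall fun k x hx => by
      obtain ⟨a, b, h, hxI⟩ := H.exists_island_of_mem k hx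
      exact mem_iUnion.2 ⟨⟨(a, b), by rw [Set.Finite.mem_toFinset]; exact h⟩, hxI⟩)
  refine ne_top_of_le_ne_top (b := ENNReal.ofReal (((etaOne S M * S.ρ 0) ^ hdim K)⁻¹))
    ENNReal.ofReal_ne_top (hle.trans (liminf_le_of_frequently_le' (Frequently.of_forall
      fun k => ?_)))
  refine le_trans (le_of_eq ?_) (ENNReal.ofReal_le_ofReal (H.sum_length_rpow_le hd1 k))
  rw [← Finset.sum_coe_sort _ fun p : ℝ × ℝ => (p.2 - p.1) ^ hdim K,
    ENNReal.ofReal_sum_of_nonneg]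
  · refine Finset.sum_congr rfl fun p _ => ?_
    rw [Real.ediam_Icc, ENNReal.ofReal_rpow_of_pos (sub_pos.2 (hmem k p).lt)]
  · rintro p -
    exact Real.rpow_nonneg (sub_nonneg.2 (hmem k p).lt.le) _

/-- The islands which are the first in their line of ancestors to have length at most `r`. -/
def stoppingIslands (S : LinearIFS (n + 2)) (M : ℕ → Finset (List (Fin (n + 2)))) (r : ℝ) :
    Set (Island S M) :=
  {I | I.length ≤ r ∧ ∃ k c d, I.level = k + 1 ∧ IsIsland S M k c d ∧ c ≤ I.left ∧ I.right ≤ d ∧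
    r < d - c}

theorem Island.eq_of_bounds {I J : Island S M} (h1 : I.level = J.level) (h2 : I.left = J.left)
    (h3 : I.right = J.right) : I = J := by
  cases I; cases J; simp_all

/-- If J is of a later generation, then its parent is longer than r, and so is the ancestor of that
parent in the generation of I. This ancestor differs from I, so it lies beside I and takes J along.
-/
theorem FiniteTypeIFS.stoppingIslands_disjoint_aux (H : FiniteTypeIFS S M K) {r : ℝ}
    {I J : Island S M} (hI : I ∈ stoppingIslands S M r) (hJ : J ∈ stoppingIslands S M r)
    (hIJ : I ≠ J) (hlev : I.level ≤ J.level) : I.right ≤ J.left ∨ J.right ≤ I.left := by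
  rcases eq_or_lt_of_le hlev with heq | hlt
  · have hJ' := J.isIsland
    rw [← heq] at hJ'
    rcases I.isIsland.trichotomy hJ' with h | h
    · exact (hIJ (Island.eq_of_bounds heq h.1 h.2)).elim
    · exact h
  · obtain ⟨-, k, c, d, hk, hP, hc, hd, hr⟩ := hJ
    obtain ⟨e, f, hA, hec, hdf⟩ := H.exists_ancestor (show I.level ≤ k by omega) hP
    rcases I.isIsland.trichotomy hA with h | h | h
    · have h1 := hI.1
      simp only [Island.length] at h1
      linarith [h.1, h.2]
    · left; linarith
    · right; linarith

theorem FiniteTypeIFS.stoppingIslands_disjoint (H : FiniteTypeIFS S M K) {r : ℝ}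
    {I J : Island S M} (hI : I ∈ stoppingIslands S M r) (hJ : J ∈ stoppingIslands S M r)
    (hIJ : I ≠ J) : Disjoint (Ioo I.left I.right) (Ioo J.left J.right) := by
  have h : I.right ≤ J.left ∨ J.right ≤ I.left := by
    rcases le_total I.level J.level with h | h
    · exact H.stoppingIslands_disjoint_aux hI hJ hIJ h
    · exact (H.stoppingIslands_disjoint_aux hJ hI hIJ.symm h).symm
  rw [Set.disjoint_left]
  rintro x hx hx'
  rcases h with h | h
  · linarith [hx.2, hx'.1]
  · linarith [hx'.2, hx.1]

/-- Take the first generation with an island of length at most r containing x. It is not generation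
0 as r < 1, and the parent also contains x, so minimality makes the parent longer than r. -/
theorem FiniteTypeIFS.exists_stoppingIsland (H : FiniteTypeIFS S M K) {r : ℝ} (hr0 : 0 < r)
    (hr1 : r < 1) {x : ℝ} (hx : x ∈ K) : ∃ I ∈ stoppingIslands S M r, x ∈ Icc I.left I.right := by
  classical
  have hex : ∃ k, ∃ c d, IsIsland S M k c d ∧ x ∈ Icc c d ∧ d - c ≤ r := by
    obtain ⟨k, hk⟩ := (H.tendsto_betaMax.eventually_lt_const hr0).exists
    obtain ⟨a, b, h, hxI⟩ := H.exists_island_of_mem k hx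
    exact ⟨k, a, b, h, hxI, h.le_betaMax.trans hk.le⟩
  obtain ⟨c, d, h, hxI, hle⟩ := Nat.find_spec hex
  rcases hk : Nat.find hex with _ | k
  · rw [hk, H.island_zero_iff] at h
    obtain ⟨rfl, rfl⟩ := h
    linarith
  · rw [hk] at h
    obtain ⟨e, f, hP, hec, hdf⟩ := H.exists_parent h
    refine ⟨⟨k + 1, c, d, h⟩, ⟨hle, k, e, f, rfl, hP, hec, hdf, ?_⟩, hxI⟩
    by_contra hlt
    push Not at hlt
    exact Nat.find_min hex (show k < Nat.find hex by omega)
      ⟨e, f, hP, ⟨hec.trans hxI.1, hxI.2.trans hdf⟩, hlt⟩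

/-- A bounded number of stopping islands of size about `b - a` meet `(a, b)`. -/
theorem FiniteTypeIFS.exists_card_stoppingIslands_le (H : FiniteTypeIFS S M K) :
    ∃ N : ℕ, ∀ a b : ℝ, a < b → ∀ T : Finset (Island S M),
      (∀ I ∈ T, I ∈ stoppingIslands S M (b - a) ∧ (Icc I.left I.right ∩ Ioo a b).Nonempty) →
      T.card ≤ N := by
  obtain ⟨q, hq, hratio⟩ := H.exists_offspring_ratio
  refine ⟨⌈3 / q⌉₊, fun a b hab T hT => ?_⟩
  have hlen : ∀ I ∈ T, q * (b - a) ≤ I.length := by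
    intro I hI
    obtain ⟨-, k, c, d, hk, hP, hc, hd, hr⟩ := (hT I hI).1
    have hI' := I.isIsland
    rw [hk] at hI'
    have := hratio k c d I.left I.right hP hI' hc hd
    exact (mul_le_mul_of_nonneg_left hr.le hq.le).trans this
  -- A volume count: these islands have disjoint interiors, length at least q(b - a), and lie in an
  -- interval of length 3(b - a).
  have hvol : ∑ I ∈ T, volume (Ioo I.left I.right) ≤ volume (Icc (a - (b - a)) (b + (b - a))) := by
    rw [← measure_biUnion_finset]
    · refine measure_mono (iUnion₂_subset fun I hI x hx => ?_)
      obtain ⟨⟨hle, -⟩, y, hy1, hy2⟩ := hT I hI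
      simp only [Island.length] at hle
      constructor <;> linarith [hx.1, hx.2, hy1.1, hy1.2, hy2.1, hy2.2]
    · intro I hI J hJ hIJ
      exact H.stoppingIslands_disjoint (hT I hI).1 (hT J hJ).1 hIJ
    · exact fun I _ => measurableSet_Ioo
  simp only [Real.volume_Ioo, Real.volume_Icc] at hvol
  rw [← ENNReal.ofReal_sum_of_nonneg fun I _ => sub_nonneg.2 I.isIsland.lt.le,
    ENNReal.ofReal_le_ofReal_iff (by linarith)] at hvol
  have h1 : (T.card : ℝ) * (q * (b - a)) ≤ 3 * (b - a) := by
    calc (T.card : ℝ) * (q * (b - a)) = ∑ I ∈ T, q * (b - a) := by simp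
      _ ≤ ∑ I ∈ T, I.length := Finset.sum_le_sum hlen
      _ ≤ 3 * (b - a) := le_trans hvol (by linarith)
  have h2 : (T.card : ℝ) ≤ 3 / q := by
    rw [le_div_iff₀ hq]
    have := sub_pos.2 hab
    nlinarith
  exact_mod_cast h2.trans (Nat.le_ceil _)

/-- Weak separation: the part of `K` in a short interval is covered by a bounded number of copies
of `K` which are not larger than the interval. -/
theorem FiniteTypeIFS.exists_cover_copies (H : FiniteTypeIFS S M K) :
    ∃ N : ℕ, ∀ a b : ℝ, a < b → b - a < 1 → ∃ (κ : Type) (_ : Fintype κ) (r c : κ → ℝ),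
      (∀ i, 0 < r i) ∧ (∀ i, r i ≤ b - a) ∧ Fintype.card κ ≤ N ∧
      ∀ x ∈ K, x ∈ Ioo a b → ∃ i, ∃ y ∈ K, x = r i * y + c i := by
  obtain ⟨N₁, hN₁⟩ := H.exists_card_stoppingIslands_le
  obtain ⟨N₂, hN₂⟩ := H.exists_ncard_le
  refine ⟨N₁ * N₂, fun a b hab hab1 => ?_⟩
  set T : Set (Island S M) :=
    {I | I ∈ stoppingIslands S M (b - a) ∧ (Icc I.left I.right ∩ Ioo a b).Nonempty} with hT
  have hTfin : T.Finite := by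
    by_contra hinf
    obtain ⟨F, hF, hcard⟩ := Set.Infinite.exists_subset_card_eq hinf (N₁ + 1)
    have := hN₁ a b hab F fun I hI => hF hI
    omega
  -- The copies are the constitutive maps of the stopping islands that meet (a,b); both the number
  -- of islands and the number of maps in each are bounded.
  let Q : Finset (Σ _ : Island S M, ℝ → ℝ) :=
    hTfin.toFinset.sigma fun I => I.finite_V.toFinset
  have hQ : ∀ p : Q, p.1.1 ∈ T ∧ p.1.2 ∈ p.1.1.V := fun p => by
    have := Finset.mem_sigma.1 p.2
    simpa using this
  refine ⟨Q, inferInstance, fun p => p.1.2 1 - p.1.2 0, fun p => p.1.2 0, fun p => ?_, fun p => ?_,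
    ?_, fun x hx hxab => ?_⟩
  · exact sub_pos.2 (vertex_lt (hQ p).2.1)
  · have h1 := (mem_constituents.1 (hQ p).2).2
    have h2 := (hQ p).1.1.1
    simp only [Island.length] at h2
    linarith
  · rw [Fintype.card_coe, Finset.card_sigma]
    calc ∑ I ∈ hTfin.toFinset, I.finite_V.toFinset.card ≤ ∑ I ∈ hTfin.toFinset, N₂ := by
          refine Finset.sum_le_sum fun I _ => ?_
          rw [← Set.ncard_eq_toFinset_card _ I.finite_V]
          exact hN₂ I
      _ = hTfin.toFinset.card * N₂ := by simp
      _ ≤ N₁ * N₂ := by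
          refine Nat.mul_le_mul_right _ (hN₁ a b hab _ fun I hI => ?_)
          exact hTfin.mem_toFinset.1 hI
  · obtain ⟨I, hI, hxI⟩ := H.exists_stoppingIsland (sub_pos.2 hab) hab1 hx
    obtain ⟨f, hf, y, hy, rfl⟩ := H.exists_constituent_eq I.isIsland hx hxI
    refine ⟨⟨⟨I, f⟩, ?_⟩, y, hy, vertex_apply hf.1 y⟩
    rw [Finset.mem_sigma]
    simp only [Set.Finite.mem_toFinset]
    exact ⟨⟨hI, _, hxI, hxab⟩, hf⟩

/-- If the measure vanished, K would have a cover by short intervals with sum of α-th powers below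
1/(N+1). Replacing each interval by at most N copies of K no larger than it gives a cover of K by
copies with sum below 1, so the dimension would be less than α. -/
theorem FiniteTypeIFS.hausdorffMeasure_ne_zero (H : FiniteTypeIFS S M K) (hd1 : dimH K < 1) :
    μH[hdim K] K ≠ 0 := by
  intro h0
  have hα := H.hdim_pos hd1
  obtain ⟨N, hN⟩ := H.exists_cover_copies
  have hlt : μH[hdim K] K < ENNReal.ofReal (1 / (N + 1)) := by
    rw [h0]; simp; positivity
  obtain ⟨s, a, b, hab, hab1, hcov, hsum⟩ :=
    exists_finite_Ioo_cover H.attractor.1 hα.le hlt (show (0 : ℝ) < 1 / 2 by norm_num)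
  have hN' := fun i : s => hN (a i) (b i) (hab i i.2) (by linarith [hab1 i i.2])
  choose κ hκ r c hr hrle hcard hc using hN'
  have hsum' : ∑ i ∈ s, (b i - a i) ^ hdim K < 1 / (N + 1) := by
    have h2 : ∑ i ∈ s, ENNReal.ofReal (b i - a i) ^ hdim K
        = ENNReal.ofReal (∑ i ∈ s, (b i - a i) ^ hdim K) := by
      rw [ENNReal.ofReal_sum_of_nonneg fun i hi => Real.rpow_nonneg (by linarith [hab i hi]) _]
      exact Finset.sum_congr rfl fun i hi => ENNReal.ofReal_rpow_of_pos (by linarith [hab i hi])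
    rw [h2] at hsum
    exact (ENNReal.ofReal_lt_ofReal_iff (by positivity)).1 hsum
  have := dimH_lt_of_subset_copies H.attractor.1 (ι := Σ i : s, κ i)
    (r := fun p => r p.1 p.2) (c := fun p => c p.1 p.2) (fun p => hr _ _)
    (fun p => (hrle p.1 p.2).trans_lt (by linarith [hab1 p.1 p.1.2]))
    (fun x hx => by
      obtain ⟨i, hi, hxi⟩ := mem_iUnion₂.1 (hcov hx)
      obtain ⟨j, y, hy, h⟩ := hc ⟨i, hi⟩ x hx hxi
      exact ⟨⟨⟨i, hi⟩, j⟩, y, hy, h⟩) hα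
    (by
      rw [Fintype.sum_sigma]
      calc ∑ i : s, ∑ j, r i j ^ hdim K ≤ ∑ i : s, N * (b i - a i) ^ hdim K := by
            refine Finset.sum_le_sum fun i _ => ?_
            have hp : 0 ≤ (b i - a i) ^ hdim K :=
              Real.rpow_nonneg (by linarith [hab i i.2]) _
            calc ∑ j, r i j ^ hdim K ≤ ∑ j : κ i, (b i - a i) ^ hdim K :=
                  Finset.sum_le_sum fun j _ =>
                    Real.rpow_le_rpow (hr i j).le (hrle i j) hα.le
              _ = Fintype.card (κ i) * (b i - a i) ^ hdim K := by simp
              _ ≤ N * (b i - a i) ^ hdim K :=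
                  mul_le_mul_of_nonneg_right (by exact_mod_cast hcard i) hp
        _ = N * ∑ i ∈ s, (b i - a i) ^ hdim K := by
            rw [← Finset.mul_sum, Finset.sum_coe_sort s fun i => (b i - a i) ^ hdim K]
        _ ≤ N * (1 / (N + 1)) := mul_le_mul_of_nonneg_left hsum'.le (by positivity)
        _ < 1 := by
            rw [mul_one_div, div_lt_one (by positivity)]
            linarith)
  rw [← dimH_eq_ofReal_hdim hd1] at this
  exact lt_irrefl _ this

end HausdorffMeasure

/-- The normalized Hausdorff measure of `[x, y]`. -/
noncomputable def mass (K : Set ℝ) (x y : ℝ) : ℝ := (normMeasure K (Icc x y)).toReal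

theorem density_Icc (K : Set ℝ) {x y : ℝ} (h : x ≤ y) :
    density K (Icc x y) = mass K x y / (y - x) ^ hdim K := by
  rw [density, Real.diam_Icc h, mass]

theorem mass_nonneg (K : Set ℝ) (x y : ℝ) : 0 ≤ mass K x y := ENNReal.toReal_nonneg

/-- If extending an interval of length `l` and mass `A` by `δ` adds mass at least `D δ^α` without
increasing the density, then `l D < δ^(1-α)`. -/
theorem mul_lt_rpow_of_extension {α l δ A D : ℝ} (h0 : 0 < α) (h1 : α < 1) (hl : 0 < l)
    (hδ : 0 < δ) (hA : 0 < A) (hA1 : A ≤ 1)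
    (h : A + D * δ ^ α ≤ A / l ^ α * (l + δ) ^ α) : l * D < δ ^ (1 - α) := by
  have hlα := Real.rpow_pos_of_pos hl α
  have e1 : (l + δ) ^ α = l ^ α * (1 + δ / l) ^ α := by
    rw [← Real.mul_rpow hl.le (by positivity)]
    congr 1; field_simp
  have e2 : (1 + δ / l) ^ α ≤ 1 + α * (δ / l) :=
    rpow_one_add_le_one_add_mul_self (by have := div_pos hδ hl; linarith) h0.le h1.le
  have e3 : A / l ^ α * (l + δ) ^ α = A * (1 + δ / l) ^ α := by
    rw [e1]; field_simp
  rw [e3] at h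
  -- This is Bernoulli's inequality together with A ≤ 1. The strictness of the conclusion comes from
  -- the factor α < 1.
  have h2 : D * δ ^ α ≤ α * (δ / l) := by
    have hx : 0 ≤ α * (δ / l) := by positivity
    nlinarith [mul_le_mul_of_nonneg_left e2 hA.le, mul_le_mul_of_nonneg_right hA1 hx]
  have hδα := Real.rpow_pos_of_pos hδ α
  have e4 : δ ^ (1 - α) = δ / δ ^ α := by
    rw [Real.rpow_sub hδ, Real.rpow_one]
  rw [e4, lt_div_iff₀ hδα]
  have h3 : l * (α * (δ / l)) = α * δ := by field_simp
  have := mul_le_mul_of_nonneg_left h2 hl.le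
  nlinarith

/-! ### The normalized measure and its scaling -/

section Mass

variable {n : ℕ} {S : LinearIFS (n + 2)} {M : ℕ → Finset (List (Fin (n + 2)))} {K : Set ℝ}

open FiniteTypeIFS

theorem normMeasure_apply (K : Set ℝ) {E : Set ℝ} (hE : MeasurableSet E) :
    normMeasure K E = (μH[hdim K] K)⁻¹ * μH[hdim K] (E ∩ K) := by
  rw [normMeasure, Measure.smul_apply, Measure.restrict_apply hE, smul_eq_mul]

theorem mass_eq_zero {x y : ℝ} (h : ∀ z ∈ Ioo x y, z ∉ K) (hd : 0 < hdim K) : mass K x y = 0 := by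
  have := Measure.nullSingletonClass_hausdorff ℝ hd
  have hsub : Icc x y ∩ K ⊆ {x, y} := by
    rintro z ⟨hz, hzK⟩
    rcases eq_or_lt_of_le hz.1 with rfl | h1
    · simp
    rcases eq_or_lt_of_le hz.2 with rfl | h2
    · simp
    exact (h z ⟨h1, h2⟩ hzK).elim
  have h0 : μH[hdim K] (Icc x y ∩ K) = 0 :=
    measure_mono_null hsub ((Set.toFinite _).measure_zero _)
  rw [mass, normMeasure_apply K measurableSet_Icc, h0, mul_zero, ENNReal.toReal_zero]

variable (H : FiniteTypeIFS S M K) (hd1 : dimH K < 1)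
include H hd1

theorem FiniteTypeIFS.isProbabilityMeasure : IsProbabilityMeasure (normMeasure K) := by
  refine ⟨?_⟩
  rw [normMeasure_apply K MeasurableSet.univ, univ_inter,
    ENNReal.inv_mul_cancel (H.hausdorffMeasure_ne_zero hd1) (H.hausdorffMeasure_ne_top hd1)]

theorem FiniteTypeIFS.nullSingletonClass : NullSingletonClass (normMeasure K) := by
  refine ⟨fun x => ?_⟩
  have := Measure.nullSingletonClass_hausdorff ℝ (H.hdim_pos hd1)
  rw [normMeasure_apply K (measurableSet_singleton x),
    measure_mono_null inter_subset_left (measure_singleton x), mul_zero]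

theorem FiniteTypeIFS.mass_le_one (x y : ℝ) : mass K x y ≤ 1 := by
  have := H.isProbabilityMeasure hd1
  have h := ENNReal.toReal_mono ENNReal.one_ne_top (prob_le_one (μ := normMeasure K) (s := Icc x y))
  simpa [mass] using h

theorem FiniteTypeIFS.mass_mono {x y x' y' : ℝ} (hx : x' ≤ x) (hy : y ≤ y') :
    mass K x y ≤ mass K x' y' := by
  have := H.isProbabilityMeasure hd1
  exact ENNReal.toReal_mono (measure_ne_top _ _) (measure_mono (Icc_subset_Icc hx hy))

/-- As an interval integral the mass is additive and depends continuously on both endpoints. Points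
have no mass, so closed and half-open intervals may be interchanged. -/
theorem FiniteTypeIFS.mass_eq_integral {x y : ℝ} (h : x ≤ y) :
    mass K x y = ∫ _ in x..y, (1 : ℝ) ∂(normMeasure K) := by
  have := H.nullSingletonClass hd1
  have := H.isProbabilityMeasure hd1
  rw [intervalIntegral.integral_of_le h, setIntegral_const, smul_eq_mul, mul_one, Measure.real,
    mass, measure_congr Ioc_ae_eq_Icc]

theorem FiniteTypeIFS.mass_add {x y z : ℝ} (hxy : x ≤ y) (hyz : y ≤ z) :
    mass K x y + mass K y z = mass K x z := by
  have := H.isProbabilityMeasure hd1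
  rw [H.mass_eq_integral hd1 hxy, H.mass_eq_integral hd1 hyz,
    H.mass_eq_integral hd1 (hxy.trans hyz), intervalIntegral.integral_add_adjacent_intervals]
  · exact intervalIntegrable_const
  · exact intervalIntegrable_const

theorem FiniteTypeIFS.continuous_mass : Continuous fun p : ℝ × ℝ =>
    ∫ _ in p.1..p.2, (1 : ℝ) ∂(normMeasure K) := by
  have := H.nullSingletonClass hd1
  have := H.isProbabilityMeasure hd1
  have hi : ∀ a b, IntervalIntegrable (fun _ => (1 : ℝ)) (normMeasure K) a b :=
    fun a b => intervalIntegrable_const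
  have hc := intervalIntegral.continuous_primitive hi 0
  have : (fun p : ℝ × ℝ => ∫ _ in p.1..p.2, (1 : ℝ) ∂(normMeasure K)) =
      fun p : ℝ × ℝ => (∫ _ in (0 : ℝ)..p.2, (1 : ℝ) ∂(normMeasure K)) -
        ∫ _ in (0 : ℝ)..p.1, (1 : ℝ) ∂(normMeasure K) := by
    funext p
    rw [intervalIntegral.integral_interval_sub_left (hi _ _) (hi _ _)]
  rw [this]
  exact (hc.comp continuous_snd).sub (hc.comp continuous_fst)

theorem FiniteTypeIFS.mass_zero_one : mass K 0 1 = 1 := by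
  rw [mass, normMeasure_apply K measurableSet_Icc, inter_eq_self_of_subset_right H.subset_Icc,
    ENNReal.inv_mul_cancel (H.hausdorffMeasure_ne_zero hd1) (H.hausdorffMeasure_ne_top hd1),
    ENNReal.toReal_one]

/-- Only an inequality holds, because other copies of K may overlap the image and add mass. -/
theorem FiniteTypeIFS.le_mass_affine {r c x y : ℝ} (hr : 0 < r)
    (h : ∀ z ∈ Icc x y, z ∈ K → r * z + c ∈ K) :
    r ^ hdim K * mass K x y ≤ mass K (r * x + c) (r * y + c) := by
  have hα := H.hdim_pos hd1
  have := H.isProbabilityMeasure hd1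
  have hsub : (fun z => r * z + c) '' (Icc x y ∩ K) ⊆ Icc (r * x + c) (r * y + c) ∩ K := by
    rintro _ ⟨z, ⟨hz, hzK⟩, rfl⟩
    refine ⟨⟨?_, ?_⟩, h z hz hzK⟩
    · have := mul_le_mul_of_nonneg_left hz.1 hr.le
      dsimp only; linarith
    · have := mul_le_mul_of_nonneg_left hz.2 hr.le
      dsimp only; linarith
  have hm := measure_mono (μ := μH[hdim K]) hsub
  rw [hausdorffMeasure_affine_image hα.le hr] at hm
  have hm' := mul_le_mul_right hm (μH[hdim K] K)⁻¹
  have e : r ^ hdim K * mass K x y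
      = (ENNReal.ofReal r ^ hdim K * normMeasure K (Icc x y)).toReal := by
    rw [ENNReal.toReal_mul, ENNReal.ofReal_rpow_of_pos hr,
      ENNReal.toReal_ofReal (Real.rpow_nonneg hr.le _), mass]
  rw [e, mass]
  refine ENNReal.toReal_mono (measure_ne_top _ _) ?_
  rw [normMeasure_apply K measurableSet_Icc, normMeasure_apply K measurableSet_Icc]
  refine le_trans (le_of_eq ?_) hm'
  ring

/-- The missing inequality is `le_mass_affine` for the inverse map. -/
theorem FiniteTypeIFS.mass_affine {r c x y : ℝ} (hr : 0 < r)
    (h : ∀ z ∈ Icc x y, (z ∈ K ↔ r * z + c ∈ K)) :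
    mass K (r * x + c) (r * y + c) = r ^ hdim K * mass K x y := by
  refine le_antisymm ?_ (H.le_mass_affine hd1 hr fun z hz => (h z hz).1)
  have key : ∀ z, r⁻¹ * (r * z + c) + -(r⁻¹ * c) = z := fun z => by field_simp; ring
  have key' : ∀ z, r * (r⁻¹ * z + -(r⁻¹ * c)) + c = z := fun z => by field_simp; ring
  have hinv := H.le_mass_affine hd1 (r := r⁻¹) (c := -(r⁻¹ * c)) (x := r * x + c) (y := r * y + c)
    (inv_pos.2 hr) fun z hz hzK => by
      have hz' : r⁻¹ * z + -(r⁻¹ * c) ∈ Icc x y := by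
        have h1 := mul_le_mul_of_nonneg_left hz.1 (inv_pos.2 hr).le
        have h2 := mul_le_mul_of_nonneg_left hz.2 (inv_pos.2 hr).le
        constructor
        · have := key x; linarith
        · have := key y; linarith
      rw [h _ hz', key']
      exact hzK
  rw [key, key, Real.inv_rpow hr.le] at hinv
  rwa [inv_mul_le_iff₀ (Real.rpow_pos_of_pos hr _)] at hinv

theorem FiniteTypeIFS.le_mass_vertex {k : ℕ} {f : ℝ → ℝ} (hf : f ∈ vertices S M k) {x y : ℝ} :
    (f 1 - f 0) ^ hdim K * mass K x y ≤ mass K (f x) (f y) := by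
  have h := H.le_mass_affine hd1 (c := f 0) (x := x) (y := y) (sub_pos.2 (vertex_lt hf))
    fun z _ hz => by rw [← vertex_apply hf]; exact H.vertex_mem hf hz
  rwa [← vertex_apply hf, ← vertex_apply hf] at h

theorem FiniteTypeIFS.mass_first_pos {x : ℝ} (hx : 0 < x) : 0 < mass K 0 x := by
  have hlim : ∀ᶠ p : ℕ in atTop, S.ρ 0 ^ p < x :=
    (tendsto_pow_atTop_nhds_zero_of_lt_one (S.ρ_pos 0).le (S.ρ_lt_one 0)).eventually_lt_const hx
  obtain ⟨p, hp⟩ := hlim.exists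
  have h := H.le_mass_affine hd1 (r := S.ρ 0 ^ p) (c := 0) (x := 0) (y := 1) (pow_pos (S.ρ_pos 0) p)
    fun z _ hz => by
      have := H.iterate_mem 0 p hz
      rw [H.iterate_first] at this
      simpa using this
  rw [H.mass_zero_one hd1] at h
  have h2 : (0 : ℝ) < (S.ρ 0 ^ p) ^ hdim K := Real.rpow_pos_of_pos (pow_pos (S.ρ_pos 0) p) _
  have h3 := H.mass_mono hd1 (x := S.ρ 0 ^ p * 0 + 0) (y := S.ρ 0 ^ p * 1 + 0) (x' := 0) (y' := x)
    (by simp) (by linarith)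
  linarith

theorem FiniteTypeIFS.mass_last_pos {x : ℝ} (hx : 0 < x) : 0 < mass K (1 - x) 1 := by
  have hlim : ∀ᶠ p : ℕ in atTop, S.ρ (Fin.last (n + 1)) ^ p < x :=
    (tendsto_pow_atTop_nhds_zero_of_lt_one (S.ρ_pos _).le (S.ρ_lt_one _)).eventually_lt_const hx
  obtain ⟨p, hp⟩ := hlim.exists
  have hρ := pow_pos (S.ρ_pos (Fin.last (n + 1))) p
  have h := H.le_mass_affine hd1 (r := S.ρ (Fin.last (n + 1)) ^ p)
    (c := 1 - S.ρ (Fin.last (n + 1)) ^ p) (x := 0) (y := 1) hρ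
    fun z _ hz => by
      have := H.iterate_mem (Fin.last (n + 1)) p hz
      rw [H.iterate_last] at this
      convert this using 1; ring
  rw [H.mass_zero_one hd1] at h
  have h2 : (0 : ℝ) < (S.ρ (Fin.last (n + 1)) ^ p) ^ hdim K := Real.rpow_pos_of_pos hρ _
  have h3 := H.mass_mono hd1 (x := S.ρ (Fin.last (n + 1)) ^ p * 0 + (1 - S.ρ (Fin.last (n + 1)) ^ p))
    (y := S.ρ (Fin.last (n + 1)) ^ p * 1 + (1 - S.ρ (Fin.last (n + 1)) ^ p))
    (x' := 1 - x) (y' := 1) (by linarith) (by linarith)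
  linarith

end Mass

/-! ### Densities at 0 and 1, and the endpoints of optimal intervals -/

section EndDensities

variable {n : ℕ} {S : LinearIFS (n + 2)} {M : ℕ → Finset (List (Fin (n + 2)))} {K : Set ℝ}
  (H : FiniteTypeIFS S M K) (hd1 : dimH K < 1)

open FiniteTypeIFS

theorem density_nonneg (K J : Set ℝ) : 0 ≤ density K J :=
  div_nonneg ENNReal.toReal_nonneg (Real.rpow_nonneg Metric.diam_nonneg _)

theorem bddBelow_density {ι : Type*} (g : ι → Set ℝ) (E : Set ι) :
    BddBelow ((fun x => density K (g x)) '' E) :=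
  ⟨0, by rintro _ ⟨x, -, rfl⟩; exact density_nonneg _ _⟩

include H hd1 in
theorem FiniteTypeIFS.lowerD0_mul_le {x : ℝ} (h0 : 0 ≤ x) (h1 : x ≤ 1) :
    lowerD0 K * x ^ hdim K ≤ mass K 0 x := by
  rcases eq_or_lt_of_le h0 with rfl | hx
  · rw [Real.zero_rpow (H.hdim_pos hd1).ne', mul_zero]
    exact mass_nonneg _ _ _
  have h : lowerD0 K ≤ density K (Icc 0 x) :=
    csInf_le (bddBelow_density _ _) (mem_image_of_mem _ ⟨hx, h1⟩)
  rwa [density_Icc K h0, sub_zero, le_div_iff₀ (Real.rpow_pos_of_pos hx _)] at h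

include H hd1 in
theorem FiniteTypeIFS.lowerD1_mul_le {x : ℝ} (h0 : 0 ≤ x) (h1 : x ≤ 1) :
    lowerD1 K * x ^ hdim K ≤ mass K (1 - x) 1 := by
  rcases eq_or_lt_of_le h0 with rfl | hx
  · rw [Real.zero_rpow (H.hdim_pos hd1).ne', mul_zero]
    exact mass_nonneg _ _ _
  have h : lowerD1 K ≤ density K (Icc (1 - x) 1) :=
    csInf_le (bddBelow_density (fun x => Icc (1 - x) 1) _) (mem_image_of_mem _ ⟨hx, h1⟩)
  rwa [density_Icc K (by linarith), sub_sub_cancel,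
    le_div_iff₀ (Real.rpow_pos_of_pos hx _)] at h

variable (hB : AssumptionB S K)

include H hd1 hB in
-- Assumption B excludes points of K in S_1([0,1]) from outside S_1(K), which turns the scaling
-- inequality into an equality. The density of [0,x] is thus invariant under x ↦ ρ_1 x.
theorem FiniteTypeIFS.mass_scale_first {x : ℝ} (h1 : x ≤ 1) :
    mass K 0 (S.ρ 0 * x) = S.ρ 0 ^ hdim K * mass K 0 x := by
  have h := H.mass_affine hd1 (r := S.ρ 0) (c := 0) (x := 0) (y := x) (S.ρ_pos 0)
    fun z hz => ⟨fun hzK => ?_, fun hzK => ?_⟩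
  · simpa using h
  · rw [add_zero, ← H.map_first]
    exact H.map_mem 0 hzK
  · rw [add_zero, ← H.map_first] at hzK
    have hm : S.map 0 z ∈ S.map 0 '' Icc 0 1 ∩ K :=
      ⟨mem_image_of_mem _ ⟨hz.1, hz.2.trans h1⟩, hzK⟩
    rw [hB.1] at hm
    obtain ⟨y, hy, hyz⟩ := hm
    rw [H.map_first, H.map_first] at hyz
    rwa [← mul_left_cancel₀ (S.ρ_pos 0).ne' hyz]

include H hd1 hB in
theorem FiniteTypeIFS.mass_scale_last {x : ℝ} (h1 : x ≤ 1) :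
    mass K (1 - S.ρ (Fin.last (n + 1)) * x) 1
      = S.ρ (Fin.last (n + 1)) ^ hdim K * mass K (1 - x) 1 := by
  have hmap : ∀ z, S.ρ (Fin.last (n + 1)) * z + (1 - S.ρ (Fin.last (n + 1)))
      = S.map (Fin.last (n + 1)) z := fun z => by rw [H.map_last]; ring
  have h := H.mass_affine hd1 (r := S.ρ (Fin.last (n + 1))) (c := 1 - S.ρ (Fin.last (n + 1)))
    (x := 1 - x) (y := 1) (S.ρ_pos _) fun z hz => ⟨fun hzK => ?_, fun hzK => ?_⟩
  · rw [← h]; congr 1 <;> ring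
  · rw [hmap]
    exact H.map_mem _ hzK
  · rw [hmap] at hzK
    have hm : S.map (Fin.last (n + 1)) z ∈ S.map (Fin.last (n + 1)) '' Icc 0 1 ∩ K :=
      ⟨mem_image_of_mem _ ⟨by linarith [hz.1], hz.2⟩, hzK⟩
    rw [hB.2] at hm
    obtain ⟨y, hy, hyz⟩ := hm
    rw [H.map_last, H.map_last] at hyz
    have := mul_left_cancel₀ (S.ρ_pos (Fin.last (n + 1))).ne' (sub_right_inj.1 hyz)
    rwa [show z = y by linarith]

/-- A function on `(0,1]` invariant under `x ↦ ρ x` and continuous attains its maximum and its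
minimum over `(0,1]` on `[ρ, 1]`. -/
theorem exists_extrema_of_scale_invariant {φ : ℝ → ℝ} {ρ : ℝ} (h0 : 0 < ρ) (h1 : ρ < 1)
    (hφ : ∀ x ∈ Ioc (0 : ℝ) 1, φ (ρ * x) = φ x) (hc : ContinuousOn φ (Icc ρ 1)) :
    (∃ x ∈ Icc ρ 1, ∀ y ∈ Ioc (0 : ℝ) 1, φ y ≤ φ x) ∧
      ∃ x ∈ Icc ρ 1, ∀ y ∈ Ioc (0 : ℝ) 1, φ x ≤ φ y := by
  have hred : ∀ y ∈ Ioc (0 : ℝ) 1, ∃ z ∈ Icc ρ 1, φ y = φ z := by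
    intro y hy
    -- Here ρ^(p+1) < y ≤ ρ^p, so dividing by ρ^p brings y into [ρ, 1].
    obtain ⟨p, hp1, hp2⟩ := exists_nat_pow_near_of_lt_one hy.1 hy.2 h0 h1
    have hpow := pow_pos h0 p
    have hz1 : y / ρ ^ p ≤ 1 := (div_le_one hpow).2 hp2
    have hz0 : ρ ≤ y / ρ ^ p := by
      rw [le_div_iff₀ hpow, ← pow_succ']; exact hp1.le
    refine ⟨y / ρ ^ p, ⟨hz0, hz1⟩, ?_⟩
    have : ∀ q : ℕ, ∀ z ∈ Ioc (0 : ℝ) 1, φ (ρ ^ q * z) = φ z := by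
      intro q z hz
      induction q with
      | zero => simp
      | succ q ih =>
        rw [pow_succ', mul_assoc, hφ, ih]
        exact ⟨mul_pos (pow_pos h0 q) hz.1,
          mul_le_one₀ (pow_le_one₀ h0.le h1.le) hz.1.le hz.2⟩
    have h := this p (y / ρ ^ p) ⟨h0.trans_le hz0, hz1⟩
    rwa [mul_div_cancel₀ _ hpow.ne'] at h
  have hne : (Icc ρ 1).Nonempty := nonempty_Icc.2 h1.le
  obtain ⟨x, hx, hmax⟩ := isCompact_Icc.exists_isMaxOn hne hc
  obtain ⟨x', hx', hmin⟩ := isCompact_Icc.exists_isMinOn hne hc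
  refine ⟨⟨x, hx, fun y hy => ?_⟩, x', hx', fun y hy => ?_⟩
  · obtain ⟨z, hz, e⟩ := hred y hy
    rw [e]; exact hmax hz
  · obtain ⟨z, hz, e⟩ := hred y hy
    rw [e]; exact hmin hz

include H hd1 hB in
theorem FiniteTypeIFS.exists_extrema_first :
    (∃ x ∈ Icc (S.ρ 0) 1, ∀ y ∈ Ioc (0 : ℝ) 1, density K (Icc 0 y) ≤ density K (Icc 0 x)) ∧
      ∃ x ∈ Icc (S.ρ 0) 1, ∀ y ∈ Ioc (0 : ℝ) 1, density K (Icc 0 x) ≤ density K (Icc 0 y) := by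
  have hρ := S.ρ_pos 0
  refine exists_extrema_of_scale_invariant hρ (S.ρ_lt_one 0) (fun x hx => ?_) ?_
  · rw [density_Icc K (mul_pos hρ hx.1).le, density_Icc K hx.1.le,
      H.mass_scale_first hd1 hB hx.2, sub_zero, sub_zero, Real.mul_rpow hρ.le hx.1.le,
      mul_div_mul_left _ _ (Real.rpow_pos_of_pos hρ _).ne']
  · have hc := H.continuous_mass hd1
    have : ContinuousOn (fun x => (∫ _ in (0 : ℝ)..x, (1 : ℝ) ∂(normMeasure K)) / x ^ hdim K)
        (Icc (S.ρ 0) 1) := by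
      refine ContinuousOn.div (hc.comp (by fun_prop : Continuous fun x : ℝ => ((0 : ℝ), x))).continuousOn
        (continuousOn_id.rpow_const fun x hx => Or.inl (hρ.trans_le hx.1).ne') fun x hx =>
          (Real.rpow_pos_of_pos (hρ.trans_le hx.1) _).ne'
    refine this.congr fun x hx => ?_
    have hx0 := (hρ.trans_le hx.1).le
    rw [density_Icc K hx0, H.mass_eq_integral hd1 hx0, sub_zero]

include H hd1 hB in
theorem FiniteTypeIFS.exists_extrema_last :
    (∃ x ∈ Icc (S.ρ (Fin.last (n + 1))) 1, ∀ y ∈ Ioc (0 : ℝ) 1,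
      density K (Icc (1 - y) 1) ≤ density K (Icc (1 - x) 1)) ∧
      ∃ x ∈ Icc (S.ρ (Fin.last (n + 1))) 1, ∀ y ∈ Ioc (0 : ℝ) 1,
        density K (Icc (1 - x) 1) ≤ density K (Icc (1 - y) 1) := by
  have hρ := S.ρ_pos (Fin.last (n + 1))
  refine exists_extrema_of_scale_invariant (φ := fun x => density K (Icc (1 - x) 1)) hρ
    (S.ρ_lt_one _) (fun x hx => ?_) ?_
  · rw [density_Icc K (by have := mul_pos hρ hx.1; linarith), density_Icc K (by linarith [hx.1]),
      H.mass_scale_last hd1 hB hx.2, sub_sub_cancel, sub_sub_cancel, Real.mul_rpow hρ.le hx.1.le,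
      mul_div_mul_left _ _ (Real.rpow_pos_of_pos hρ _).ne']
  · have hc := H.continuous_mass hd1
    have : ContinuousOn (fun x => (∫ _ in (1 - x)..1, (1 : ℝ) ∂(normMeasure K)) / x ^ hdim K)
        (Icc (S.ρ (Fin.last (n + 1))) 1) := by
      refine ContinuousOn.div
        (hc.comp (by fun_prop : Continuous fun x : ℝ => (1 - x, (1 : ℝ)))).continuousOn
        (continuousOn_id.rpow_const fun x hx => Or.inl (hρ.trans_le hx.1).ne') fun x hx =>
          (Real.rpow_pos_of_pos (hρ.trans_le hx.1) _).ne'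
    refine this.congr fun x hx => ?_
    have hx0 := (hρ.trans_le hx.1).le
    dsimp only
    rw [density_Icc K (by linarith), H.mass_eq_integral hd1 (by linarith), sub_sub_cancel]

include H hd1 in
theorem FiniteTypeIFS.density_first_pos {x : ℝ} (hx : 0 < x) : 0 < density K (Icc 0 x) := by
  rw [density_Icc K hx.le, sub_zero]
  exact div_pos (H.mass_first_pos hd1 hx) (Real.rpow_pos_of_pos hx _)

include H hd1 in
theorem FiniteTypeIFS.density_last_pos {x : ℝ} (hx : 0 < x) : 0 < density K (Icc (1 - x) 1) := by
  rw [density_Icc K (by linarith), sub_sub_cancel]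
  exact div_pos (H.mass_last_pos hd1 hx) (Real.rpow_pos_of_pos hx _)

include H hd1 hB in
-- Scale invariance reduces (0,1] to a compact interval, so the infimum of these positive densities
-- is attained.
theorem FiniteTypeIFS.lowerD0_pos : 0 < lowerD0 K := by
  obtain ⟨-, x, hx, hmin⟩ := H.exists_extrema_first hd1 hB
  refine (H.density_first_pos hd1 ((S.ρ_pos 0).trans_le hx.1)).trans_le ?_
  refine le_csInf ⟨_, mem_image_of_mem _ ⟨one_pos, le_rfl⟩⟩ ?_
  rintro _ ⟨y, hy, rfl⟩
  exact hmin y hy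

include H hd1 hB in
theorem FiniteTypeIFS.lowerD1_pos : 0 < lowerD1 K := by
  obtain ⟨-, x, hx, hmin⟩ := H.exists_extrema_last hd1 hB
  refine (H.density_last_pos hd1 ((S.ρ_pos _).trans_le hx.1)).trans_le ?_
  refine le_csInf ⟨_, mem_image_of_mem _ ⟨one_pos, le_rfl⟩⟩ ?_
  rintro _ ⟨y, hy, rfl⟩
  exact hmin y hy

include H hd1 in
/-- The right endpoint of an optimal interval is the right endpoint of an island. -/
theorem FiniteTypeIFS.isIsland_right_of_optimal {k : ℕ} {u x : ℝ} (hux : u < x) (hx1 : x ≤ 1)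
    (hpos : 0 < mass K u x)
    (hopt : ∀ x', u < x' → x' ≤ 1 → density K (Icc u x') ≤ density K (Icc u x))
    (hβ : betaMax S M k ^ (1 - hdim K) ≤ (x - u) * lowerD1 K) : ∃ a, IsIsland S M k a x := by
  have hα := H.hdim_pos hd1
  have hα1 := hdim_lt_one hd1
  have hxu : 0 < x - u := sub_pos.2 hux
  -- Otherwise x is interior to some f([0,1]). Extending to f(1) by δ = f(1) - x adds mass at least
  -- `lowerD1 K` times δ^α, because f copies the end of K at 1. Optimality then bounds (x - u) times
  -- `lowerD1 K` strictly by δ^(1-α), against `hβ` and δ ≤ β_max.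
  have hxU : x ∉ openUnion S M k := by
    intro hx
    obtain ⟨f, hf, hfx0, hfx1⟩ := mem_openUnion.1 hx
    have hlt := sub_pos.2 (vertex_lt hf)
    have hδ : 0 < f 1 - x := sub_pos.2 hfx1
    have h1 := hopt (f 1) (by linarith) (H.vertex_one_le hf)
    rw [density_Icc K (by linarith), density_Icc K hux.le,
      ← H.mass_add hd1 hux.le hfx1.le, div_le_iff₀ (Real.rpow_pos_of_pos (by linarith) _)] at h1
    have h2 : lowerD1 K * (f 1 - x) ^ hdim K ≤ mass K x (f 1) := by
      set z := (f 1 - x) / (f 1 - f 0) with hz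
      have hz0 : 0 ≤ z := (div_pos hδ hlt).le
      have hz1 : z ≤ 1 := (div_le_one hlt).2 (by linarith)
      have hzm : (f 1 - f 0) * z = f 1 - x := by rw [hz]; field_simp
      have h3 := H.le_mass_vertex hd1 hf (x := 1 - z) (y := 1)
      have e : f (1 - z) = x := by rw [vertex_apply hf, mul_sub, hzm]; ring
      rw [e] at h3
      refine le_trans ?_ h3
      rw [← hzm, Real.mul_rpow hlt.le hz0]
      have := mul_le_mul_of_nonneg_left (H.lowerD1_mul_le hd1 hz0 hz1)
        (Real.rpow_nonneg hlt.le (hdim K))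
      linarith
    have h3 := mul_lt_rpow_of_extension (D := lowerD1 K) hα hα1 hxu hδ hpos
      (H.mass_le_one hd1 u x) (by
        rw [show x - u + (f 1 - x) = f 1 - u by ring]
        linarith)
    have h4 : (f 1 - x) ^ (1 - hdim K) ≤ betaMax S M k ^ (1 - hdim K) :=
      Real.rpow_le_rpow hδ.le (by linarith [H.vertex_sub_le_betaMax hf]) (by linarith)
    linarith
  by_contra hno
  -- If f(1) = x, the island of f either ends at x, which is excluded, or contains x in its
  -- interior.
  have hf : ∀ f ∈ vertices S M k, f 0 < x → f 1 < x := by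
    intro f hf h0
    refine lt_of_le_of_ne (not_lt.1 fun h => hxU (mem_openUnion.2 ⟨f, hf, h0, h⟩)) fun h1 => ?_
    obtain ⟨a, b, h, ha, hb⟩ := H.exists_island_of_vertex hf
    have : b = x := le_antisymm (not_lt.1 fun hxb => hxU (h.Ioo_subset ⟨by linarith, hxb⟩))
      (by linarith)
    exact hno ⟨a, this ▸ h⟩
  have hev : ∀ᶠ y in nhdsWithin x (Iio x), ∀ f ∈ vertices S M k, f 0 < x → f 1 < y := by
    rw [eventually_all_finite (finite_vertices S M k)]
    intro f hfk
    by_cases h0 : f 0 < x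
    · exact ((eventually_gt_nhds (hf f hfk h0)).filter_mono nhdsWithin_le_nhds).mono fun y hy _ => hy
    · exact Eventually.of_forall fun y h => (h0 h).elim
  have hev2 : ∀ᶠ y in nhdsWithin x (Iio x), u < y :=
    (eventually_gt_nhds hux).filter_mono nhdsWithin_le_nhds
  obtain ⟨y, ⟨hy, huy⟩, hyx⟩ := ((hev.and hev2).and self_mem_nhdsWithin).exists
  -- All vertex intervals that start before x end before y, so (y,x) misses K. Cutting it off keeps
  -- the mass and shortens the interval, which raises the density.
  have hzero : mass K y x = 0 := by
    refine mass_eq_zero (fun z hz hzK => ?_) hα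
    obtain ⟨f, hfk, w, hw, rfl⟩ := H.exists_vertex_eq k hzK
    have hm := H.vertex_apply_mem_Icc hfk hw
    have := hy f hfk (hm.1.trans_lt hz.2)
    linarith [hm.2, hz.1]
  have h2 := hopt y huy (hyx.le.trans hx1)
  rw [density_Icc K huy.le, density_Icc K hux.le] at h2
  have hmass : mass K u y = mass K u x := by
    rw [← H.mass_add hd1 huy.le hyx.le, hzero, add_zero]
  rw [hmass] at h2
  exact absurd h2 (not_le.2 (div_lt_div_of_pos_left hpos
    (Real.rpow_pos_of_pos (by linarith) _) (Real.rpow_lt_rpow (by linarith) (by linarith) hα)))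

include H hd1 in
/-- The left endpoint of an optimal interval is the left endpoint of an island. -/
theorem FiniteTypeIFS.isIsland_left_of_optimal {k : ℕ} {x v : ℝ} (hxv : x < v) (hx0 : 0 ≤ x)
    (hpos : 0 < mass K x v)
    (hopt : ∀ x', x' < v → 0 ≤ x' → density K (Icc x' v) ≤ density K (Icc x v))
    (hβ : betaMax S M k ^ (1 - hdim K) ≤ (v - x) * lowerD0 K) : ∃ b, IsIsland S M k x b := by
  have hα := H.hdim_pos hd1
  have hα1 := hdim_lt_one hd1
  have hvx : 0 < v - x := sub_pos.2 hxv
  have hxU : x ∉ openUnion S M k := by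
    intro hx
    obtain ⟨f, hf, hfx0, hfx1⟩ := mem_openUnion.1 hx
    have hlt := sub_pos.2 (vertex_lt hf)
    have hδ : 0 < x - f 0 := sub_pos.2 hfx0
    have h1 := hopt (f 0) (by linarith) (H.vertex_zero_nonneg hf)
    rw [density_Icc K (by linarith), density_Icc K hxv.le,
      ← H.mass_add hd1 hfx0.le hxv.le, div_le_iff₀ (Real.rpow_pos_of_pos (by linarith) _)] at h1
    have h2 : lowerD0 K * (x - f 0) ^ hdim K ≤ mass K (f 0) x := by
      set z := (x - f 0) / (f 1 - f 0) with hz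
      have hz0 : 0 ≤ z := (div_pos hδ hlt).le
      have hz1 : z ≤ 1 := (div_le_one hlt).2 (by linarith)
      have hzm : (f 1 - f 0) * z = x - f 0 := by rw [hz]; field_simp
      have h3 := H.le_mass_vertex hd1 hf (x := 0) (y := z)
      have e : f z = x := by rw [vertex_apply hf, hzm]; ring
      rw [e] at h3
      refine le_trans ?_ h3
      rw [← hzm, Real.mul_rpow hlt.le hz0]
      have := mul_le_mul_of_nonneg_left (H.lowerD0_mul_le hd1 hz0 hz1)
        (Real.rpow_nonneg hlt.le (hdim K))
      linarith
    have h3 := mul_lt_rpow_of_extension (D := lowerD0 K) hα hα1 hvx hδ hpos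
      (H.mass_le_one hd1 x v) (by
        rw [show v - x + (x - f 0) = v - f 0 by ring]
        linarith)
    have h4 : (x - f 0) ^ (1 - hdim K) ≤ betaMax S M k ^ (1 - hdim K) :=
      Real.rpow_le_rpow hδ.le (by linarith [H.vertex_sub_le_betaMax hf]) (by linarith)
    linarith
  by_contra hno
  have hf : ∀ f ∈ vertices S M k, x < f 1 → x < f 0 := by
    intro f hf h0
    refine lt_of_le_of_ne (not_lt.1 fun h => hxU (mem_openUnion.2 ⟨f, hf, h, h0⟩)) fun h1 => ?_
    obtain ⟨a, b, h, ha, hb⟩ := H.exists_island_of_vertex hf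
    have : a = x := le_antisymm (by linarith)
      (not_lt.1 fun hxb => hxU (h.Ioo_subset ⟨hxb, by linarith⟩))
    exact hno ⟨b, this ▸ h⟩
  have hev : ∀ᶠ y in nhdsWithin x (Ioi x), ∀ f ∈ vertices S M k, x < f 1 → y < f 0 := by
    rw [eventually_all_finite (finite_vertices S M k)]
    intro f hfk
    by_cases h0 : x < f 1
    · exact ((eventually_lt_nhds (hf f hfk h0)).filter_mono nhdsWithin_le_nhds).mono fun y hy _ => hy
    · exact Eventually.of_forall fun y h => (h0 h).elim
  have hev2 : ∀ᶠ y in nhdsWithin x (Ioi x), y < v :=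
    (eventually_lt_nhds hxv).filter_mono nhdsWithin_le_nhds
  obtain ⟨y, ⟨hy, hyv⟩, hxy⟩ := ((hev.and hev2).and self_mem_nhdsWithin).exists
  have hzero : mass K x y = 0 := by
    refine mass_eq_zero (fun z hz hzK => ?_) hα
    obtain ⟨f, hfk, w, hw, rfl⟩ := H.exists_vertex_eq k hzK
    have hm := H.vertex_apply_mem_Icc hfk hw
    have := hy f hfk (hz.1.trans_le hm.2)
    linarith [hm.1, hz.2]
  have hxy' : x < y := hxy
  have h2 := hopt y hyv (hx0.trans hxy'.le)
  rw [density_Icc K hyv.le, density_Icc K hxv.le] at h2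
  have hmass : mass K y v = mass K x v := by
    rw [← H.mass_add hd1 hxy'.le hyv.le, hzero, zero_add]
  rw [hmass] at h2
  exact absurd h2 (not_le.2 (div_lt_div_of_pos_left hpos
    (Real.rpow_pos_of_pos (by linarith) _) (Real.rpow_lt_rpow (by linarith) (by linarith) hα)))

end EndDensities

/-! ### Combining two densities by Hölder's inequality -/

/-- The maximal density of two adjacent intervals with individual densities `A` and `B`, over all
proportions of their lengths. -/
noncomputable def combine (α A B : ℝ) : ℝ := (A ^ (1 / (1 - α)) + B ^ (1 / (1 - α))) ^ (1 - α)

theorem combine_mono {α A B A' B' : ℝ} (h1 : α < 1) (hA : 0 ≤ A) (hB : 0 ≤ B) (hAA : A ≤ A')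
    (hBB : B ≤ B') : combine α A B ≤ combine α A' B' := by
  have h : 0 ≤ 1 - α := by linarith
  have h' : 0 ≤ 1 / (1 - α) := by positivity
  unfold combine
  gcongr

/-- Hölder's inequality on two points with the conjugate exponents 1/(1-α) and 1/α. -/
theorem add_le_combine {α A B X Y : ℝ} (h0 : 0 < α) (h1 : α < 1) (hA : 0 ≤ A) (hB : 0 ≤ B)
    (hX : 0 ≤ X) (hY : 0 ≤ Y) : A * X ^ α + B * Y ^ α ≤ combine α A B * (X + Y) ^ α := by
  have hβ : 0 < 1 - α := sub_pos.2 h1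
  have hpq : (1 / (1 - α)).HolderConjugate (1 / α) := by
    rw [Real.holderConjugate_iff]
    refine ⟨?_, ?_⟩
    · rw [lt_div_iff₀ hβ]; linarith
    · rw [one_div, one_div, inv_inv, inv_inv]; ring
  have h := Real.inner_le_Lp_mul_Lq_of_nonneg (Finset.univ : Finset Bool) hpq
    (f := fun i => cond i A B) (g := fun i => cond i (X ^ α) (Y ^ α))
    (by rintro (_ | _) _ <;> assumption)
    (by rintro (_ | _) _ <;> exact Real.rpow_nonneg ‹_› _)
  simp only [Fintype.sum_bool, cond_true, cond_false, one_div_one_div] at h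
  rwa [← Real.rpow_mul hX, ← Real.rpow_mul hY, mul_one_div_cancel h0.ne', Real.rpow_one,
    Real.rpow_one] at h

/-- The equality case of Hölder: the optimal lengths are in proportion A^(1/(1-α)) : B^(1/(1-α)). -/
theorem combine_eq_of_proportion {α A B : ℝ} (h1 : α < 1) (hA : 0 < A) (hB : 0 < B) :
    A * (A ^ (1 / (1 - α))) ^ α + B * (B ^ (1 / (1 - α))) ^ α
      = combine α A B * (A ^ (1 / (1 - α)) + B ^ (1 / (1 - α))) ^ α := by
  have hβ : 0 < 1 - α := sub_pos.2 h1
  have key : ∀ A : ℝ, 0 < A → A * (A ^ (1 / (1 - α))) ^ α = A ^ (1 / (1 - α)) := by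
    intro A hA
    rw [← Real.rpow_mul hA.le]
    nth_rewrite 1 [← Real.rpow_one A]
    rw [← Real.rpow_add hA]
    congr 1; field_simp; ring
  have hs : 0 < A ^ (1 / (1 - α)) + B ^ (1 / (1 - α)) :=
    add_pos (Real.rpow_pos_of_pos hA _) (Real.rpow_pos_of_pos hB _)
  rw [key A hA, key B hB, combine, ← Real.rpow_add hs, sub_add_cancel, Real.rpow_one]

/-! ### The upper bound: magnification and touching points -/

section UpperBound

variable {n : ℕ} {S : LinearIFS (n + 2)} {M : ℕ → Finset (List (Fin (n + 2)))} {K : Set ℝ}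
  {k : ℕ} {a b c d : ℝ}

open FiniteTypeIFS

variable (H : FiniteTypeIFS S M K) (hd1 : dimH K < 1) (hA : AssumptionA S M)
include H hd1

section Ends
include hA

/-- Near the right endpoint of an island, `K` looks like it does near `1`. -/
theorem FiniteTypeIFS.mass_le_of_right_end {D x : ℝ} (h : IsIsland S M k a c)
    (hD : ∀ z ∈ Ioc (0 : ℝ) 1, density K (Icc (1 - z) 1) ≤ D) (hx : x < c)
    (hlt : c - x < eta S M * betaMin S M k) : mass K x c ≤ D * (c - x) ^ hdim K := by
  obtain ⟨p, hp⟩ := H.exists_isRightExponent hA ⟨k, a, c, h⟩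
  have hη := H.etaTwo_le_right hp
  obtain ⟨f, hf, hfc, hleast⟩ := hp
  have hf' : f ∈ vertices S M k := hf.1
  have hfc' : f 1 = c := hfc
  have hr := sub_pos.2 (vertex_lt hf')
  have h1 := H.etaOne_mul_le ⟨k, a, c, h⟩ hf (Or.inr hfc)
  have hβ := h.betaMin_le
  have hη1 := H.etaOne_pos
  have hη2 := H.etaTwo_pos hA
  have hρ := pow_pos (S.ρ_pos (Fin.last (n + 1))) p
  have hρ1 := pow_le_one₀ (n := p) (S.ρ_pos (Fin.last (n + 1))).le (S.ρ_lt_one _).le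
  -- Here η_1 compares the last constitutive interval with the island, and η_2 compares its final
  -- piece f S_m^p([0,1]) with that interval.
  have hlt' : c - x < (f 1 - f 0) * S.ρ (Fin.last (n + 1)) ^ p := by
    refine hlt.trans_le ?_
    calc eta S M * betaMin S M k = etaOne S M * betaMin S M k * etaTwo S M := by
          rw [eta]; ring
      _ ≤ (f 1 - f 0) * S.ρ (Fin.last (n + 1)) ^ p := by
          refine mul_le_mul ?_ hη hη2.le hr.le
          exact (mul_le_mul_of_nonneg_left hβ hη1.le).trans h1
  -- So [x,c] lies to the right of all the other constitutive intervals, and f alone contributes to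
  -- K there.
  have hfp : f ((S.map (Fin.last (n + 1)))^[p] 0) < x := by
    rw [vertex_apply hf', H.iterate_last]
    nlinarith
  set z := (c - x) / (f 1 - f 0) with hz
  have hz0 : 0 < z := div_pos (sub_pos.2 hx) hr
  have hzm : (f 1 - f 0) * z = c - x := by rw [hz]; field_simp
  have hz1 : z ≤ 1 := (div_le_one hr).2 (by nlinarith)
  have hmass := H.mass_affine hd1 (r := f 1 - f 0) (c := f 0) (x := 1 - z) (y := 1) hr
    fun w hw => by
      rw [← vertex_apply hf']
      refine ⟨fun hwK => H.vertex_mem hf' hwK, fun hwK => ?_⟩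
      have hwx : x ≤ f w := by
        rw [vertex_apply hf']
        have := mul_le_mul_of_nonneg_left hw.1 hr.le
        nlinarith
      have hwc : f w ≤ c := by
        rw [vertex_apply hf']
        have := mul_le_mul_of_nonneg_left hw.2 hr.le
        linarith
      have hwa : a ≤ f w := by
        have h2 := (mem_constituents.1 hf).2.1
        have h3 := mul_nonneg hr.le (show 0 ≤ w by linarith [hw.1])
        rw [vertex_apply hf']
        linarith
      obtain ⟨g, hg, y, hy, hgy⟩ := H.exists_constituent_eq h hwK ⟨hwa, hwc⟩
      by_cases hgf : g = f
      · subst hgf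
        rw [vertex_apply hf' y, vertex_apply hf' w, add_left_inj] at hgy
        rwa [← mul_left_cancel₀ hr.ne' hgy]
      · have h2 := hleast.1 g hg hgf
        have h3 := (H.vertex_apply_mem_Icc hg.1 hy).2
        linarith
  have e1 : (f 1 - f 0) * (1 - z) + f 0 = x := by rw [mul_sub, hzm]; linarith
  have e2 : (f 1 - f 0) * 1 + f 0 = c := by linarith
  rw [e1, e2] at hmass
  have hDz := hD z ⟨hz0, hz1⟩
  rw [density_Icc K (by linarith), sub_sub_cancel,
    div_le_iff₀ (Real.rpow_pos_of_pos hz0 _)] at hDz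
  rw [hmass, ← hzm, Real.mul_rpow hr.le hz0.le]
  have := mul_le_mul_of_nonneg_left hDz (Real.rpow_nonneg hr.le (hdim K))
  linarith

/-- Near the left endpoint of an island, `K` looks like it does near `0`. -/
theorem FiniteTypeIFS.mass_le_of_left_end {D y : ℝ} (h : IsIsland S M k c b)
    (hD : ∀ z ∈ Ioc (0 : ℝ) 1, density K (Icc 0 z) ≤ D) (hy : c < y)
    (hlt : y - c < eta S M * betaMin S M k) : mass K c y ≤ D * (y - c) ^ hdim K := by
  obtain ⟨p, hp⟩ := H.exists_isLeftExponent hA ⟨k, c, b, h⟩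
  have hη := H.etaTwo_le_left hp
  obtain ⟨f, hf, hfc, hleast⟩ := hp
  have hf' : f ∈ vertices S M k := hf.1
  have hfc' : f 0 = c := hfc
  have hr := sub_pos.2 (vertex_lt hf')
  have h1 := H.etaOne_mul_le ⟨k, c, b, h⟩ hf (Or.inl hfc)
  have hβ := h.betaMin_le
  have hη1 := H.etaOne_pos
  have hη2 := H.etaTwo_pos hA
  have hρ := pow_pos (S.ρ_pos 0) p
  have hρ1 := pow_le_one₀ (n := p) (S.ρ_pos 0).le (S.ρ_lt_one _).le
  have hlt' : y - c < (f 1 - f 0) * S.ρ 0 ^ p := by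
    refine hlt.trans_le ?_
    calc eta S M * betaMin S M k = etaOne S M * betaMin S M k * etaTwo S M := by
          rw [eta]; ring
      _ ≤ (f 1 - f 0) * S.ρ 0 ^ p := by
          refine mul_le_mul ?_ hη hη2.le hr.le
          exact (mul_le_mul_of_nonneg_left hβ hη1.le).trans h1
  have hfp : y < f ((S.map 0)^[p] 1) := by
    rw [vertex_apply hf', H.iterate_first]
    linarith
  set z := (y - c) / (f 1 - f 0) with hz
  have hz0 : 0 < z := div_pos (sub_pos.2 hy) hr
  have hzm : (f 1 - f 0) * z = y - c := by rw [hz]; field_simp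
  have hz1 : z ≤ 1 := (div_le_one hr).2 (by nlinarith)
  have hmass := H.mass_affine hd1 (r := f 1 - f 0) (c := f 0) (x := 0) (y := z) hr
    fun w hw => by
      rw [← vertex_apply hf']
      refine ⟨fun hwK => H.vertex_mem hf' hwK, fun hwK => ?_⟩
      have hwx : f w ≤ y := by
        rw [vertex_apply hf']
        have := mul_le_mul_of_nonneg_left hw.2 hr.le
        linarith
      have hwc : c ≤ f w := by
        rw [vertex_apply hf']
        have := mul_nonneg hr.le hw.1
        linarith
      have hwb : f w ≤ b := by
        have h2 := (mem_constituents.1 hf).2.2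
        have h3 := mul_le_mul_of_nonneg_left (hw.2.trans hz1) hr.le
        rw [vertex_apply hf']
        linarith
      obtain ⟨g, hg, v, hv, hgv⟩ := H.exists_constituent_eq h hwK ⟨hwc, hwb⟩
      by_cases hgf : g = f
      · subst hgf
        rw [vertex_apply hf' v, vertex_apply hf' w, add_left_inj] at hgv
        rwa [← mul_left_cancel₀ hr.ne' hgv]
      · have h2 := hleast.1 g hg hgf
        have h3 := (H.vertex_apply_mem_Icc hg.1 hv).1
        linarith
  have e1 : (f 1 - f 0) * z + f 0 = y := by rw [hzm]; linarith
  have e2 : (f 1 - f 0) * 0 + f 0 = c := by linarith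
  rw [e1, e2] at hmass
  have hDz := hD z ⟨hz0, hz1⟩
  rw [density_Icc K hz0.le, sub_zero, div_le_iff₀ (Real.rpow_pos_of_pos hz0 _)] at hDz
  rw [hmass, ← hzm, Real.mul_rpow hr.le hz0.le]
  have := mul_le_mul_of_nonneg_left hDz (Real.rpow_nonneg hr.le (hdim K))
  linarith

end Ends

/-- Every interval with endpoints in `K` can be moved into an island of generation at most `k₀`,
without changing its density, such that it does not lie in an island of generation `k₀ + 1`. -/
theorem FiniteTypeIFS.exists_magnification {k₀ : ℕ} (hk₀ : NoNewType S M k₀) {x y : ℝ} (hxy : x < y)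
    (hx : x ∈ K) (hy : y ∈ K) : ∃ x' y', x' < y' ∧ x' ∈ K ∧ y' ∈ K ∧
      density K (Icc x y) = density K (Icc x' y') ∧
      ∀ e f, IsIsland S M (k₀ + 1) e f → e ≤ x' → y' ≤ f → False := by
  classical
  -- The first generation in which no island contains [x,y] is not generation 0. Its predecessor j
  -- supplies the island to be moved.
  have hex : ∃ k, ¬ ∃ a b, IsIsland S M k a b ∧ a ≤ x ∧ y ≤ b := by
    obtain ⟨k, hk⟩ := (H.tendsto_betaMax.eventually_lt_const (sub_pos.2 hxy)).exists
    refine ⟨k, ?_⟩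
    rintro ⟨a, b, h, ha, hb⟩
    linarith [h.le_betaMax]
  have hspec := Nat.find_spec hex
  rcases hj : Nat.find hex with _ | j
  · rw [hj] at hspec
    exact (hspec ⟨0, 1, H.island_zero_iff.2 ⟨rfl, rfl⟩, (H.subset_Icc hx).1,
      (H.subset_Icc hy).2⟩).elim
  rw [hj] at hspec
  have hmin := Nat.find_min hex (show j < Nat.find hex by omega)
  push Not at hmin
  obtain ⟨a, b, h, ha, hb⟩ := hmin
  obtain ⟨k', a', b', s, t, hk', h', hsim⟩ := H.exists_similarity hk₀ h
  have hs := hsim.pos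
  have hsub : ∀ z ∈ Icc x y, z ∈ Icc a b := fun z hz => ⟨ha.trans hz.1, hz.2.trans hb⟩
  have hlt : s * x < s * y := by rwa [mul_lt_mul_iff_right₀ hs]
  refine ⟨s * x + t, s * y + t, by linarith,
    (hsim.mem_iff x (hsub x (left_mem_Icc.2 hxy.le))).1 hx,
    (hsim.mem_iff y (hsub y (right_mem_Icc.2 hxy.le))).1 hy, ?_, ?_⟩
  · rw [density_Icc K hxy.le, density_Icc K (by linarith),
      H.mass_affine hd1 hs fun z hz => hsim.mem_iff z (hsub z hz), add_sub_add_right_eq_sub,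
      ← mul_sub, Real.mul_rpow hs.le (sub_nonneg.2 hxy.le),
      mul_div_mul_left _ _ (Real.rpow_pos_of_pos hs _).ne']
  · intro e f hef hex' hyf
    -- If the moved interval lay in an island of generation k₀ + 1, then it would lie in one of
    -- generation k' + 1 ≤ k₀ + 1. That one is an offspring of [a',b'], since its parent overlaps
    -- [a',b'], and pulling it back gives an island of generation j + 1 containing [x,y].
    obtain ⟨p, q, hpq, hpe, hfq⟩ := H.exists_ancestor (Nat.succ_le_succ hk') hef
    obtain ⟨u, v, huv, hup, hqv⟩ := H.exists_parent hpq
    have hax : a' ≤ s * x + t := by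
      have := mul_le_mul_of_nonneg_left ha hs.le
      rw [← hsim.left]; linarith
    have hyb : s * y + t ≤ b' := by
      have := mul_le_mul_of_nonneg_left hb hs.le
      rw [← hsim.right]; linarith
    have heq : u = a' ∧ v = b' := by
      rcases huv.trichotomy h' with h | h | h
      · exact h
      · linarith
      · linarith
    obtain ⟨rfl, rfl⟩ := heq
    have ep : s * ((p - t) / s) + t = p := by field_simp; ring
    have eq : s * ((q - t) / s) + t = q := by field_simp; ring
    have hD := hsim.descendant_iff 1 le_rfl ((p - t) / s) ((q - t) / s)
    rw [ep, eq] at hD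
    obtain ⟨hi, -, -⟩ := hD.2 ⟨hpq, hup, hqv⟩
    refine hspec ⟨_, _, hi, ?_, ?_⟩
    · rw [div_le_iff₀ hs]; linarith
    · rw [le_div_iff₀ hs]; linarith

omit hd1 in
/-- An interval with endpoints in `K` which does not lie in an island of generation `k` is long, or
lies in the union of two touching islands. -/
theorem FiniteTypeIFS.long_or_straddle {x y : ℝ} (hxy : x < y) (hx : x ∈ K) (hy : y ∈ K)
    (hno : ∀ e f, IsIsland S M k e f → e ≤ x → y ≤ f → False) :
    min (betaMin S M k) (gammaMinStar S M k) ≤ y - x ∨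
      ∃ a c b, IsIsland S M k a c ∧ IsIsland S M k c b ∧ x < c ∧ c < y := by
  obtain ⟨a, c, hA, hxA⟩ := H.exists_island_of_mem k hx
  obtain ⟨d, e, hB, hyB⟩ := H.exists_island_of_mem k hy
  have hcd : c ≤ d := by
    rcases hA.trichotomy hB with ⟨rfl, rfl⟩ | h | h
    · exact (hno _ _ hA hxA.1 hyB.2).elim
    · exact h
    · linarith [hxA.1, hyB.2]
  obtain ⟨u, v, hU, hcu, hud, hlake⟩ := hA.exists_next hB hcd
  -- Look at the next island to the right of that of x. A positive gap is a lake inside [x,y].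
  -- Without a gap, this island is either that of y, giving the touching point, or lies entirely
  -- within [x,y].
  rcases eq_or_lt_of_le hcu with rfl | hlt
  · rcases hU.trichotomy hB with ⟨rfl, rfl⟩ | h | h
    · right
      refine ⟨a, c, v, hA, hU, lt_of_le_of_ne hxA.2 fun h => ?_, lt_of_le_of_ne hyB.1 fun h => ?_⟩
      · exact hno _ _ hU h.ge hyB.2
      · exact hno _ _ hA hxA.1 h.ge
    · left
      refine (min_le_left _ _).trans (hU.betaMin_le.trans ?_)
      linarith [hxA.2, hyB.1]
    · linarith [hU.lt, hB.lt]
  · left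
    refine (min_le_right _ _).trans ((gammaMinStar_le hlake (sub_pos.2 hlt)).trans ?_)
    linarith [hxA.2, hyB.1]

include hA in
/-- The densities of all intervals are bounded by those of long intervals and the combinations of
the densities at `0` and at `1`. -/
theorem FiniteTypeIFS.density_le {k₀ : ℕ} (hk₀ : NoNewType S M k₀) {D₀ D₁ B : ℝ}
    (hD₀ : ∀ z ∈ Ioc (0 : ℝ) 1, density K (Icc 0 z) ≤ D₀)
    (hD₁ : ∀ z ∈ Ioc (0 : ℝ) 1, density K (Icc (1 - z) 1) ≤ D₁)
    (hlong : ∀ x y, 0 ≤ x → y ≤ 1 →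
      eta S M * min (betaMin S M (k₀ + 1)) (gammaMinStar S M (k₀ + 1)) ≤ y - x →
      density K (Icc x y) ≤ B) (hcomb : combine (hdim K) D₀ D₁ ≤ B) {J : Set ℝ}
    (hJ : J.OrdConnected) (hJ01 : J ⊆ Icc 0 1) : density K J ≤ B := by
  have hα := H.hdim_pos hd1
  have hα1 := hdim_lt_one hd1
  have h01 : (1 : ℝ) ∈ Ioc (0 : ℝ) 1 := ⟨one_pos, le_rfl⟩
  have hD₀0 : 0 ≤ D₀ := (density_nonneg _ _).trans (hD₀ 1 h01)
  have hD₁0 : 0 ≤ D₁ := (density_nonneg _ _).trans (hD₁ 1 h01)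
  have hγ := H.gammaMinStar_pos hk₀ hd1
  have hβ := H.betaMin_pos (k₀ + 1)
  have hη := H.eta_pos hA
  have hη1 := H.eta_le_one hA
  have hB0 : 0 ≤ B := by
    refine le_trans ?_ hcomb
    unfold combine; positivity
  have main : ∀ x y, x < y → x ∈ K → y ∈ K → density K (Icc x y) ≤ B := by
    intro x y hxy hx hy
    obtain ⟨x', y', hxy', hx', hy', heq, hno⟩ := H.exists_magnification hd1 hk₀ hxy hx hy
    rw [heq]
    by_cases hc : eta S M * min (betaMin S M (k₀ + 1)) (gammaMinStar S M (k₀ + 1)) ≤ y' - x'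
    · exact hlong x' y' (H.subset_Icc hx').1 (H.subset_Icc hy').2 hc
    push Not at hc
    rcases H.long_or_straddle hxy' hx' hy' hno with h | ⟨a, c, b, hac, hcb, hxc, hcy⟩
    · have : eta S M * min (betaMin S M (k₀ + 1)) (gammaMinStar S M (k₀ + 1))
          ≤ min (betaMin S M (k₀ + 1)) (gammaMinStar S M (k₀ + 1)) :=
        mul_le_of_le_one_left (lt_min hβ hγ).le hη1
      linarith
    have hc' : y' - x' < eta S M * betaMin S M (k₀ + 1) :=
      hc.trans_le (mul_le_mul_of_nonneg_left (min_le_left _ _) hη.le)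
    -- The interval is shorter than η β_min, so each side of the touching point sees only one end of
    -- K; Hölder then combines the two sides.
    have h1 := H.mass_le_of_right_end hd1 hA hac hD₁ hxc (by linarith)
    have h2 := H.mass_le_of_left_end hd1 hA hcb hD₀ hcy (by linarith)
    have h3 := add_le_combine hα hα1 hD₀0 hD₁0 (sub_nonneg.2 hcy.le) (sub_nonneg.2 hxc.le)
    rw [density_Icc K hxy'.le, div_le_iff₀ (Real.rpow_pos_of_pos (sub_pos.2 hxy') _),
      ← H.mass_add hd1 hxc.le hcy.le]
    have h4 : combine (hdim K) D₀ D₁ * (y' - c + (c - x')) ^ hdim K ≤ B * (y' - x') ^ hdim K := by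
      rw [show y' - c + (c - x') = y' - x' by ring]
      exact mul_le_mul_of_nonneg_right hcomb (Real.rpow_nonneg (by linarith) _)
    linarith
  -- For an arbitrary J of positive mass, the hull of J ∩ K carries at least the mass of J, has no
  -- larger diameter, and has its endpoints in K.
  by_cases hzero : normMeasure K J = 0
  · rw [density, hzero]; simpa using hB0
  have hE : (J ∩ K).Nonempty := by
    by_contra hne
    rw [not_nonempty_iff_eq_empty] at hne
    rw [normMeasure_apply K hJ.measurableSet, hne] at hzero
    simp at hzero
  have hb : Bornology.IsBounded (J ∩ K) := H.attractor.1.isBounded.subset inter_subset_right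
  have hxK : sInf (J ∩ K) ∈ K := by
    exact H.attractor.1.isClosed.closure_subset_iff.2 inter_subset_right (csInf_mem_closure hE hb.bddBelow)
  have hyK : sSup (J ∩ K) ∈ K := by
    exact H.attractor.1.isClosed.closure_subset_iff.2 inter_subset_right (csSup_mem_closure hE hb.bddAbove)
  have hsub : J ∩ K ⊆ Icc (sInf (J ∩ K)) (sSup (J ∩ K)) := fun z hz =>
    ⟨csInf_le hb.bddBelow hz, le_csSup hb.bddAbove hz⟩
  have hmeas : normMeasure K J ≤ normMeasure K (Icc (sInf (J ∩ K)) (sSup (J ∩ K))) := by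
    rw [normMeasure_apply K hJ.measurableSet, normMeasure_apply K measurableSet_Icc]
    exact mul_le_mul_right (measure_mono (subset_inter hsub inter_subset_right)) _
  have := H.isProbabilityMeasure hd1
  have hlt : sInf (J ∩ K) < sSup (J ∩ K) := by
    refine lt_of_le_of_ne (Real.sInf_le_sSup _ hb.bddBelow hb.bddAbove) fun heq => hzero ?_
    have := H.nullSingletonClass hd1
    rw [heq, Icc_self, measure_singleton] at hmeas
    exact le_antisymm hmeas zero_le
  refine le_trans ?_ (main _ _ hlt hxK hyK)
  have hJb : Bornology.IsBounded J := (Metric.isBounded_Icc 0 1).subset hJ01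
  have hdiam : sSup (J ∩ K) - sInf (J ∩ K) ≤ Metric.diam J := by
    rw [← Real.diam_eq hb]
    exact Metric.diam_mono inter_subset_left hJb
  rw [density_Icc K hlt.le, density]
  refine div_le_div₀ (mass_nonneg _ _ _) (ENNReal.toReal_mono (measure_ne_top _ _) hmeas)
    (Real.rpow_pos_of_pos (sub_pos.2 hlt) _) (Real.rpow_le_rpow (sub_pos.2 hlt).le hdiam hα.le)

/-- The density attains its maximum over the intervals of length at least `c₀`. -/
theorem FiniteTypeIFS.exists_max_density {c₀ : ℝ} (h0 : 0 < c₀) (h1 : c₀ ≤ 1) :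
    ∃ x y, 0 ≤ x ∧ y ≤ 1 ∧ c₀ ≤ y - x ∧ ∀ u v, 0 ≤ u → v ≤ 1 → c₀ ≤ v - u →
      density K (Icc u v) ≤ density K (Icc x y) := by
  let Q : Set (ℝ × ℝ) := {p | 0 ≤ p.1 ∧ p.2 ≤ 1 ∧ c₀ ≤ p.2 - p.1}
  have hQ : IsCompact Q := by
    refine (isCompact_Icc.prod isCompact_Icc : IsCompact (Icc (0 : ℝ) 1 ×ˢ Icc (0 : ℝ) 1)).of_isClosed_subset
      ?_ ?_
    · exact (isClosed_le continuous_const continuous_fst).inter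
        ((isClosed_le continuous_snd continuous_const).inter
          (isClosed_le continuous_const (continuous_snd.sub continuous_fst)))
    · rintro ⟨x, y⟩ ⟨hx, hy, hxy⟩
      dsimp only at hx hy hxy
      exact ⟨⟨hx, by dsimp only; linarith⟩, ⟨by dsimp only; linarith, hy⟩⟩
  have hne : Q.Nonempty := ⟨(0, 1), le_rfl, le_rfl, by dsimp only; linarith⟩
  have hc : ContinuousOn (fun p : ℝ × ℝ => density K (Icc p.1 p.2)) Q := by
    have : ContinuousOn (fun p : ℝ × ℝ => (∫ _ in p.1..p.2, (1 : ℝ) ∂(normMeasure K)) /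
        (p.2 - p.1) ^ hdim K) Q :=
      (H.continuous_mass hd1).continuousOn.div
        ((continuous_snd.sub continuous_fst).continuousOn.rpow_const
          fun p hp => Or.inl (h0.trans_le hp.2.2).ne')
        fun p hp => (Real.rpow_pos_of_pos (h0.trans_le hp.2.2) _).ne'
    refine this.congr fun p hp => ?_
    have hp' : p.1 ≤ p.2 := by linarith [hp.2.2]
    rw [density_Icc K hp', H.mass_eq_integral hd1 hp']
  obtain ⟨⟨x, y⟩, ⟨hx, hy, hxy⟩, hmax⟩ := hQ.exists_isMaxOn hne hc
  exact ⟨x, y, hx, hy, hxy, fun u v hu hv huv => hmax (show (u, v) ∈ Q from ⟨hu, hv, huv⟩)⟩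

end UpperBound

/-! ### Density of quotients of powers -/

/-- The differences of natural multiples of two incommensurable positive numbers are dense. -/
theorem exists_nat_mul_sub_mem_Ioo {a β u v : ℝ} (ha : 0 < a) (hβ : 0 < β)
    (hirr : Irrational (a / β)) (huv : u < v) : ∃ n m : ℕ, n * a - m * β ∈ Ioo u v := by
  have : Fact (0 < β) := ⟨hβ⟩
  have hd := AddCircle.denseRange_zsmul_coe_iff.2 hirr
  obtain ⟨t, ht⟩ := exists_between huv
  -- Clustering along n → ∞, rather than mere density of the integer multiples, leaves n free to be
  -- large.
  have hcl : MapClusterPt (t : AddCircle β) atTop (fun n : ℕ => n • (a : AddCircle β)) :=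
    ((mapClusterPt_atTop_nsmul_tfae (t : AddCircle β) (a : AddCircle β)).out 0 3).2 (hd _)
  have hopen : IsOpen ((fun x : ℝ => (x : AddCircle β)) '' Ioo u v) :=
    QuotientAddGroup.isOpenMap_coe _ isOpen_Ioo
  have hfreq := hcl.frequently (hopen.mem_nhds (mem_image_of_mem _ ht))
  -- With n a > v the multiple of β to be subtracted is positive, so its coefficient is a natural
  -- number.
  have hlarge : ∀ᶠ n : ℕ in atTop, v < n * a :=
    (tendsto_natCast_atTop_atTop.atTop_mul_const ha).eventually_gt_atTop v
  obtain ⟨n, ⟨z, hz, hzn⟩, hn⟩ := (hfreq.and_eventually hlarge).exists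
  dsimp only at hzn
  rw [← AddCircle.coe_nsmul, eq_comm, ← sub_eq_zero, ← AddCircle.coe_sub,
    AddCircle.coe_eq_zero_iff] at hzn
  obtain ⟨m, hm⟩ := hzn
  rw [zsmul_eq_mul, nsmul_eq_mul] at hm
  have hm0 : 0 ≤ m := by
    by_contra hneg
    push Not at hneg
    have : (m : ℝ) < 0 := by exact_mod_cast hneg
    nlinarith [hz.2]
  lift m to ℕ using hm0
  refine ⟨n, m, ?_⟩
  rw [Int.cast_natCast] at hm
  rw [hm, sub_sub_cancel]
  exact hz

/-- If no positive powers of `a, b ∈ (0,1)` agree, the quotients of their powers are dense. -/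
theorem exists_pow_div_pow_mem_Ioo {a b u v : ℝ} (ha0 : 0 < a) (ha1 : a < 1) (hb0 : 0 < b)
    (hb1 : b < 1) (hna : ∀ n m : ℕ, 0 < n → 0 < m → a ^ n ≠ b ^ m) (hu : 0 < u) (huv : u < v) :
    ∃ p q : ℕ, a ^ p / b ^ q ∈ Ioo u v := by
  have hla := Real.log_neg ha0 ha1
  have hlb := Real.log_neg hb0 hb1
  -- A rational quotient of logarithms would make a positive power of a equal to a positive power of
  -- b.
  have hirr : Irrational (-Real.log b / -Real.log a) := by
    rintro ⟨r, hr⟩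
    have hr0 : (0 : ℝ) < (r : ℝ) := by rw [hr]; exact div_pos (by linarith) (by linarith)
    have hr0' : 0 < r := by exact_mod_cast hr0
    have hnum : 0 < r.num := Rat.num_pos.2 hr0'
    have hcast : (r : ℝ) = (r.num.toNat : ℝ) / (r.den : ℝ) := by
      rw [Rat.cast_def]
      congr 1
      exact_mod_cast (Int.toNat_of_nonneg hnum.le).symm
    have hden : (0 : ℝ) < r.den := by exact_mod_cast r.pos
    rw [hcast, div_eq_div_iff hden.ne' (by linarith)] at hr
    refine hna r.num.toNat r.den (by omega) r.pos ?_
    apply Real.log_injOn_pos (pow_pos ha0 _) (pow_pos hb0 _)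
    rw [Real.log_pow, Real.log_pow]
    linarith
  obtain ⟨q, p, h1, h2⟩ := exists_nat_mul_sub_mem_Ioo (u := Real.log u) (v := Real.log v)
    (neg_pos.2 hlb) (neg_pos.2 hla) hirr (Real.log_lt_log hu huv)
  have hpos : 0 < a ^ p / b ^ q := div_pos (pow_pos ha0 _) (pow_pos hb0 _)
  have hlog : Real.log (a ^ p / b ^ q) = q * -Real.log b - p * -Real.log a := by
    rw [Real.log_div (pow_pos ha0 _).ne' (pow_pos hb0 _).ne', Real.log_pow, Real.log_pow]
    ring
  rw [← hlog] at h1 h2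
  exact ⟨p, q, (Real.log_lt_log_iff hu hpos).1 h1, (Real.log_lt_log_iff hpos (hu.trans huv)).1 h2⟩

/-! ### The lower bound: all proportions at a touching point -/

section LowerBound

variable {n : ℕ} {S : LinearIFS (n + 2)} {M : ℕ → Finset (List (Fin (n + 2)))} {K : Set ℝ}
  {k : ℕ} {a b c : ℝ}

open FiniteTypeIFS

variable (H : FiniteTypeIFS S M K) (hd1 : dimH K < 1)
include H hd1

/-- The intervals `[0, x]` and `[1 - y, 1]` can be copied to the two sides of a touching point, at
all scales given by the powers of the first and of the last ratio. -/
theorem FiniteTypeIFS.add_le_of_touching {D x y : ℝ} (hac : IsIsland S M k a c)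
    (hcb : IsIsland S M k c b) (hD : ∀ x y, 0 ≤ x → x < y → y ≤ 1 → density K (Icc x y) ≤ D)
    (hx : x ∈ Ioc (0 : ℝ) 1) (hy : y ∈ Ioc (0 : ℝ) 1) :
    ∃ σ₀ σ₁ : ℝ, 0 < σ₀ ∧ 0 < σ₁ ∧ ∀ p q : ℕ,
      density K (Icc 0 x) * (σ₀ * S.ρ 0 ^ p * x) ^ hdim K +
        density K (Icc (1 - y) 1) * (σ₁ * S.ρ (Fin.last (n + 1)) ^ q * y) ^ hdim K ≤
      D * (σ₀ * S.ρ 0 ^ p * x + σ₁ * S.ρ (Fin.last (n + 1)) ^ q * y) ^ hdim K := by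
  obtain ⟨f, hf, hfc⟩ := hac.exists_right
  obtain ⟨g, hg, hgc⟩ := hcb.exists_left
  have hfr := sub_pos.2 (vertex_lt hf.1)
  have hgr := sub_pos.2 (vertex_lt hg.1)
  -- The constants are the ratios of the constitutive maps that start and end at c. Since S_1 fixes
  -- 0 and S_m fixes 1, the maps g S_1^p and f S_m^q still send 0 and 1 to c.
  refine ⟨g 1 - g 0, f 1 - f 0, hgr, hfr, fun p q => ?_⟩
  have hρp := pow_pos (S.ρ_pos 0) p
  have hρq := pow_pos (S.ρ_pos (Fin.last (n + 1))) q
  have hρp1 := pow_le_one₀ (n := p) (S.ρ_pos 0).le (S.ρ_lt_one 0).le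
  have hρq1 := pow_le_one₀ (n := q) (S.ρ_pos (Fin.last (n + 1))).le (S.ρ_lt_one _).le
  set s := (g 1 - g 0) * S.ρ 0 ^ p with hs
  set r := (f 1 - f 0) * S.ρ (Fin.last (n + 1)) ^ q with hr
  have hs0 : 0 < s := mul_pos hgr hρp
  have hr0 : 0 < r := mul_pos hfr hρq
  have h1 := H.le_mass_affine hd1 (c := c) (x := 0) (y := x) hs0 fun z _ hz => by
    have := H.vertex_mem hg.1 (H.iterate_mem 0 p hz)
    rw [H.iterate_first, vertex_apply hg.1] at this
    convert this using 1
    rw [hs, ← hgc]; ring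
  have h2 := H.le_mass_affine hd1 (c := c - r) (x := 1 - y) (y := 1) hr0 fun z _ hz => by
    have := H.vertex_mem hf.1 (H.iterate_mem (Fin.last (n + 1)) q hz)
    rw [H.iterate_last, vertex_apply hf.1] at this
    convert this using 1
    rw [hr, ← hfc]; ring
  have e1 : s * 0 + c = c := by ring
  have e2 : r * (1 - y) + (c - r) = c - r * y := by ring
  have e3 : r * 1 + (c - r) = c := by ring
  rw [e1] at h1
  rw [e2, e3] at h2
  have hsx : 0 < s * x := mul_pos hs0 hx.1
  have hry : 0 < r * y := mul_pos hr0 hy.1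
  have hg1 := H.vertex_one_le hg.1
  have hf0 := H.vertex_zero_nonneg hf.1
  have hs1 : s ≤ g 1 - g 0 := mul_le_of_le_one_right hgr.le hρp1
  have hr1 : r ≤ f 1 - f 0 := mul_le_of_le_one_right hfr.le hρq1
  have hsx1 : s * x ≤ s := mul_le_of_le_one_right hs0.le hx.2
  have hry1 : r * y ≤ r := mul_le_of_le_one_right hr0.le hy.2
  have h3 := hD (c - r * y) (s * x + c) (by linarith) (by linarith) (by linarith)
  rw [density_Icc K (by linarith), div_le_iff₀ (Real.rpow_pos_of_pos (by linarith) _),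
    ← H.mass_add hd1 (show c - r * y ≤ c by linarith) (by linarith),
    show s * x + c - (c - r * y) = s * x + r * y by ring] at h3
  have h4 : density K (Icc 0 x) * (s * x) ^ hdim K = s ^ hdim K * mass K 0 x := by
    have := (Real.rpow_pos_of_pos hx.1 (hdim K)).ne'
    rw [density_Icc K hx.1.le, sub_zero, Real.mul_rpow hs0.le hx.1.le]
    field_simp
  have h5 : density K (Icc (1 - y) 1) * (r * y) ^ hdim K = r ^ hdim K * mass K (1 - y) 1 := by
    have := (Real.rpow_pos_of_pos hy.1 (hdim K)).ne'
    rw [density_Icc K (by linarith [hy.1]), sub_sub_cancel, Real.mul_rpow hr0.le hy.1.le]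
    field_simp
  rw [h4, h5]
  linarith

/-- At a touching point all combinations of densities at `0` and at `1` are approximated. -/
theorem FiniteTypeIFS.combine_le_of_touching {D x y : ℝ} (hac : IsIsland S M k a c)
    (hcb : IsIsland S M k c b)
    (hna : ∀ n₁ nₘ : ℕ, 0 < n₁ → 0 < nₘ → S.ρ 0 ^ n₁ ≠ S.ρ (Fin.last (n + 1)) ^ nₘ)
    (hD : ∀ x y, 0 ≤ x → x < y → y ≤ 1 → density K (Icc x y) ≤ D)
    (hx : x ∈ Ioc (0 : ℝ) 1) (hy : y ∈ Ioc (0 : ℝ) 1) :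
    combine (hdim K) (density K (Icc 0 x)) (density K (Icc (1 - y) 1)) ≤ D := by
  have hα := H.hdim_pos hd1
  have hα1 := hdim_lt_one hd1
  obtain ⟨σ₀, σ₁, h0, h1, hle⟩ := H.add_le_of_touching hd1 hac hcb hD hx hy
  have hA := H.density_first_pos hd1 hx.1
  have hB := H.density_last_pos hd1 hy.1
  set A := density K (Icc 0 x)
  set B := density K (Icc (1 - y) 1)
  have hκ : 0 < σ₀ * x / (σ₁ * y) := div_pos (mul_pos h0 hx.1) (mul_pos h1 hy.1)
  set κ := σ₀ * x / (σ₁ * y) with hκdef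
  -- By homogeneity only the proportion t of the right part to the left part matters; these are the
  -- proportions reached by powers.
  have hdiscrete : ∀ p q : ℕ,
      A * (κ * (S.ρ 0 ^ p / S.ρ (Fin.last (n + 1)) ^ q)) ^ hdim K + B ≤
        D * (κ * (S.ρ 0 ^ p / S.ρ (Fin.last (n + 1)) ^ q) + 1) ^ hdim K := by
    intro p q
    have hρp := pow_pos (S.ρ_pos 0) p
    have hρq := pow_pos (S.ρ_pos (Fin.last (n + 1))) q
    set Y := σ₁ * S.ρ (Fin.last (n + 1)) ^ q * y with hY
    have hY0 : 0 < Y := mul_pos (mul_pos h1 hρq) hy.1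
    set t := κ * (S.ρ 0 ^ p / S.ρ (Fin.last (n + 1)) ^ q) with ht
    have ht0 : 0 < t := mul_pos hκ (div_pos hρp hρq)
    have hX : σ₀ * S.ρ 0 ^ p * x = t * Y := by
      have := hy.1.ne'
      rw [ht, hY, hκdef]; field_simp
    have h := hle p q
    rw [hX, ← hY, show t * Y + Y = (t + 1) * Y by ring, Real.mul_rpow ht0.le hY0.le,
      Real.mul_rpow (by linarith) hY0.le] at h
    have hYα := Real.rpow_pos_of_pos hY0 (hdim K)
    have h' : (A * t ^ hdim K + B) * Y ^ hdim K ≤ D * (t + 1) ^ hdim K * Y ^ hdim K := by linarith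
    exact le_of_mul_le_mul_right h' hYα
  -- A violation would persist near t, where non-arithmeticity provides an attainable proportion.
  have hcont : ∀ t, 0 < t → A * t ^ hdim K + B ≤ D * (t + 1) ^ hdim K := by
    intro t ht
    by_contra hlt
    push Not at hlt
    have hcA : ContinuousAt (fun t : ℝ => A * t ^ hdim K + B) t :=
      ((Real.continuousAt_rpow_const _ _ (Or.inl ht.ne')).const_mul A).add continuousAt_const
    have hcD : ContinuousAt (fun t : ℝ => D * (t + 1) ^ hdim K) t :=
      ((continuousAt_id.add continuousAt_const).rpow_const
        (Or.inl (show t + 1 ≠ 0 by positivity))).const_mul D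
    have hev : ∀ᶠ s in nhds t, D * (s + 1) ^ hdim K < A * s ^ hdim K + B :=
      hcD.eventually_lt hcA hlt
    have hev2 : ∀ᶠ s in nhds t, 0 < s := eventually_gt_nhds ht
    obtain ⟨ε, hε, hball⟩ := Metric.eventually_nhds_iff.1 (hev.and hev2)
    obtain ⟨p, q, hp1, hp2⟩ := exists_pow_div_pow_mem_Ioo (S.ρ_pos 0) (S.ρ_lt_one 0)
      (S.ρ_pos (Fin.last (n + 1))) (S.ρ_lt_one _) hna (div_pos ht hκ)
      (show t / κ < (t + ε) / κ from div_lt_div_of_pos_right (by linarith) hκ)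
    rw [div_lt_iff₀ hκ] at hp1
    rw [lt_div_iff₀ hκ] at hp2
    have hd : dist (κ * (S.ρ 0 ^ p / S.ρ (Fin.last (n + 1)) ^ q)) t < ε := by
      rw [Real.dist_eq, abs_lt]; constructor <;> linarith
    exact absurd (hdiscrete p q) (not_le.2 (hball hd).1)
  set X := A ^ (1 / (1 - hdim K)) with hX
  set Y := B ^ (1 / (1 - hdim K)) with hY
  have hX0 : 0 < X := Real.rpow_pos_of_pos hA _
  have hY0 : 0 < Y := Real.rpow_pos_of_pos hB _
  -- This is the proportion of equality in Hölder's inequality.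
  have h := hcont (X / Y) (div_pos hX0 hY0)
  have hYα := Real.rpow_pos_of_pos hY0 (hdim K)
  have e1 : (X / Y) ^ hdim K * Y ^ hdim K = X ^ hdim K := by
    rw [← Real.mul_rpow (div_pos hX0 hY0).le hY0.le, div_mul_cancel₀ _ hY0.ne']
  have e2 : (X / Y + 1) ^ hdim K * Y ^ hdim K = (X + Y) ^ hdim K := by
    rw [← Real.mul_rpow (by positivity) hY0.le, add_mul, div_mul_cancel₀ _ hY0.ne', one_mul]
  have h' := mul_le_mul_of_nonneg_right h hYα.le
  rw [add_mul, mul_assoc, e1, mul_assoc, e2, combine_eq_of_proportion hα1 hA hB] at h'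
  exact le_of_mul_le_mul_right h' (Real.rpow_pos_of_pos (add_pos hX0 hY0) _)

end LowerBound

/-! ### Field intervals and the thresholds for the generations -/

section FieldIntervals

variable {n : ℕ} {S : LinearIFS (n + 2)} {M : ℕ → Finset (List (Fin (n + 2)))} {K : Set ℝ}

theorem finite_fieldIntervals (S : LinearIFS (n + 2)) (M : ℕ → Finset (List (Fin (n + 2)))) (k : ℕ) :
    {p : ℝ × ℝ | IsFieldInterval S M k p.1 p.2}.Finite := by
  have hf := finite_islands S M k
  refine ((hf.image fun p => p.1).prod (hf.image fun p => p.2)).subset ?_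
  rintro ⟨x, y⟩ ⟨-, ⟨y', h⟩, x', h'⟩
  exact ⟨⟨(x, y'), h, rfl⟩, ⟨(x', y), h', rfl⟩⟩

theorem FiniteTypeIFS.fieldInterval_bounds (H : FiniteTypeIFS S M K) {k : ℕ} {x y : ℝ}
    (h : IsFieldInterval S M k x y) : 0 ≤ x ∧ x < y ∧ y ≤ 1 := by
  obtain ⟨h1, ⟨y', h2⟩, x', h3⟩ := h
  exact ⟨(H.island_bounds h2).1, h1, (H.island_bounds h3).2⟩

theorem FiniteTypeIFS.exists_isLeast_betaMax (H : FiniteTypeIFS S M K) {C R : ℝ} (hR : 0 < R) :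
    ∃ k, IsLeast {k | C * betaMax S M k ≤ R} k := by
  apply Nat.exists_isLeast
  have h := H.tendsto_betaMax.const_mul C
  rw [mul_zero] at h
  obtain ⟨k, hk⟩ := (h.eventually_lt_const hR).exists
  exact ⟨k, hk.le⟩

theorem FiniteTypeIFS.betaMax_nonneg (H : FiniteTypeIFS S M K) (k : ℕ) : 0 ≤ betaMax S M k := by
  obtain ⟨b, h⟩ := H.exists_first_island k
  linarith [h.le_betaMax, h.lt]

theorem rpow_le_of_le_rpow {α β X : ℝ} (h1 : α < 1) (hβ : 0 ≤ β) (hX : 0 ≤ X)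
    (h : β ≤ X ^ (1 / (1 - α))) : β ^ (1 - α) ≤ X := by
  have hα : 0 < 1 - α := sub_pos.2 h1
  calc β ^ (1 - α) ≤ (X ^ (1 / (1 - α))) ^ (1 - α) := Real.rpow_le_rpow hβ h hα.le
    _ = X := by rw [← Real.rpow_mul hX, one_div_mul_cancel hα.ne', Real.rpow_one]

end FieldIntervals

/-! ### The maximal density as a finite maximum -/

theorem theorem4p12 {n : ℕ} (S : LinearIFS (n + 2)) (M : ℕ → Finset (List (Fin (n + 2))))
    (K : Set ℝ) (hK : S.IsAttractor K)
    -- `(0,1)` is invariant, the first interval starts at `0` and the last one stops at `1`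
    (hinv : ∀ j, S.map j '' Set.Ioo 0 1 ⊆ Set.Ioo 0 1)
    (h0 : S.map 0 0 = 0) (h1 : S.map (Fin.last (n + 1)) 1 = 1)
    -- the generalized finite type condition, realized by the index sets `M`
    (hM : IsNestedIndexSeq M) (hnested : Antitone (openUnion S M))
    (hfin : Finite (OverlapType S M))
    -- the dimension is less than one, and the weighted incidence matrix is irreducible
    (hdim1 : dimH K < 1)
    (rep : OverlapType S M → Island S M) (hrep : ∀ T, (rep T).type = T)
    (hirr : (weightedIncidence rep (hdim K)).IsIrreducible)
    (hA : AssumptionA S M) (hB : AssumptionB S K)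
    (k₀ : ℕ) (hk₀ : IsLeast {k | NoNewType S M k} k₀)
    -- there are touching islands of generation `k₀ + 1`
    (htouch : IsLeast (lakeLengths S M (k₀ + 1)) 0)
    -- the ratios of the first and the last map are non-arithmetic
    (hna : ∀ n₁ nₘ : ℕ, 0 < n₁ → 0 < nₘ → S.ρ 0 ^ n₁ ≠ S.ρ (Fin.last (n + 1)) ^ nₘ) :
    ∃ k k₁ k₂ : ℕ,
      IsLeast {k | 2 * betaMax S M k ≤
        (eta S M * min (betaMin S M (k₀ + 1)) (gammaMinStar S M (k₀ + 1)) *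
          min (lowerD0 K) (lowerD1 K)) ^ (1 / (1 - hdim K))} k ∧
      IsLeast {k | betaMax S M k ≤ (S.ρ 0 * lowerD1 K) ^ (1 / (1 - hdim K))} k₁ ∧
      IsLeast {k | betaMax S M k ≤
        (S.ρ (Fin.last (n + 1)) * lowerD0 K) ^ (1 / (1 - hdim K))} k₂ ∧
      {r | ∃ x y, IsFieldInterval S M k x y ∧ r = density K (Set.Icc x y)}.Finite ∧
      {r | ∃ x y, IsFieldInterval S M k₁ 0 x ∧ IsFieldInterval S M k₂ y 1 ∧
        r = (density K (Set.Icc 0 x) ^ (1 / (1 - hdim K)) +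
          density K (Set.Icc y 1) ^ (1 / (1 - hdim K))) ^ (1 - hdim K)}.Finite ∧
      IsGreatest
        ({r | ∃ x y, IsFieldInterval S M k x y ∧ r = density K (Set.Icc x y)} ∪
          {r | ∃ x y, IsFieldInterval S M k₁ 0 x ∧ IsFieldInterval S M k₂ y 1 ∧
            r = (density K (Set.Icc 0 x) ^ (1 / (1 - hdim K)) +
              density K (Set.Icc y 1) ^ (1 / (1 - hdim K))) ^ (1 - hdim K)})
        (dMax K) := by
  have H : FiniteTypeIFS S M K := ⟨hK, hinv, h0, h1, hM, hnested, hfin⟩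
  have hα1 := hdim_lt_one hdim1
  have hN : NoNewType S M k₀ := hk₀.1
  have hD0 := H.lowerD0_pos hdim1 hB
  have hD1 := H.lowerD1_pos hdim1 hB
  have hη := H.eta_pos hA
  have hη1 := H.eta_le_one hA
  have hβ := H.betaMin_pos (k₀ + 1)
  have hγ := H.gammaMinStar_pos hN hdim1
  have hρ0 := S.ρ_pos 0
  have hρ1 := S.ρ_pos (Fin.last (n + 1))
  -- The threshold below which magnified intervals are governed by the combination `C` alone.
  set c₀ := eta S M * min (betaMin S M (k₀ + 1)) (gammaMinStar S M (k₀ + 1)) with hc₀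
  have hc₀0 : 0 < c₀ := mul_pos hη (lt_min hβ hγ)
  have hc₀1 : c₀ ≤ 1 := by
    obtain ⟨b, hb⟩ := H.exists_first_island (k₀ + 1)
    have h2 : betaMin S M (k₀ + 1) ≤ 1 := by linarith [hb.betaMin_le, (H.island_bounds hb).2]
    exact mul_le_one₀ hη1 (lt_min hβ hγ).le ((min_le_left _ _).trans h2)
  obtain ⟨⟨x₀, hx₀, hmax₀⟩, -⟩ := H.exists_extrema_first hdim1 hB
  obtain ⟨⟨x₁, hx₁, hmax₁⟩, -⟩ := H.exists_extrema_last hdim1 hB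
  have hx₀' : x₀ ∈ Ioc (0 : ℝ) 1 := ⟨hρ0.trans_le hx₀.1, hx₀.2⟩
  have hx₁' : x₁ ∈ Ioc (0 : ℝ) 1 := ⟨hρ1.trans_le hx₁.1, hx₁.2⟩
  -- An optimal interval among those of length at least c₀. It is optimal among all intervals
  -- precisely when its density is not below `C`.
  obtain ⟨u, v, hu, hv, huv, hmax⟩ := H.exists_max_density hdim1 hc₀0 hc₀1
  have huv' : u < v := by linarith
  set C := combine (hdim K) (density K (Icc 0 x₀)) (density K (Icc (1 - x₁) 1)) with hC
  have hall : ∀ J : Set ℝ, J.OrdConnected → J ⊆ Icc 0 1 →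
      density K J ≤ max (density K (Icc u v)) C := fun J hJ hJ01 =>
    H.density_le hdim1 hA hN hmax₀ hmax₁
      (fun x y hx hy hxy => (hmax x y hx hy hxy).trans (le_max_left _ _)) (le_max_right _ _) hJ hJ01
  have hle_dMax : ∀ x y, 0 ≤ x → x < y → y ≤ 1 → density K (Icc x y) ≤ dMax K := by
    intro x y hx hxy hy
    refine le_csSup ⟨max (density K (Icc u v)) C, ?_⟩
      ⟨Icc x y, ordConnected_Icc, ⟨x, left_mem_Icc.2 hxy.le, y, right_mem_Icc.2 hxy.le, hxy.ne⟩, Icc_subset_Icc hx hy, rfl⟩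
    rintro r ⟨J, hJ, -, hJ01, rfl⟩
    exact hall J hJ hJ01
  have hC_le : C ≤ dMax K := by
    obtain ⟨⟨l, a, c, hac⟩, ⟨l', c', b, hcb⟩, hl, hl', -, -, hlake⟩ := htouch.1
    dsimp only at hl hl' hlake
    subst hl hl'
    obtain rfl : c' = c := by linarith
    exact H.combine_le_of_touching hdim1 hac hcb hna hle_dMax hx₀' hx₁'
  have hdMax : dMax K = max (density K (Icc u v)) C := by
    refine le_antisymm (csSup_le ⟨_, Icc 0 1, ordConnected_Icc, ⟨0, by simp, 1, by simp, zero_ne_one⟩,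
      Subset.rfl, rfl⟩ ?_) (max_le (hle_dMax u v hu huv' hv) hC_le)
    rintro r ⟨J, hJ, -, hJ01, rfl⟩
    exact hall J hJ hJ01
  obtain ⟨k, hk⟩ := H.exists_isLeast_betaMax (C := 2)
    (Real.rpow_pos_of_pos (mul_pos hc₀0 (lt_min hD0 hD1)) (1 / (1 - hdim K)))
  obtain ⟨k₁, hk₁⟩ := H.exists_isLeast_betaMax (C := 1)
    (Real.rpow_pos_of_pos (mul_pos hρ0 hD1) (1 / (1 - hdim K)))
  obtain ⟨k₂, hk₂⟩ := H.exists_isLeast_betaMax (C := 1)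
    (Real.rpow_pos_of_pos (mul_pos hρ1 hD0) (1 / (1 - hdim K)))
  simp only [one_mul] at hk₁ hk₂
  refine ⟨k, k₁, k₂, hk, hk₁, hk₂, ?_, ?_, ?_, ?_⟩
  · refine ((finite_fieldIntervals S M k).image fun p => density K (Icc p.1 p.2)).subset ?_
    rintro r ⟨x, y, h, rfl⟩
    exact ⟨(x, y), h, rfl⟩
  · refine (((finite_fieldIntervals S M k₁).prod (finite_fieldIntervals S M k₂)).image
      fun p => combine (hdim K) (density K (Icc p.1.1 p.1.2)) (density K (Icc p.2.1 p.2.2))).subset ?_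
    rintro r ⟨x, y, h, h', rfl⟩
    exact ⟨((0, x), (y, 1)), ⟨h, h'⟩, rfl⟩
  · rcases max_choice (density K (Icc u v)) C with hcase | hcase
    · left
      rw [hcase] at hdMax
      -- As [0,1] has density 1 and competes with [u,v], the density of [u,v] is at least 1.
      have hpos : 0 < mass K u v := by
        have h2 := hmax 0 1 le_rfl le_rfl (by linarith)
        rw [density_Icc K zero_le_one, H.mass_zero_one hdim1, sub_zero, Real.one_rpow, div_one,
          density_Icc K huv'.le, one_le_div (Real.rpow_pos_of_pos (by linarith) _)] at h2
        exact (Real.rpow_pos_of_pos (by linarith) _).trans_le h2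
      -- The threshold for k, with the factor 2 weakened to 1, is what moving either endpoint of an
      -- interval of length at least c₀ requires.
      have hβk : betaMax S M k ^ (1 - hdim K) ≤ c₀ * min (lowerD0 K) (lowerD1 K) := by
        refine rpow_le_of_le_rpow hα1 (H.betaMax_nonneg k) (mul_pos hc₀0 (lt_min hD0 hD1)).le ?_
        have h2 := hk.1
        rw [mem_ofPred_eq] at h2
        linarith [H.betaMax_nonneg k]
      have hl := H.isIsland_left_of_optimal hdim1 (k := k) huv' hu hpos
        (fun x' hx' hx0 => by rw [← hdMax]; exact hle_dMax x' v hx0 hx' hv)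
        (hβk.trans (mul_le_mul huv (min_le_left _ _) (lt_min hD0 hD1).le (by linarith)))
      have hr := H.isIsland_right_of_optimal hdim1 (k := k) huv' hv hpos
        (fun x' hx' hx1 => by rw [← hdMax]; exact hle_dMax u x' hu hx' hx1)
        (hβk.trans (mul_le_mul huv (min_le_right _ _) (lt_min hD0 hD1).le (by linarith)))
      exact ⟨u, v, ⟨huv', hl, hr⟩, hdMax⟩
    · right
      rw [hcase] at hdMax
      -- Only the right endpoint of [0,x₀] is moved, so maximality among the intervals [0,x'] is
      -- enough. The length is at least ρ_1, whence the threshold defining k₁.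
      have hr := H.isIsland_right_of_optimal hdim1 (k := k₁) hx₀'.1 hx₀'.2
        (H.mass_first_pos hdim1 hx₀'.1) (fun x' hx' hx1 => hmax₀ x' ⟨hx', hx1⟩)
        ((rpow_le_of_le_rpow hα1 (H.betaMax_nonneg k₁) (mul_pos hρ0 hD1).le hk₁.1).trans
          (mul_le_mul_of_nonneg_right (by linarith [hx₀.1]) hD1.le))
      have hl := H.isIsland_left_of_optimal hdim1 (k := k₂) (x := 1 - x₁) (v := 1)
        (by linarith [hx₁'.1]) (by linarith [hx₁'.2]) (H.mass_last_pos hdim1 hx₁'.1)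
        (fun x' hx' hx0 => by
          have := hmax₁ (1 - x') ⟨by linarith, by linarith⟩
          rwa [sub_sub_cancel] at this)
        ((rpow_le_of_le_rpow hα1 (H.betaMax_nonneg k₂) (mul_pos hρ1 hD0).le hk₂.1).trans
          (mul_le_mul_of_nonneg_right (by linarith [hx₁.1]) hD0.le))
      exact ⟨x₀, 1 - x₁, ⟨hx₀'.1, H.exists_first_island k₁, hr⟩,
        ⟨by linarith [hx₁'.1], hl, H.exists_last_island k₂⟩, hdMax⟩
  · rintro r (⟨x, y, h, rfl⟩ | ⟨x, y, h, h', rfl⟩)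
    · obtain ⟨hx, hxy, hy⟩ := H.fieldInterval_bounds h
      exact hle_dMax x y hx hxy hy
    · obtain ⟨-, hx0, hx1⟩ := H.fieldInterval_bounds h
      obtain ⟨hy0, hy1, -⟩ := H.fieldInterval_bounds h'
      have h2 := hmax₁ (1 - y) ⟨by linarith, by linarith⟩
      rw [sub_sub_cancel] at h2
      exact (combine_mono hα1 (density_nonneg _ _) (density_nonneg _ _)
        (hmax₀ x ⟨hx0, hx1⟩) h2).trans hC_le
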